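/- For a field $K$ of characteristic different from $2$ let $W(K)$ be its Witt ring (isometry classes of non-degenerate quadratic forms under $\oplus$ and $\otimes$, modulo the ideal generated by $\langle 1,-1\rangle$), and let $\mathrm{Et}_n(K)$ be the set of isomorphism classes of étale $K$-algebras of rank $n$. Let $\mathrm{Inv}(n)$ be the ring of Witt invariants of degree $n$, i.e. of families of maps $\alpha_K\colon \mathrm{Et}_n(K)\to W(K)$, for all fields $K$ of characteristic $\neq 2$, which are compatible with extension of scalars along all field extensions $K\to L$. For $A\in \mathrm{Et}_n(K)$ let $\mathrm{Tr}(A)$ be the trace form $x\mapsto \mathrm{tr}_{A/K}(x^2)$, and for $a\in K^*$ let $\mathcal E_a=K[x]/(x^2-a)$. Let $P_i^m$ denote the $i$-th elementary symmetric polynomial in $m$ variables. Let $n\ge 1$ and $m=\lfloor n/2\rfloor$. Define $\lambda_i=\lambda_i^n\in \mathrm{Inv}(n)$ by $\lambda_i(A)=\bigwedge^i \mathrm{Tr}(A)$. For each $0\le i\le m$ there is a unique $\beta_i=\beta_i^n\in\mathrm{Inv}(n)$ such that for all $K$ and all $a_1,\dots,a_m\in K^*$ $$\beta_i(\mathcal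 E_{a_1}\times\dots\times\mathcal E_{a_m}\times K^{n-2m})=P_i^m(\mathrm{Tr}\,\mathcal E_{a_1},\dots,\mathrm{Tr}\,\mathcal E_{a_m}).$$ Put $$\gamma_{i,k}^m=\sum_{j=k}^{i}(-1)^{j-k}\left(\!\!\binom{m}{j-k}\!\!\right)\binom{m-j}{i-j},\qquad \delta_{i,k}^m=\sum_{j=k}^{i}(-1)^{j-k}\binom{m-k}{j-k}\binom{m}{i-j},$$ where $\left(\!\binom{m}{j}\!\right)$ is the number of multisets of size $j$ from $m$ elements, that is $\binom{m+j-1}{j}$ (equal to $1$ for $j=0$), and an empty sum is $0$. Then $(\beta_i)_{0\le i\le m}$ (the so-called $\beta$-basis) and $(\lambda_i)_{0\le i\le m}$ (Serre's $\lambda$-basis) are related as follows, for all $0\le i\le m$, where $\langle 2^e\rangle\in\mathrm{Inv}(n)$ is the constant invariant with value the class of the form $2^ex^2$. If $n=2m$, then $$\beta_i=\sum_{k=0}^i\langle 2^{i-k}\rangle\,\gamma_{i,k}^m\,\lambda_k,\qquad \lambda_i=\sum_{k=0}^i\langle 2^{i-k}\rangle\,\delta_{i,k}^m\,\beta_k .$$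 If $n=2m+1$, then $$\beta_i=\sum_{k=0}^i\Bigl(\sum_{u=k}^i(-1)^{u-k}\langle 2^{i-u}\rangle\,\gamma_{i,u}^m\Bigr)\lambda_k,\qquad \lambda_i=\sum_{k=0}^i\langle 2^{i-k}\rangle\bigl(\delta_{i,k}^m+\langle 2\rangle\,\delta_{i-1,k}^m\bigr)\beta_k .$$ -/

import Mathlib

universe u v

namespace WittInv

/-! ### Isometry classes of non-degenerate symmetric bilinear forms -/

section Forms

open scoped Kronecker

variable {K : Type u} [Field K]

/-- Two Gram matrices are congruent when an invertible change of coordinates carries the one to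
the other, that is, when the corresponding bilinear forms are isometric. -/
def Congruent {ι : Type*} {κ : Type*} [Fintype ι] [Fintype κ] [DecidableEq ι] [DecidableEq κ]
    (A : Matrix ι ι K) (B : Matrix κ κ K) : Prop :=
  ∃ (P : Matrix ι κ K) (Q : Matrix κ ι K), P * Q = 1 ∧ Q * P = 1 ∧ P.transpose * A * P = B

section Congruent

variable {ι κ μ ν : Type*} [Fintype ι] [Fintype κ] [Fintype μ] [Fintype ν]
  [DecidableEq ι] [DecidableEq κ] [DecidableEq μ] [DecidableEq ν]
  {A : Matrix ι ι K} {B : Matrix κ κ K} {C : Matrix μ μ K} {D : Matrix ν ν K}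

theorem Congruent.refl (A : Matrix ι ι K) : Congruent A A := ⟨1, 1, by simp, by simp, by simp⟩

theorem Congruent.symm (h : Congruent A B) : Congruent B A := by
  obtain ⟨P, Q, h1, h2, rfl⟩ := h
  refine ⟨Q, P, h2, h1, ?_⟩
  have h3 : Q.transpose * P.transpose = 1 := by rw [← Matrix.transpose_mul, h1]; simp
  calc Q.transpose * (P.transpose * A * P) * Q
      = (Q.transpose * P.transpose) * A * (P * Q) := by simp only [Matrix.mul_assoc]
    _ = A := by rw [h3, h1]; simp

theorem Congruent.trans (h : Congruent A B) (h' : Congruent B C) : Congruent A C := by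
  obtain ⟨P, Q, h1, h2, rfl⟩ := h
  obtain ⟨P', Q', h1', h2', rfl⟩ := h'
  refine ⟨P * P', Q' * Q, ?_, ?_, ?_⟩
  · rw [Matrix.mul_assoc, ← Matrix.mul_assoc P', h1']; simpa using h1
  · rw [Matrix.mul_assoc, ← Matrix.mul_assoc Q, h2]; simpa using h2'
  · rw [Matrix.transpose_mul]; simp only [Matrix.mul_assoc]

theorem Congruent.of_submatrix (A : Matrix ι ι K) (e : κ ≃ ι) : Congruent A (A.submatrix e e) := by
  refine ⟨(1 : Matrix ι ι K).submatrix id e, (1 : Matrix ι ι K).submatrix e id, ?_, ?_, ?_⟩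
  · rw [Matrix.submatrix_mul_equiv]; simp
  · ext i j; simp [Matrix.mul_apply, Matrix.one_apply]
  · ext i j; simp [Matrix.mul_apply, Matrix.one_apply]

theorem Congruent.of_eq_submatrix (e : κ ≃ ι) (h : A.submatrix e e = B) : Congruent A B :=
  h ▸ Congruent.of_submatrix A e

theorem Congruent.fromBlocks (h : Congruent A B) (h' : Congruent C D) :
    Congruent (Matrix.fromBlocks A 0 0 C) (Matrix.fromBlocks B 0 0 D) := by
  obtain ⟨P, Q, h1, h2, rfl⟩ := h
  obtain ⟨P', Q', h1', h2', rfl⟩ := h'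
  refine ⟨Matrix.fromBlocks P 0 0 P', Matrix.fromBlocks Q 0 0 Q', ?_, ?_, ?_⟩ <;>
    simp [Matrix.fromBlocks_multiply, Matrix.fromBlocks_transpose, *]

theorem Congruent.kronecker (h : Congruent A B) (h' : Congruent C D) :
    Congruent (A ⊗ₖ C) (B ⊗ₖ D) := by
  obtain ⟨P, Q, h1, h2, rfl⟩ := h
  obtain ⟨P', Q', h1', h2', rfl⟩ := h'
  refine ⟨P ⊗ₖ P', Q ⊗ₖ Q', ?_, ?_, ?_⟩
  · rw [← Matrix.mul_kronecker_mul, h1, h1', Matrix.one_kronecker_one]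
  · rw [← Matrix.mul_kronecker_mul, h2, h2', Matrix.one_kronecker_one]
  · rw [Matrix.mul_kronecker_mul, Matrix.mul_kronecker_mul]; rfl

theorem Congruent.map {L : Type v} [Field L] (φ : K →+* L) (h : Congruent A B) :
    Congruent (A.map φ) (B.map φ) := by
  obtain ⟨P, Q, h1, h2, rfl⟩ := h
  refine ⟨P.map φ, Q.map φ, ?_, ?_, ?_⟩
  · rw [← Matrix.map_mul, h1]; simp
  · rw [← Matrix.map_mul, h2]; simp
  · rw [Matrix.map_mul, Matrix.map_mul]; rfl

end Congruent

/-- `A` is the Gram matrix of a non-degenerate symmetric bilinear form. -/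
def IsGram {ι : Type*} [Fintype ι] [DecidableEq ι] (A : Matrix ι ι K) : Prop :=
  A.IsSymm ∧ IsUnit A.det

section IsGram

variable {ι κ : Type*} [Fintype ι] [Fintype κ] [DecidableEq ι] [DecidableEq κ]
  {A : Matrix ι ι K} {B : Matrix κ κ K}

theorem IsGram.submatrix (h : IsGram A) (e : κ ≃ ι) : IsGram (A.submatrix e e) :=
  ⟨h.1.submatrix e, by rw [Matrix.det_submatrix_equiv_self]; exact h.2⟩

theorem IsGram.fromBlocks (h : IsGram A) (h' : IsGram B) :
    IsGram (Matrix.fromBlocks A 0 0 B) :=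
  ⟨Matrix.IsSymm.fromBlocks h.1 (by simp) h'.1,
    by rw [Matrix.det_fromBlocks_zero₂₁]; exact h.2.mul h'.2⟩

theorem IsGram.kronecker (h : IsGram A) (h' : IsGram B) : IsGram (A ⊗ₖ B) := by
  refine ⟨?_, ?_⟩
  · show (A ⊗ₖ B).transpose = _
    have := Matrix.kroneckerMap_transpose (fun x y : K => x * y) A B
    rw [h.1, h'.1] at this
    exact this.symm
  · show IsUnit (Matrix.det (A ⊗ₖ B))
    rw [Matrix.det_kronecker]; exact (h.2.pow _).mul (h'.2.pow _)

theorem IsGram.map {L : Type v} [Field L] (φ : K →+* L) (h : IsGram A) : IsGram (A.map φ) :=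
  ⟨h.1.map φ, by
    have : (A.map φ).det = φ A.det := (RingHom.map_det φ A).symm
    rw [this]; exact h.2.map φ⟩

variable (ι) in
theorem isGram_one : IsGram (1 : Matrix ι ι K) := ⟨Matrix.isSymm_one, by simp⟩

theorem isGram_diagonal (d : ι → Kˣ) : IsGram (Matrix.diagonal fun i => (d i : K)) :=
  ⟨Matrix.isSymm_diagonal _, by
    rw [Matrix.det_diagonal, isUnit_iff_ne_zero, Finset.prod_ne_zero_iff]
    exact fun i _ => (d i).ne_zero⟩

end IsGram

variable (K) in
/-- A non-degenerate symmetric bilinear form on some `K ^ n`, given by its Gram matrix. As the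
fields in use have characteristic different from two, this is the same as a non-degenerate
quadratic form, `q x = b x x`. -/
structure Form where
  dim : ℕ
  gram : Matrix (Fin dim) (Fin dim) K
  isGram : IsGram gram

variable (K) in
instance Form.setoid : Setoid (Form K) where
  r a b := Congruent a.gram b.gram
  iseqv := ⟨fun a => .refl a.gram, fun h => h.symm, fun h h' => h.trans h'⟩

variable (K) in
/-- The set of isometry classes of non-degenerate symmetric bilinear forms over `K`. -/
def FormClass : Type u := Quotient (Form.setoid K)

/-- The isometry class of the form with Gram matrix `A`. -/
noncomputable def cls {ι : Type*} [Fintype ι] [DecidableEq ι] (A : Matrix ι ι K) (h : IsGram A) :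
    FormClass K :=
  Quotient.mk (Form.setoid K)
    ⟨Fintype.card ι, A.submatrix (Fintype.equivFin ι).symm (Fintype.equivFin ι).symm,
      h.submatrix _⟩

section cls

variable {ι κ : Type*} [Fintype ι] [Fintype κ] [DecidableEq ι] [DecidableEq κ]
  {A : Matrix ι ι K} {B : Matrix κ κ K}

theorem cls_eq_iff (hA : IsGram A) (hB : IsGram B) : cls A hA = cls B hB ↔ Congruent A B := by
  have h1 := Congruent.of_submatrix A (Fintype.equivFin ι).symm
  have h2 := Congruent.of_submatrix B (Fintype.equivFin κ).symm
  refine ⟨fun h => ?_, fun h => ?_⟩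
  · exact (h1.trans (Quotient.exact h)).trans h2.symm
  · exact Quotient.sound ((h1.symm.trans h).trans h2)

theorem cls_eq (hA : IsGram A) (hB : IsGram B) (h : Congruent A B) : cls A hA = cls B hB :=
  (cls_eq_iff hA hB).2 h

theorem mk_eq_cls (a : Form K) : Quotient.mk (Form.setoid K) a = cls a.gram a.isGram :=
  Quotient.sound (Congruent.of_submatrix a.gram _)

theorem FormClass.ind {p : FormClass K → Prop}
    (h : ∀ (n : ℕ) (A : Matrix (Fin n) (Fin n) K) (hA : IsGram A), p (cls A hA)) (x : FormClass K) :
    p x := by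
  induction x using Quotient.ind with
  | _ a => rw [mk_eq_cls]; exact h _ _ _

end cls

/-- Orthogonal sum. -/
noncomputable instance : Add (FormClass K) where
  add := Quotient.lift₂
    (fun a b => cls (Matrix.fromBlocks a.gram 0 0 b.gram) (a.isGram.fromBlocks b.isGram))
    (fun _ _ _ _ h h' => cls_eq _ _ (Congruent.fromBlocks h h'))

/-- Tensor product. -/
noncomputable instance : Mul (FormClass K) where
  mul := Quotient.lift₂
    (fun a b => cls (a.gram ⊗ₖ b.gram) (a.isGram.kronecker b.isGram))
    (fun _ _ _ _ h h' => cls_eq _ _ (Congruent.kronecker h h'))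

/-- The form on the zero space. -/
noncomputable instance : Zero (FormClass K) where
  zero := cls (1 : Matrix (Fin 0) (Fin 0) K) (isGram_one _)

/-- The form `⟨1⟩`. -/
noncomputable instance : One (FormClass K) where
  one := cls (1 : Matrix Unit Unit K) (isGram_one _)

section ops

variable {ι κ : Type*} [Fintype ι] [Fintype κ] [DecidableEq ι] [DecidableEq κ]
  {A : Matrix ι ι K} {B : Matrix κ κ K}

theorem cls_add (hA : IsGram A) (hB : IsGram B) :
    cls A hA + cls B hB = cls (Matrix.fromBlocks A 0 0 B) (hA.fromBlocks hB) :=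
  cls_eq ((hA.submatrix _).fromBlocks (hB.submatrix _)) _ (Congruent.fromBlocks (Congruent.of_submatrix A _).symm
    (Congruent.of_submatrix B _).symm)

theorem cls_mul (hA : IsGram A) (hB : IsGram B) :
    cls A hA * cls B hB = cls (A ⊗ₖ B) (hA.kronecker hB) :=
  cls_eq ((hA.submatrix _).kronecker (hB.submatrix _)) _ (Congruent.kronecker (Congruent.of_submatrix A _).symm
    (Congruent.of_submatrix B _).symm)

theorem cls_zero : (0 : FormClass K) =
    cls (1 : Matrix (Fin 0) (Fin 0) K) (isGram_one _) := rfl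

theorem cls_one : (1 : FormClass K) =
    cls (1 : Matrix Unit Unit K) (isGram_one _) := rfl

end ops

protected theorem FormClass.add_comm' (x y : FormClass K) : x + y = y + x := by
  induction x using FormClass.ind with | _ n A hA => ?_
  induction y using FormClass.ind with | _ m B hB => ?_
  rw [cls_add, cls_add]
  refine cls_eq _ _ (.of_eq_submatrix (Equiv.sumComm _ _) ?_)
  ext (i | i) (j | j) <;> simp

protected theorem FormClass.mul_comm' (x y : FormClass K) : x * y = y * x := by
  induction x using FormClass.ind with | _ n A hA => ?_
  induction y using FormClass.ind with | _ m B hB => ?_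
  rw [cls_mul, cls_mul]
  refine cls_eq _ _ (.of_eq_submatrix (Equiv.prodComm _ _) ?_)
  ext ⟨i, j⟩ ⟨i', j'⟩
  simp [mul_comm]

protected theorem FormClass.add_mul' (x y z : FormClass K) : (x + y) * z = x * z + y * z := by
  induction x using FormClass.ind with | _ n A hA => ?_
  induction y using FormClass.ind with | _ m B hB => ?_
  induction z using FormClass.ind with | _ l C hC => ?_
  rw [cls_add, cls_mul, cls_mul, cls_mul, cls_add]
  refine cls_eq _ _ (.of_eq_submatrix (Equiv.sumProdDistrib _ _ _).symm ?_)
  ext (⟨i, j⟩ | ⟨i, j⟩) (⟨i', j'⟩ | ⟨i', j'⟩) <;> simp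

protected theorem FormClass.zero_mul' (x : FormClass K) : 0 * x = 0 := by
  induction x using FormClass.ind with | _ n A hA => ?_
  rw [cls_zero, cls_mul]
  refine cls_eq _ _ (.of_eq_submatrix (Equiv.equivOfIsEmpty _ _) ?_)
  ext i; exact i.elim0

protected theorem FormClass.one_mul' (x : FormClass K) : 1 * x = x := by
  induction x using FormClass.ind with | _ n A hA => ?_
  rw [cls_one, cls_mul]
  refine cls_eq _ _ (.of_eq_submatrix (Equiv.punitProd _).symm ?_)
  ext i j; simp

/-- Isometry classes form a commutative semiring under orthogonal sum and tensor product. -/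
noncomputable instance : CommSemiring (FormClass K) where
  add_assoc x y z := by
    induction x using FormClass.ind with | _ n A hA => ?_
    induction y using FormClass.ind with | _ m B hB => ?_
    induction z using FormClass.ind with | _ l C hC => ?_
    rw [cls_add, cls_add, cls_add, cls_add]
    refine cls_eq _ _ (.of_eq_submatrix (Equiv.sumAssoc _ _ _).symm ?_)
    ext (i | i | i) (j | j | j) <;> simp
  zero_add x := by
    induction x using FormClass.ind with | _ n A hA => ?_
    rw [cls_zero, cls_add]
    refine cls_eq _ _ (.of_eq_submatrix (Equiv.emptySum _ _).symm ?_)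
    ext i j; simp
  add_zero x := by
    rw [FormClass.add_comm']
    induction x using FormClass.ind with | _ n A hA => ?_
    rw [cls_zero, cls_add]
    refine cls_eq _ _ (.of_eq_submatrix (Equiv.emptySum _ _).symm ?_)
    ext i j; simp
  add_comm := FormClass.add_comm'
  nsmul := nsmulRec
  mul_assoc x y z := by
    induction x using FormClass.ind with | _ n A hA => ?_
    induction y using FormClass.ind with | _ m B hB => ?_
    induction z using FormClass.ind with | _ l C hC => ?_
    rw [cls_mul, cls_mul, cls_mul, cls_mul]
    refine cls_eq _ _ (.of_eq_submatrix (Equiv.prodAssoc _ _ _).symm ?_)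
    ext ⟨i, j, k⟩ ⟨i', j', k'⟩
    simp [mul_assoc]
  mul_comm := FormClass.mul_comm'
  one_mul := FormClass.one_mul'
  mul_one x := by rw [FormClass.mul_comm', FormClass.one_mul']
  zero_mul := FormClass.zero_mul'
  mul_zero x := by rw [FormClass.mul_comm', FormClass.zero_mul']
  right_distrib := FormClass.add_mul'
  left_distrib x y z := by
    rw [FormClass.mul_comm', FormClass.add_mul', FormClass.mul_comm' y, FormClass.mul_comm' z]

/-- The form `⟨a⟩`, that is, `x ↦ a x ^ 2`. -/
noncomputable def FormClass.diag (a : Kˣ) : FormClass K :=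
  cls (Matrix.diagonal fun _ : Unit => (a : K)) (isGram_diagonal _)

theorem FormClass.diag_one : FormClass.diag (1 : Kˣ) = 1 :=
  cls_eq _ _ (by simpa using Congruent.refl _)

variable (K) in
/-- The hyperbolic form `h = ⟨1, -1⟩`. -/
noncomputable def FormClass.hyp : FormClass K := FormClass.diag 1 + FormClass.diag (-1)

/-- Extension of scalars of isometry classes. -/
noncomputable def FormClass.map {L : Type v} [Field L] (φ : K →+* L) :
    FormClass K →+* FormClass L where
  toFun := Quotient.lift (fun a => cls (a.gram.map φ) (a.isGram.map φ))
    (fun _ _ h => cls_eq _ _ (Congruent.map φ h))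
  map_zero' := cls_eq _ _ (.of_eq_submatrix (finCongr (by simp)) (by ext i; exact i.elim0))
  map_one' := cls_eq _ _ (.of_eq_submatrix
    ((Fintype.equivFin Unit)) (by ext i j; simp))
  map_add' x y := by
    induction x using FormClass.ind with | _ n A hA => ?_
    induction y using FormClass.ind with | _ m B hB => ?_
    rw [cls_add]
    have key : ∀ {ι : Type} [Fintype ι] [DecidableEq ι] (A : Matrix ι ι K) (hA : IsGram A),
      Quotient.lift (fun a : Form K => cls (a.gram.map φ) (a.isGram.map φ))
        (fun _ _ h => cls_eq _ _ (Congruent.map φ h)) (cls A hA) = cls (A.map φ) (hA.map φ) :=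
      fun A hA => cls_eq ((hA.submatrix _).map φ) _ (Congruent.map φ (Congruent.of_submatrix A _).symm)
    rw [key, key, key, cls_add]
    refine cls_eq _ _ ?_
    rw [Matrix.fromBlocks_map]
    simpa using Congruent.refl _
  map_mul' x y := by
    induction x using FormClass.ind with | _ n A hA => ?_
    induction y using FormClass.ind with | _ m B hB => ?_
    rw [cls_mul]
    have key : ∀ {ι : Type} [Fintype ι] [DecidableEq ι] (A : Matrix ι ι K) (hA : IsGram A),
      Quotient.lift (fun a : Form K => cls (a.gram.map φ) (a.isGram.map φ))
        (fun _ _ h => cls_eq _ _ (Congruent.map φ h)) (cls A hA) = cls (A.map φ) (hA.map φ) :=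
      fun A hA => cls_eq ((hA.submatrix _).map φ) _ (Congruent.map φ (Congruent.of_submatrix A _).symm)
    rw [key, key, key, cls_mul]
    refine cls_eq _ _ ?_
    have : (A ⊗ₖ B).map φ = (A.map φ) ⊗ₖ (B.map φ) := by
      ext ⟨i, j⟩ ⟨i', j'⟩; simp
    rw [this]
    exact Congruent.refl _

theorem FormClass.map_cls {L : Type v} [Field L] (φ : K →+* L) {ι : Type*} [Fintype ι]
    [DecidableEq ι] (A : Matrix ι ι K) (hA : IsGram A) :
    FormClass.map φ (cls A hA) = cls (A.map φ) (hA.map φ) :=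
  cls_eq ((hA.submatrix _).map φ) _ (Congruent.map φ (Congruent.of_submatrix A _).symm)

theorem FormClass.map_diag {L : Type v} [Field L] (φ : K →+* L) (a : Kˣ) :
    FormClass.map φ (FormClass.diag a) = FormClass.diag (Units.map φ a) := by
  rw [FormClass.diag, FormClass.map_cls]
  exact cls_eq _ _ (.of_eq_submatrix (Equiv.refl _) (by ext i j; simp))

theorem FormClass.map_hyp {L : Type v} [Field L] (φ : K →+* L) :
    FormClass.map φ (FormClass.hyp K) = FormClass.hyp L := by
  simp only [FormClass.hyp, map_add, FormClass.map_diag]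
  congr 2 <;> ext <;> simp

variable (K) in
/-- Equality modulo the ideal generated by the hyperbolic form. -/
noncomputable def wittCon : RingCon (FormClass K) where
  r x y := ∃ a b, x + a * FormClass.hyp K = y + b * FormClass.hyp K
  iseqv := by
    refine ⟨fun x => ⟨0, 0, rfl⟩, fun ⟨a, b, h⟩ => ⟨b, a, h.symm⟩, ?_⟩
    rintro x y z ⟨a, b, h⟩ ⟨c, d, h'⟩
    refine ⟨a + c, b + d, ?_⟩
    calc x + (a + c) * FormClass.hyp K = (x + a * FormClass.hyp K) + c * FormClass.hyp K := by ring
      _ = (y + c * FormClass.hyp K) + b * FormClass.hyp K := by rw [h]; ring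
      _ = z + (b + d) * FormClass.hyp K := by rw [h']; ring
  add' := by
    rintro w x y z ⟨a, b, h⟩ ⟨c, d, h'⟩
    refine ⟨a + c, b + d, ?_⟩
    calc w + y + (a + c) * FormClass.hyp K
        = (w + a * FormClass.hyp K) + (y + c * FormClass.hyp K) := by ring
      _ = x + z + (b + d) * FormClass.hyp K := by rw [h, h']; ring
  mul' := by
    rintro w x y z ⟨a, b, h⟩ ⟨c, d, h'⟩
    refine ⟨w * c + a * y + a * c * FormClass.hyp K, x * d + b * z + b * d * FormClass.hyp K, ?_⟩
    calc w * y + (w * c + a * y + a * c * FormClass.hyp K) * FormClass.hyp K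
        = (w + a * FormClass.hyp K) * (y + c * FormClass.hyp K) := by ring
      _ = x * z + (x * d + b * z + b * d * FormClass.hyp K) * FormClass.hyp K := by
          rw [h, h']; ring

variable (K) in
/-- The Witt ring of `K`: the quotient of the semiring of isometry classes, equivalently of its
Grothendieck ring, by the ideal generated by the hyperbolic form. -/
def W : Type u := (wittCon K).Quotient

noncomputable instance : CommSemiring (W K) := inferInstanceAs (CommSemiring (wittCon K).Quotient)

/-- The class in the Witt ring of an isometry class. -/
noncomputable def W.mk : FormClass K →+* W K := (wittCon K).mk'

theorem W.mk_eq_iff {x y : FormClass K} :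
    W.mk x = W.mk y ↔ ∃ a b, x + a * FormClass.hyp K = y + b * FormClass.hyp K :=
  RingCon.eq (wittCon K)

theorem W.mk_surjective : Function.Surjective (W.mk : FormClass K → W K) :=
  RingCon.mk'_surjective (wittCon K)

theorem W.neg_one_mul_add (x : W K) : W.mk (FormClass.diag (-1)) * x + x = 0 := by
  obtain ⟨x, rfl⟩ := W.mk_surjective x
  rw [← map_mul, ← map_add, ← map_zero W.mk, W.mk_eq_iff]
  refine ⟨0, x, ?_⟩
  rw [FormClass.hyp, FormClass.diag_one]
  ring

/-- The negative of the class of `q` is the class of `⟨-1⟩ q = -q`. -/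
noncomputable instance : Neg (W K) where
  neg x := W.mk (FormClass.diag (-1)) * x

noncomputable instance : CommRing (W K) where
  __ := (inferInstance : CommSemiring (W K))
  zsmul := zsmulRec
  neg_add_cancel := W.neg_one_mul_add

/-- The class `⟨a⟩` in the Witt ring. -/
noncomputable def W.diag (a : Kˣ) : W K := W.mk (FormClass.diag a)

/-- Extension of scalars `W K → W L` along a field extension. -/
noncomputable def W.map {L : Type v} [Field L] (φ : K →+* L) : W K →+* W L :=
  RingCon.lift (wittCon K) (W.mk.comp (FormClass.map φ)) (by
    rintro x y ⟨a, b, h⟩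
    rw [RingCon.ker_apply]
    refine W.mk_eq_iff.2 ⟨FormClass.map φ a, FormClass.map φ b, ?_⟩
    rw [← FormClass.map_hyp φ, ← map_mul, ← map_mul, ← map_add, ← map_add, h])

theorem W.map_mk {L : Type v} [Field L] (φ : K →+* L) (x : FormClass K) :
    W.map φ (W.mk x) = W.mk (FormClass.map φ x) := rfl

theorem W.map_diag {L : Type v} [Field L] (φ : K →+* L) (a : Kˣ) :
    W.map φ (W.diag a) = W.diag (Units.map φ a) := by
  rw [W.diag, W.map_mk, FormClass.map_diag]; rfl

end Forms

/-! ### Bilinear spaces and their exterior powers -/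

section Bilin

open Module

variable {K : Type u} [Field K] {V : Type v} [AddCommGroup V] [Module K V]

theorem isGram_toMatrix {ι : Type*} [Fintype ι] [DecidableEq ι] (v : Basis ι K V)
    {b : LinearMap.BilinForm K V} (hs : b.IsSymm) (hn : b.Nondegenerate) :
    IsGram (LinearMap.BilinForm.toMatrix v b) :=
  ⟨(LinearMap.BilinForm.isSymm_toMatrix_iff_isSymm v).2 hs,
    isUnit_iff_ne_zero.2 ((LinearMap.BilinForm.nondegenerate_iff_det_ne_zero v).1 hn)⟩

/-- The isometry class of a finite-dimensional non-degenerate symmetric bilinear space. -/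
noncomputable def bilinClass [FiniteDimensional K V] (b : LinearMap.BilinForm K V)
    (hs : b.IsSymm) (hn : b.Nondegenerate) : FormClass K :=
  cls (LinearMap.BilinForm.toMatrix (finBasis K V) b) (isGram_toMatrix _ hs hn)

theorem congruent_toMatrix {V' : Type*} [AddCommGroup V'] [Module K V']
    {ι κ : Type*} [Fintype ι] [Fintype κ] [DecidableEq ι] [DecidableEq κ]
    (v : Basis ι K V) (w : Basis κ K V') (b : LinearMap.BilinForm K V)
    (b' : LinearMap.BilinForm K V') (e : V' ≃ₗ[K] V) (h : ∀ x y, b (e x) (e y) = b' x y) :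
    Congruent (LinearMap.BilinForm.toMatrix v b) (LinearMap.BilinForm.toMatrix w b') := by
  refine ⟨LinearMap.toMatrix w v e.toLinearMap, LinearMap.toMatrix v w e.symm.toLinearMap,
    ?_, ?_, ?_⟩
  · rw [← LinearMap.toMatrix_comp]; simp
  · rw [← LinearMap.toMatrix_comp]; simp
  · rw [← LinearMap.BilinForm.toMatrix_comp]
    congr 1
    ext x y
    simp [h]

/-- The isometry class can be computed in every basis. -/
theorem bilinClass_eq_cls [FiniteDimensional K V] {ι : Type*} [Fintype ι] [DecidableEq ι]
    (v : Basis ι K V) (b : LinearMap.BilinForm K V) (hs : b.IsSymm) (hn : b.Nondegenerate) :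
    bilinClass b hs hn = cls (LinearMap.BilinForm.toMatrix v b) (isGram_toMatrix v hs hn) :=
  cls_eq _ _ (congruent_toMatrix _ _ _ _ (LinearEquiv.refl K V) fun _ _ => rfl)

/-- Isometric bilinear spaces have the same class. -/
theorem bilinClass_congr {V' : Type*} [AddCommGroup V'] [Module K V'] [FiniteDimensional K V]
    [FiniteDimensional K V'] {b : LinearMap.BilinForm K V} {b' : LinearMap.BilinForm K V'}
    (hs : b.IsSymm) (hn : b.Nondegenerate) (hs' : b'.IsSymm) (hn' : b'.Nondegenerate)
    (e : V' ≃ₗ[K] V) (h : ∀ x y, b (e x) (e y) = b' x y) :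
    bilinClass b hs hn = bilinClass b' hs' hn' :=
  cls_eq _ _ (congruent_toMatrix _ _ _ _ e h)

/-- The `i`-th exterior power of a bilinear form, the form on `⋀^i V` with
`(x₁ ∧ ⋯ ∧ xᵢ, y₁ ∧ ⋯ ∧ yᵢ) ↦ det (b xᵣ yₛ)`. -/
noncomputable def extForm (i : ℕ) (b : LinearMap.BilinForm K V) :
    LinearMap.BilinForm K (⋀[K]^i V) :=
  exteriorPower.pairingDual K V i ∘ₗ exteriorPower.map i b

theorem extForm_ιMulti (i : ℕ) (b : LinearMap.BilinForm K V) (x y : Fin i → V) :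
    extForm i b (exteriorPower.ιMulti K i x) (exteriorPower.ιMulti K i y) =
      (Matrix.of fun r s => b (x s) (y r)).det := by
  simp [extForm, exteriorPower.pairingDual_ιMulti_ιMulti]

theorem extForm_isSymm (i : ℕ) {b : LinearMap.BilinForm K V} (hs : b.IsSymm) :
    (extForm i b).IsSymm := by
  have h : LinearMap.flip (extForm i b) = extForm i b := by
    apply exteriorPower.linearMap_ext
    ext x
    simp only [LinearMap.compAlternatingMap_apply, LinearMap.flip_apply]
    rename_i y
    simp only [extForm_ιMulti]
    rw [← Matrix.det_transpose]
    congr 1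
    ext r s
    exact hs.eq _ _
  exact ⟨fun x y => by
    have := LinearMap.congr_fun (LinearMap.congr_fun h y) x
    simpa using this⟩

theorem extForm_nondegenerate [FiniteDimensional K V] (i : ℕ) {b : LinearMap.BilinForm K V}
    (hs : b.IsSymm) (hn : b.Nondegenerate) : (extForm i b).Nondegenerate := by
  refine (LinearMap.IsRefl.nondegenerate_iff_separatingRight (extForm_isSymm i hs).isRefl).2 ?_
  intro y hy
  let v := finBasis K V
  let w := b.dualBasis hn v
  have hw : (fun j => b (w j)) = v.coord := by
    funext j
    refine v.ext fun k => ?_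
    rw [LinearMap.BilinForm.apply_dualBasis_left, Basis.coord_apply, Basis.repr_self,
      Finsupp.single_apply]
  refine (v.exteriorPower i).ext_elem fun s => ?_
  rw [map_zero, Finsupp.zero_apply, ← Basis.coord_apply, exteriorPower.basis_coord]
  have h := hy (exteriorPower.ιMulti_family K i w s)
  rw [extForm, LinearMap.comp_apply, exteriorPower.map_apply_ιMulti_family] at h
  rw [exteriorPower.ιMultiDual, ← hw]
  exact h

/-- The Gram matrix of an exterior power consists of minors. -/
theorem toMatrix_extForm {m : ℕ} (v : Basis (Fin m) K V) (i : ℕ) (b : LinearMap.BilinForm K V)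
    (s t : Set.powersetCard (Fin m) i) :
    LinearMap.BilinForm.toMatrix (v.exteriorPower i) (extForm i b) s t =
      (Matrix.of fun r r' => LinearMap.BilinForm.toMatrix v b
        (Set.powersetCard.ofFinEmbEquiv.symm s r')
        (Set.powersetCard.ofFinEmbEquiv.symm t r)).det := by
  rw [LinearMap.BilinForm.toMatrix_apply, exteriorPower.basis_apply, exteriorPower.basis_apply,
    exteriorPower.ιMulti_family, exteriorPower.ιMulti_family, extForm_ιMulti]
  simp [LinearMap.BilinForm.toMatrix_apply]

end Bilin

/-! ### Fields, étale algebras and trace forms -/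

/-- A field of characteristic different from two. -/
structure Fld : Type (u + 1) where
  carrier : Type u
  [field : Field carrier]
  two_ne_zero : (2 : carrier) ≠ 0

instance : CoeSort Fld.{u} (Type u) := ⟨Fld.carrier⟩

instance (K : Fld.{u}) : Field K := K.field

/-- An étale `K`-algebra of rank `n`. -/
structure EtAlg (n : ℕ) (K : Type u) [Field K] : Type (u + 1) where
  carrier : Type u
  [commRing : CommRing carrier]
  [algebra : Algebra K carrier]
  [etale : Algebra.Etale K carrier]
  finrank_eq : Module.finrank K carrier = n

section EtAlg

open Module TensorProduct

variable {n : ℕ} {K : Type u} [Field K]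

instance : CoeSort (EtAlg n K) (Type u) := ⟨EtAlg.carrier⟩

instance (A : EtAlg n K) : CommRing A := A.commRing

instance (A : EtAlg n K) : Algebra K A := A.algebra

instance (A : EtAlg n K) : Algebra.Etale K A := A.etale

instance (A : EtAlg n K) : FiniteDimensional K A := Algebra.FormallyUnramified.finite_of_free K A

variable (n K) in
instance EtAlg.setoid : Setoid (EtAlg n K) where
  r A B := Nonempty (A ≃ₐ[K] B)
  iseqv := ⟨fun _ => ⟨.refl⟩, fun ⟨e⟩ => ⟨e.symm⟩, fun ⟨e⟩ ⟨f⟩ => ⟨e.trans f⟩⟩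

variable (n K) in
/-- The set of isomorphism classes of étale `K`-algebras of rank `n`. -/
def Et : Type (u + 1) := Quotient (EtAlg.setoid n K)

/-- The isomorphism class of an étale algebra. -/
def Et.mk (A : EtAlg n K) : Et n K := Quotient.mk _ A

/-- Extension of scalars of an étale algebra. -/
noncomputable def EtAlg.baseChange {L : Type u} [Field L] (φ : K →+* L) (A : EtAlg n K) :
    EtAlg n L :=
  letI := φ.toAlgebra
  { carrier := L ⊗[K] A
    finrank_eq := by rw [Module.finrank_baseChange, A.finrank_eq] }

/-- Extension of scalars on isomorphism classes of étale algebras. -/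
noncomputable def Et.map {L : Type u} [Field L] (φ : K →+* L) : Et n K → Et n L :=
  Quotient.lift (fun A => Et.mk (A.baseChange φ)) (by
    rintro A B ⟨e⟩
    let := φ.toAlgebra
    exact Quotient.sound ⟨Algebra.TensorProduct.congr (AlgEquiv.refl (R := L) (A₁ := L)) e⟩)

theorem toMatrix_traceForm_baseChange {L : Type u} [Field L] [Algebra K L] (A : Type u)
    [CommRing A] [Algebra K A] [FiniteDimensional K A] {ι : Type*} [Fintype ι] [DecidableEq ι]
    (v : Basis ι K A) :
    LinearMap.BilinForm.toMatrix (Algebra.TensorProduct.basis L v)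
        (Algebra.traceForm L (L ⊗[K] A)) =
      (LinearMap.BilinForm.toMatrix v (Algebra.traceForm K A)).map (algebraMap K L) := by
  ext i j
  simp only [LinearMap.BilinForm.toMatrix_apply, Algebra.TensorProduct.basis_apply,
    Algebra.traceForm_apply, Matrix.map_apply, Algebra.TensorProduct.tmul_mul_tmul, one_mul]
  rw [Algebra.trace_apply, Algebra.trace_apply, ← LinearMap.trace_baseChange]
  congr 1
  ext x
  simp

theorem traceForm_nondegenerate_pi {I : Type*} [Finite I] :
    (Algebra.traceForm K (I → K)).Nondegenerate := by
  have := Fintype.ofFinite I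
  classical
  rw [LinearMap.BilinForm.nondegenerate_iff_det_ne_zero (Pi.basisFun K I)]
  have : LinearMap.BilinForm.toMatrix (Pi.basisFun K I) (Algebra.traceForm K (I → K)) = 1 := by
    ext i j
    rw [LinearMap.BilinForm.toMatrix_apply, Algebra.traceForm_apply,
      Algebra.trace_eq_matrix_trace (Pi.basisFun K I), Matrix.trace]
    simp [Algebra.leftMulMatrix_apply, Matrix.one_apply, Pi.single_apply, eq_comm]
  rw [this]; simp

theorem traceForm_equiv {A : Type*} [CommRing A] [Algebra K A] {B : Type*} [CommRing B]
    [Algebra K B] (e : A ≃ₐ[K] B) (x y : A) :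
    Algebra.traceForm K B (e x) (e y) = Algebra.traceForm K A x y := by
  rw [Algebra.traceForm_apply, Algebra.traceForm_apply, ← map_mul, Algebra.trace_eq_of_algEquiv]

theorem traceForm_nondegenerate_of_algEquiv {A : Type*} [CommRing A] [Algebra K A] {B : Type*}
    [CommRing B] [Algebra K B] (e : A ≃ₐ[K] B) (h : (Algebra.traceForm K A).Nondegenerate) :
    (Algebra.traceForm K B).Nondegenerate := by
  have h1 : Algebra.traceForm K B =
      LinearMap.BilinForm.congr e.toLinearEquiv (Algebra.traceForm K A) := by
    ext x y
    have := traceForm_equiv e (e.symm x) (e.symm y)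
    simpa using this
  rw [h1]
  exact LinearMap.BilinForm.Nondegenerate.congr _ h

/-- The trace form of an étale algebra is non-degenerate. -/
theorem traceForm_nondegenerate (A : EtAlg n K) : (Algebra.traceForm K A).Nondegenerate := by
  let L := AlgebraicClosure K
  let v := finBasis K A
  rw [LinearMap.BilinForm.nondegenerate_iff_det_ne_zero v]
  intro h0
  have hL : (Algebra.traceForm L (L ⊗[K] A)).Nondegenerate := by
    have : IsArtinianRing (L ⊗[K] A) := isArtinian_of_tower L inferInstance
    exact traceForm_nondegenerate_of_algEquiv
      (Algebra.FormallyEtale.equivPiOfIsSepClosed L (L ⊗[K] A)).symm traceForm_nondegenerate_pi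
  rw [LinearMap.BilinForm.nondegenerate_iff_det_ne_zero (Algebra.TensorProduct.basis L v),
    toMatrix_traceForm_baseChange] at hL
  apply hL
  have h := RingHom.map_det (algebraMap K L) (LinearMap.BilinForm.toMatrix v (Algebra.traceForm K A))
  rw [h0, map_zero] at h
  exact h.symm

/-- The exterior power `⋀^i Tr(A)` of the trace form `(x, y) ↦ tr (x y)`, as isometry class. -/
noncomputable def EtAlg.extTrace (i : ℕ) (A : EtAlg n K) : FormClass K :=
  bilinClass (extForm i (Algebra.traceForm K A))
    (extForm_isSymm i (Algebra.traceForm_isSymm K))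
    (extForm_nondegenerate i (Algebra.traceForm_isSymm K) (traceForm_nondegenerate A))

theorem EtAlg.extTrace_congr (i : ℕ) {A B : EtAlg n K} (e : A ≃ₐ[K] B) :
    A.extTrace i = B.extTrace i := by
  have hm : ∀ x y, Algebra.traceForm K B (e.toLinearEquiv x) (e.toLinearEquiv y) =
    Algebra.traceForm K A x y := fun x y => traceForm_equiv e x y
  let v := finBasis K A
  let w := v.map e.toLinearEquiv
  have hw : LinearMap.BilinForm.toMatrix w (Algebra.traceForm K B) =
      LinearMap.BilinForm.toMatrix v (Algebra.traceForm K A) := by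
    ext s t
    simp only [LinearMap.BilinForm.toMatrix_apply]
    exact hm _ _
  rw [extTrace, extTrace, bilinClass_eq_cls (v.exteriorPower i),
    bilinClass_eq_cls (w.exteriorPower i)]
  refine cls_eq _ _ (.of_eq_submatrix (Equiv.refl _) ?_)
  ext s t
  rw [toMatrix_extForm, hw]
  exact toMatrix_extForm _ _ _ _ _

theorem EtAlg.extTrace_baseChange (i : ℕ) {L : Type u} [Field L] (φ : K →+* L) (A : EtAlg n K) :
    (A.baseChange φ).extTrace i = FormClass.map φ (A.extTrace i) := by
  let := φ.toAlgebra
  let v := finBasis K A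
  let w : Basis _ L (A.baseChange φ) := Algebra.TensorProduct.basis L v
  have hw : LinearMap.BilinForm.toMatrix w (Algebra.traceForm L (A.baseChange φ)) =
      (LinearMap.BilinForm.toMatrix v (Algebra.traceForm K A)).map φ :=
    toMatrix_traceForm_baseChange _ v
  rw [extTrace, extTrace, bilinClass_eq_cls (v.exteriorPower i),
    bilinClass_eq_cls (w.exteriorPower i), FormClass.map_cls]
  refine cls_eq _ _ (.of_eq_submatrix (Equiv.refl _) ?_)
  ext s t
  simp only [Equiv.coe_refl, Matrix.submatrix_apply, id_eq, Matrix.map_apply]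
  rw [toMatrix_extForm, toMatrix_extForm, hw, RingHom.map_det]
  rfl

variable (K) in
/-- The class in the Witt ring of the `i`-th exterior power of the trace form. -/
noncomputable def Et.extTrace (i : ℕ) : Et n K → W K :=
  Quotient.lift (fun A => W.mk (A.extTrace i)) (by
    rintro A B ⟨e⟩
    exact congrArg W.mk (EtAlg.extTrace_congr i e))

/-- The trace form `(x, y) ↦ tr (x y)` of an étale algebra, as isometry class. -/
noncomputable def EtAlg.trace (A : EtAlg n K) : FormClass K :=
  bilinClass (Algebra.traceForm K A) (Algebra.traceForm_isSymm K) (traceForm_nondegenerate A)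

variable (n) in
/-- The ring `Inv(n)` of Witt invariants of étale algebras of degree `n`: the natural
transformations from `Et n` to the Witt ring, on all fields of characteristic different from two,
under pointwise addition and multiplication. -/
noncomputable def Inv : Subring (∀ K : Fld.{u}, Et n K → W K) where
  carrier := {α | ∀ (K L : Fld.{u}) (φ : K →+* L) (x : Et n K),
    α L (Et.map φ x) = W.map φ (α K x)}
  mul_mem' h h' K L φ x := by simp [h K L φ x, h' K L φ x]
  one_mem' K L φ x := by simp
  add_mem' h h' K L φ x := by simp [h K L φ x, h' K L φ x]
  zero_mem' K L φ x := by simp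
  neg_mem' h K L φ x := by simp [h K L φ x]

variable (n) in
/-- The invariant `λ_i : A ↦ ⋀^i Tr(A)`. -/
noncomputable def lam (i : ℕ) : Inv.{u} n :=
  ⟨fun K => Et.extTrace K i, fun K L φ x => by
    induction x using Quotient.ind with
    | _ A => exact congrArg W.mk (EtAlg.extTrace_baseChange i φ A)⟩

variable (n) in
/-- The constant invariant `⟨2 ^ e⟩`. -/
noncomputable def two (e : ℕ) : Inv.{u} n :=
  ⟨fun K _ => W.diag (Units.mk0 (2 : K) K.two_ne_zero ^ e), fun K L φ x => by
    rw [W.map_diag]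
    refine congrArg W.diag (Units.ext ?_)
    simp [map_ofNat φ 2]⟩

end EtAlg

/-! ### Multiquadratic algebras -/

section Multiquadratic

open Polynomial

variable (K : Fld.{u})

/-- The quadratic algebra `K[x] / (x ^ 2 - a)`. -/
abbrev QuadAlg (a : Kˣ) : Type u := AdjoinRoot (X ^ 2 - C (a : K) : K[X])

theorem finrank_quadAlg (a : Kˣ) : Module.finrank K (QuadAlg K a) = 2 := by
  rw [(AdjoinRoot.powerBasis' (monic_X_pow_sub_C (a : K) two_ne_zero)).finrank]
  simp

instance (a : Kˣ) : FiniteDimensional K (QuadAlg K a) :=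
  (AdjoinRoot.powerBasis' (monic_X_pow_sub_C (a : K) two_ne_zero)).finite

theorem formallyUnramified_quadAlg (a : Kˣ) : Algebra.FormallyUnramified K (QuadAlg K a) := by
  rw [Algebra.FormallyUnramified.iff_comp_injective]
  intro B _ _ I hI f g hfg
  refine AdjoinRoot.algHom_ext ?_
  have hroot : (AdjoinRoot.root (X ^ 2 - C (a : K) : K[X])) ^ 2 = algebraMap K _ (a : K) := by
    have h := AdjoinRoot.eval₂_root (X ^ 2 - C (a : K) : K[X])
    simp only [eval₂_sub, eval₂_pow, eval₂_X, eval₂_C] at h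
    exact sub_eq_zero.1 h
  set r : QuadAlg K a := AdjoinRoot.root (X ^ 2 - C (a : K) : K[X])
  have hf : f r ^ 2 = algebraMap K B a := by rw [← map_pow, hroot, AlgHom.commutes]
  have hg : g r ^ 2 = algebraMap K B a := by rw [← map_pow, hroot, AlgHom.commutes]
  have hmem : f r - g r ∈ I := by
    have h := AlgHom.congr_fun hfg r
    exact Ideal.Quotient.eq.1 h
  have hsq : (f r - g r) ^ 2 = 0 := by
    have h := Ideal.pow_mem_pow hmem 2
    rwa [hI, Ideal.mem_bot] at h
  have h2 : algebraMap K B (2 * a) * (f r - g r) = 0 := by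
    rw [map_mul, map_ofNat]
    linear_combination (-2) * (f r - g r) * hg + g r * (hf - hg - hsq)
  have hu : IsUnit (algebraMap K B (2 * a)) :=
    (isUnit_iff_ne_zero.2 (mul_ne_zero K.two_ne_zero a.ne_zero)).map _
  exact sub_eq_zero.1 ((hu.mul_right_eq_zero).1 h2)

instance (a : Kˣ) : Algebra.Etale K (QuadAlg K a) where
  formallyEtale := by
    have := formallyUnramified_quadAlg K a
    exact Algebra.FormallyEtale.iff_formallyUnramified_of_field.2 this
  finitePresentation := Algebra.FinitePresentation.of_finiteType.1 inferInstance

theorem etale_prod_aux {R : Type u} [CommRing R] (F : Bool → Type u) [∀ t, CommRing (F t)]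
    [∀ t, Algebra R (F t)] [∀ t, Algebra.Etale R (F t)] :
    Algebra.Etale R (F false × F true) :=
  Algebra.Etale.of_equiv (R := R) (A := ∀ t, F t)
    { toFun := fun x => (x false, x true)
      invFun := fun x t => Bool.rec x.1 x.2 t
      left_inv := fun x => by funext t; cases t <;> rfl
      right_inv := fun x => rfl
      map_mul' := fun x y => rfl
      map_add' := fun x y => rfl
      commutes' := fun r => rfl }

theorem etale_prod {R A B : Type u} [CommRing R] [cA : CommRing A] [cB : CommRing B]
    [aA : Algebra R A] [aB : Algebra R B] [eA : Algebra.Etale R A] [eB : Algebra.Etale R B] :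
    Algebra.Etale R (A × B) :=
  let F : Bool → Type u := fun t => Bool.rec A B t
  let i1 : ∀ t, CommRing (F t) := fun t => Bool.rec cA cB t
  let i2 : ∀ t, @Algebra R (F t) _ (i1 t).toCommSemiring.toSemiring := fun t => Bool.rec aA aB t
  have i3 : ∀ t, @Algebra.Etale R (F t) _ (i1 t) (i2 t) := fun t => Bool.rec eA eB t
  @etale_prod_aux R _ F i1 i2 i3

/-- The étale algebra `K[x] / (x ^ 2 - a)` of rank two. -/
noncomputable def quad (a : Kˣ) : EtAlg 2 K where
  carrier := QuadAlg K a
  finrank_eq := finrank_quadAlg K a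

/-- The multiquadratic algebra `E₁ × ⋯ × E_m × K ^ (n - 2 m)` of rank `n`, where `m = ⌊n / 2⌋` and
`E_j = K[x] / (x ^ 2 - a_j)`. -/
noncomputable def multiquad (n : ℕ) (a : Fin (n / 2) → Kˣ) : EtAlg n K where
  carrier := (∀ j, QuadAlg K (a j)) × (Fin (n - 2 * (n / 2)) → K)
  etale := etale_prod
  finrank_eq := by
    rw [Module.finrank_prod, Module.finrank_pi_fintype]
    simp only [finrank_quadAlg]
    simp
    omega

end Multiquadratic

/-- The elementary symmetric polynomial `P_i^m` evaluated at `x`. -/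
def elemSymm {R : Type*} [CommRing R] {m : ℕ} (i : ℕ) (x : Fin m → R) : R :=
  ∑ J ∈ Finset.powersetCard i Finset.univ, ∏ j ∈ J, x j

/-- The invariant `b` restricts on multiquadratic algebras to
`(a₁, …, a_m) ↦ P_i^m(Tr(E₁), …, Tr(E_m))` with `E_j = K[x] / (x ^ 2 - a_j)`. -/
def IsBeta (n i : ℕ) (b : Inv.{u} n) : Prop :=
  ∀ (K : Fld.{u}) (a : Fin (n / 2) → Kˣ),
    b.1 K (Et.mk (multiquad K n a)) = elemSymm i fun j => W.mk (quad K (a j)).trace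

/-! ### The coefficients -/

/-- The integers `γ_{i,k}^m`; `Nat.multichoose m j = (m + j - 1).choose j`. -/
def gam (m i k : ℕ) : ℤ :=
  ∑ j ∈ Finset.Icc k i, (-1) ^ (j - k) * (Nat.multichoose m (j - k) : ℤ) * ((m - j).choose (i - j) : ℤ)

/-- The integers `δ_{i,k}^m`, for `i` an integer, as the index `i = -1` occurs; they vanish for
`i < k`. -/
noncomputable def del (m : ℕ) (i : ℤ) (k : ℕ) : ℤ :=
  ∑ j ∈ Finset.Icc (k : ℤ) i, (-1) ^ (j - k).toNat * ((m - k).choose (j - k).toNat : ℤ) *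
    (m.choose (i - j).toNat : ℤ)

end WittInv

namespace WittInv

/-! ### Diagonal forms -/

section DiagonalForms

variable {K : Type u} [Field K]

/-! The change of basis is an identity between polynomials as soon as an invariant is known to be
determined by its values on multiquadratic algebras (`eq_zero_of_multiquad`). Put c = ⟨2⟩ and y_j =
⟨2 a_j⟩. Then Tr E_{a_j} = c + y_j, so β_i becomes e_i(c + y), and λ_i becomes the coefficient of
X^i in Q = ∏ (1 + cX)(1 + y_j X), with Q multiplied by 1 + X if n is odd. Dividing Q by (1 + cX)^m
gives the e_j(y) with multiset coefficients, and expanding e_i(c + y) in the e_j(y) then produces γ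
(`elemSymm_eq_sum_gam`). Conversely, 1 + y_j X = (1 - cX) + (c + y_j)X produces δ
(`coeff_quadPoly`). The factor 1 + X is inverted by alternating sums. The formula for β_i, read as a
definition, also proves existence.

For the splitting principle, let α vanish on multiquadratic algebras. That α(E) = 0 is proved for
all fields at once, by descending induction on the number of idempotents of E. Suppose E = A × S
with a field A of degree at least three. By Springer's theorem (`W.map_injective_of_odd_finrank`)
the base field may be enlarged by the fixed field of a Sylow 2-subgroup. Afterwards A either has
acquired idempotents or is F[√b] with b outside the base field K. In the second case put c = b - 1.
The algebra F[√(1 + tc)] × S over K(t) joins the given one at t = 1 to F[√1] × S at t = 0, which has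
more idempotents (`eq_zero_of_quadProd`). The value q of α on this family is unramified on the
affine line: where F stays a field over the residue field, 1 + tc is locally a constant unit times a
square; elsewhere the induction hypothesis kills q. Hence q is constant, it is zero because it is
zero at t = 0, and so α vanishes at t = 1.

That unramified classes are constant (`exists_map_constRat_eq`) is part of Milnor's computation of
W(K(t)), by the filtration by degrees of polynomials. It rests on the presentation of the Witt group
by generators and relations (`IsWittMap.sum_eq_zero`), a consequence of Witt cancellation, and on
the independence of the two residue forms over Laurent series
(`eq_zero_of_map_add_unif_mul_map_eq_zero`). -/

theorem cls_congr {ι κ : Type*} [Fintype ι] [Fintype κ] [DecidableEq ι] [DecidableEq κ]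
    {A : Matrix ι ι K} {B : Matrix κ κ K} (hA : IsGram A) (e : κ ≃ ι)
    (h : A.submatrix e e = B) (hB : IsGram B) : cls A hA = cls B hB :=
  cls_eq _ _ (.of_eq_submatrix e h)

theorem cls_diagonal {ι : Type*} [Fintype ι] [DecidableEq ι] (d : ι → Kˣ) :
    cls (Matrix.diagonal fun i => (d i : K)) (isGram_diagonal d) = ∑ i, FormClass.diag (d i) := by
  suffices h : ∀ (n : ℕ) (d : Fin n → Kˣ),
      cls (Matrix.diagonal fun i => (d i : K)) (isGram_diagonal d) =
        ∑ i, FormClass.diag (d i) by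
    let e := (Fintype.equivFin ι).symm
    rw [← Equiv.sum_comp e, ← h _ (fun i => d (e i))]
    exact cls_congr _ e (by ext i j; simp [Matrix.diagonal_apply]) _
  intro n
  induction n with
  | zero =>
    intro d
    rw [Fin.sum_univ_zero]
    exact cls_congr _ (Equiv.refl _) (by ext i; exact i.elim0) (isGram_one _)
  | succ n ih =>
    intro d
    rw [Fin.sum_univ_castSucc, ← ih, FormClass.diag, cls_add]
    refine cls_congr _ ((Equiv.sumCongr (Equiv.refl (Fin n)) (Equiv.ofUnique Unit (Fin 1))).trans
      finSumFinEquiv) ?_ _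
    ext (i | i) (j | j)
    · simp [Matrix.diagonal_apply, Fin.ext_iff]
      rfl
    · have := i.2
      simp [Matrix.diagonal_apply, Fin.ext_iff]
      omega
    · have := j.2
      simp [Matrix.diagonal_apply, Fin.ext_iff]
      omega
    · simp [Matrix.diagonal_apply, Fin.ext_iff]
      congr 2

/-- Outside characteristic two there is an orthogonal basis, and invertibility of the Gram
determinant makes the diagonal entries units. -/
theorem FormClass.exists_eq_sum_diag (h2 : (2 : K) ≠ 0) (x : FormClass K) :
    ∃ (n : ℕ) (d : Fin n → Kˣ), x = ∑ i, FormClass.diag (d i) := by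
  induction x using FormClass.ind with | _ n A hA => ?_
  have : Invertible (2 : K) := invertibleOfNonzero h2
  let b := Matrix.toBilin' A
  have hb : b.IsSymm := (Matrix.isSymm_toBilin'_iff_isSymm).2 hA.1
  obtain ⟨v, hv⟩ := LinearMap.BilinForm.exists_orthogonal_basis (B := b) ⟨hb.eq⟩
  let v' := v.reindex (finCongr (Module.finrank_fin_fun K))
  have hc : Congruent A (LinearMap.BilinForm.toMatrix v' b) := by
    have := congruent_toMatrix (Pi.basisFun K (Fin n)) v' b b (LinearEquiv.refl _ _) fun _ _ => rfl
    rwa [LinearMap.BilinForm.toMatrix_basisFun, LinearMap.BilinForm.toMatrix'_toBilin'] at this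
  have hd : LinearMap.BilinForm.toMatrix v' b = Matrix.diagonal fun i => b (v' i) (v' i) := by
    ext i j
    rw [LinearMap.BilinForm.toMatrix_apply, Matrix.diagonal_apply]
    split_ifs with hij
    · rw [hij]
    · simp only [v', Module.Basis.reindex_apply]
      exact hv (by simpa using hij)
  have hg : IsUnit (LinearMap.BilinForm.toMatrix v' b).det := by
    obtain ⟨P, Q, h1, h3, h4⟩ := hc
    rw [← h4, Matrix.det_mul, Matrix.det_mul, Matrix.det_transpose]
    have : IsUnit P.det := by
      refine IsUnit.of_mul_eq_one Q.det ?_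
      rw [← Matrix.det_mul, h1, Matrix.det_one]
    exact (this.mul hA.2).mul this
  rw [hd, Matrix.det_diagonal, isUnit_iff_ne_zero, Finset.prod_ne_zero_iff] at hg
  refine ⟨n, fun i => Units.mk0 _ (hg i (Finset.mem_univ _)), ?_⟩
  rw [← cls_diagonal]
  exact cls_eq _ _ (by rw [hd] at hc; exact hc)

theorem FormClass.diag_mul (a b : Kˣ) :
    FormClass.diag (a * b) = FormClass.diag a * FormClass.diag b := by
  rw [FormClass.diag, FormClass.diag, FormClass.diag, cls_mul]
  refine cls_congr _ (Equiv.punitProd Unit) ?_ _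
  ext i j
  simp

theorem FormClass.diag_mul_sq (a b : Kˣ) : FormClass.diag (a * b ^ 2) = FormClass.diag a := by
  symm
  refine cls_eq _ _ ⟨Matrix.diagonal fun _ => (b : K), Matrix.diagonal fun _ => ((b⁻¹ : Kˣ) : K),
    ?_, ?_, ?_⟩
  · ext; simp
  · ext; simp
  · ext
    simp [Matrix.diagonal_mul_diagonal]
    ring

theorem FormClass.diag_add (a b c : Kˣ) (h : (a + b : K) = c) :
    FormClass.diag a + FormClass.diag b = FormClass.diag c + FormClass.diag (a * b * c) := by
  rw [FormClass.diag, FormClass.diag, FormClass.diag, FormClass.diag, cls_add, cls_add]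
  have hc : (a + b : K) ≠ 0 := h ▸ c.ne_zero
  -- The new basis is (1, 1), of value a + b = c, and the orthogonal vector (-b, a), of value ab(a +
  -- b).
  refine cls_eq _ _ ⟨Matrix.fromBlocks (.of fun _ _ => 1) (.of fun _ _ => -(b : K))
    (.of fun _ _ => 1) (.of fun _ _ => (a : K)), 
    Matrix.fromBlocks (.of fun _ _ => a / c) (.of fun _ _ => b / c)
    (.of fun _ _ => -1 / c) (.of fun _ _ => 1 / c), ?_, ?_, ?_⟩
  · rw [Matrix.fromBlocks_multiply, ← Matrix.fromBlocks_one]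
    congr 1 <;> ext <;> simp [Matrix.mul_apply, ← h] <;> field_simp <;> ring
  · rw [Matrix.fromBlocks_multiply, ← Matrix.fromBlocks_one]
    congr 1 <;> ext <;> simp [Matrix.mul_apply, ← h] <;> field_simp <;> ring
  · rw [Matrix.fromBlocks_transpose, Matrix.fromBlocks_multiply, Matrix.fromBlocks_multiply]
    congr 1 <;> ext <;> simp [Matrix.mul_apply, ← h] <;> ring

theorem W.diag_one : W.diag (1 : Kˣ) = 1 := by rw [W.diag, FormClass.diag_one, map_one]

theorem W.diag_mul (a b : Kˣ) : W.diag (a * b) = W.diag a * W.diag b := by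
  rw [W.diag, FormClass.diag_mul, map_mul]; rfl

theorem W.diag_neg (a : Kˣ) : W.diag (-a) = -W.diag a := by
  rw [neg_eq_neg_one_mul a, W.diag_mul]; rfl

theorem W.exists_eq_sum_diag (h2 : (2 : K) ≠ 0) (x : W K) :
    ∃ (n : ℕ) (d : Fin n → Kˣ), x = ∑ i, W.diag (d i) := by
  obtain ⟨x, rfl⟩ := W.mk_surjective x
  obtain ⟨n, d, rfl⟩ := FormClass.exists_eq_sum_diag h2 x
  exact ⟨n, d, by rw [map_sum]; rfl⟩

end DiagonalForms

/-! ### Witt cancellation -/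

section Cancellation

variable {K : Type u} [Field K]

/-- The reflection in u - e carries u to e, the one in u + e carries u to -e. The values of the form
at u - e and u + e add up to 4a, so at least one of the two reflections exists. -/
theorem exists_reflection {ι : Type*} [Fintype ι] [DecidableEq ι] (h2 : (2 : K) ≠ 0)
    {M : Matrix ι ι K} (hM : M.IsSymm) {u e : ι → K} {a : K} (ha : a ≠ 0)
    (hu : u ⬝ᵥ M.mulVec u = a) (he : e ⬝ᵥ M.mulVec e = a) :
    ∃ S : Matrix ι ι K, S * S = 1 ∧ S.transpose * M * S = M ∧
      (S.mulVec u = e ∨ S.mulVec u = -e) := by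
  have hsym : ∀ x y : ι → K, x ⬝ᵥ M.mulVec y = y ⬝ᵥ M.mulVec x := fun x y => by
    rw [Matrix.dotProduct_mulVec, ← Matrix.mulVec_transpose, hM.eq, dotProduct_comm]
  have key : ∀ w : ι → K, w ⬝ᵥ M.mulVec w ≠ 0 → ∃ S : Matrix ι ι K, S * S = 1 ∧
      S.transpose * M * S = M ∧
      S.mulVec u = u - (2 * (w ⬝ᵥ M.mulVec u) / (w ⬝ᵥ M.mulVec w)) • w := by
    intro w hw
    set q := w ⬝ᵥ M.mulVec w with hq
    have hSS : (1 - (2 / q) • Matrix.vecMulVec w (M.mulVec w)) *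
        (1 - (2 / q) • Matrix.vecMulVec w (M.mulVec w)) = 1 := by
      have : Matrix.vecMulVec w (M.mulVec w) * Matrix.vecMulVec w (M.mulVec w) =
          q • Matrix.vecMulVec w (M.mulVec w) := by
        rw [Matrix.vecMulVec_mul_vecMulVec, dotProduct_comm, ← hq, Matrix.vecMulVec_smul]
      simp only [sub_mul, mul_sub, one_mul, mul_one, smul_mul_assoc, mul_smul_comm, this, smul_smul]
      have : 2 / q * q = 2 := by field_simp
      rw [this]
      module
    refine ⟨1 - (2 / q) • Matrix.vecMulVec w (M.mulVec w), hSS, ?_, ?_⟩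
    · have : (1 - (2 / q) • Matrix.vecMulVec w (M.mulVec w)).transpose * M =
          M * (1 - (2 / q) • Matrix.vecMulVec w (M.mulVec w)) := by
        rw [Matrix.transpose_sub, Matrix.transpose_smul, Matrix.transpose_vecMulVec, sub_mul,
          mul_sub, smul_mul_assoc, mul_smul_comm, Matrix.vecMulVec_mul, Matrix.mul_vecMulVec,
          ← Matrix.mulVec_transpose, hM.eq]
        simp
      rw [this, mul_assoc, hSS, mul_one]
    · rw [Matrix.sub_mulVec, Matrix.smul_mulVec, Matrix.vecMulVec_mulVec, Matrix.one_mulVec]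
      rw [← hsym u w, dotProduct_comm (M.mulVec w) u]
      ext i
      simp
      ring
  have hue := hsym u e
  have e1 : (u - e) ⬝ᵥ M.mulVec (u - e) = 2 * (a - u ⬝ᵥ M.mulVec e) := by
    rw [Matrix.mulVec_sub, sub_dotProduct, dotProduct_sub, dotProduct_sub, hu, he, ← hue]; ring
  have e2 : (u + e) ⬝ᵥ M.mulVec (u + e) = 2 * (a + u ⬝ᵥ M.mulVec e) := by
    rw [Matrix.mulVec_add, add_dotProduct, dotProduct_add, dotProduct_add, hu, he, ← hue]; ring
  by_cases h : (u - e) ⬝ᵥ M.mulVec (u - e) = 0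
  · have h' : (u + e) ⬝ᵥ M.mulVec (u + e) ≠ 0 := by
      intro h'
      have : 2 * (2 * a) = 0 := by linear_combination h + h' - e1 - e2
      simp [h2, ha] at this
    obtain ⟨S, h1, h3, h4⟩ := key _ h'
    refine ⟨S, h1, h3, Or.inr ?_⟩
    rw [h4, e2, add_dotProduct, hu, ← hue, div_self (by rwa [e2] at h')]
    simp
  · obtain ⟨S, h1, h3, h4⟩ := key _ h
    refine ⟨S, h1, h3, Or.inl ?_⟩
    rw [h4, e1, sub_dotProduct, hu, ← hue, div_self (by rwa [e1] at h)]
    simp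

/-- After composition with a reflection the isometry fixes the last basis vector up to sign. It then
respects the orthogonal complements, and its upper left block is the isometry sought. -/
theorem Congruent.cancel {ι κ : Type*} [Fintype ι] [Fintype κ] [DecidableEq ι] [DecidableEq κ]
    (h2 : (2 : K) ≠ 0) {A : Matrix ι ι K} {B : Matrix κ κ K} (hA : A.IsSymm) (a : Kˣ)
    (h : Congruent (Matrix.fromBlocks A 0 0 (Matrix.diagonal fun _ : Unit => (a : K)))
      (Matrix.fromBlocks B 0 0 (Matrix.diagonal fun _ : Unit => (a : K)))) : Congruent A B := by
  obtain ⟨P, Q, h1, h3, h4⟩ := h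
  set M := Matrix.fromBlocks A 0 0 (Matrix.diagonal fun _ : Unit => (a : K)) with hM
  have hMs : M.IsSymm := Matrix.IsSymm.fromBlocks hA (by simp) (Matrix.isSymm_diagonal _)
  have hq : ∀ w : κ ⊕ Unit → K, P.mulVec w ⬝ᵥ M.mulVec (P.mulVec w) =
      w ⬝ᵥ (P.transpose * M * P).mulVec w := fun w => by
    simp only [← Matrix.mulVec_mulVec]
    rw [Matrix.dotProduct_mulVec w, Matrix.vecMul_transpose]
  obtain ⟨S, hSS, hSM, hS⟩ := exists_reflection h2 hMs (u := P.mulVec (Pi.single (Sum.inr ()) 1))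
    (e := Pi.single (Sum.inr ()) 1) a.ne_zero
    (by rw [hq, h4]; simp [Matrix.fromBlocks])
    (by simp [hM, Matrix.fromBlocks])
  have g1 : (S * P) * (Q * S) = 1 := by
    rw [Matrix.mul_assoc, ← Matrix.mul_assoc P, h1, Matrix.one_mul, hSS]
  have g2 : (Q * S) * (S * P) = 1 := by
    rw [Matrix.mul_assoc, ← Matrix.mul_assoc S, hSS, Matrix.one_mul, h3]
  have g3 : (S * P).transpose * M * (S * P) =
      Matrix.fromBlocks B 0 0 (Matrix.diagonal fun _ : Unit => (a : K)) := by
    rw [← h4, Matrix.transpose_mul]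
    calc P.transpose * S.transpose * M * (S * P) = P.transpose * (S.transpose * M * S) * P := by
          simp only [Matrix.mul_assoc]
      _ = _ := by rw [hSM]
  rw [Matrix.mulVec_mulVec, Matrix.mulVec_single_one] at hS
  generalize S * P = R at *
  generalize Q * S = R' at *
  have hR12 : R.toBlocks₁₂ = 0 := by
    ext i j
    rcases hS with hS | hS <;>
      simpa [Matrix.toBlocks₁₂] using congrFun hS (Sum.inl i)
  have hR22 : R.toBlocks₂₂ () () ≠ 0 := by
    rcases hS with hS | hS <;> have := congrFun hS (Sum.inr ()) <;>
      simp at this <;> simp [Matrix.toBlocks₂₂, this]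
  rw [← Matrix.fromBlocks_toBlocks R, hR12] at g1 g2 g3
  rw [← Matrix.fromBlocks_toBlocks R'] at g1 g2
  rw [Matrix.fromBlocks_transpose, Matrix.fromBlocks_multiply, Matrix.fromBlocks_multiply,
    Matrix.fromBlocks_inj] at g3
  rw [Matrix.fromBlocks_multiply, ← Matrix.fromBlocks_one, Matrix.fromBlocks_inj] at g1 g2
  -- As R₁₂ = 0, the lower left block of the Gram identity reads R₂₂ᵀ a R₂₁ = 0.
  have hR21 : R.toBlocks₂₁ = 0 := by
    ext i j
    have := congrFun (congrFun g3.2.2.1 ()) j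
    simp [Matrix.mul_apply] at this
    simpa [hR22] using this
  rw [hR21] at g3 g2
  refine ⟨R.toBlocks₁₁, R'.toBlocks₁₁, ?_, ?_, ?_⟩
  · simpa using g1.1
  · simpa using g2.1
  · simpa using g3.1

theorem FormClass.add_diag_cancel (h2 : (2 : K) ≠ 0) {x y : FormClass K} {a : Kˣ}
    (h : x + FormClass.diag a = y + FormClass.diag a) : x = y := by
  induction x using FormClass.ind with | _ n A hA => ?_
  induction y using FormClass.ind with | _ m B hB => ?_
  rw [FormClass.diag, cls_add, cls_add, cls_eq_iff] at h
  exact cls_eq _ _ (h.cancel h2 hA.1 a)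

theorem FormClass.add_right_cancel' (h2 : (2 : K) ≠ 0) {x y z : FormClass K}
    (h : x + z = y + z) : x = y := by
  obtain ⟨n, d, rfl⟩ := FormClass.exists_eq_sum_diag h2 z
  induction n with
  | zero => simpa using h
  | succ n ih =>
    rw [Fin.sum_univ_castSucc, ← add_assoc, ← add_assoc] at h
    exact ih _ (FormClass.add_diag_cancel h2 h)

end Cancellation

/-! ### Isotropy of forms that vanish in the Witt ring -/

section Isotropy

variable {K : Type u} [Field K]

theorem FormClass.diag_add_diag_neg (h2 : (2 : K) ≠ 0) (c : Kˣ) :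
    FormClass.diag c + FormClass.diag (-c) = FormClass.hyp K := by
  rw [FormClass.hyp, FormClass.diag, FormClass.diag, FormClass.diag, FormClass.diag, cls_add,
    cls_add]
  -- Chosen with p - r = 1 and p + r = 1/c, so that c(p² - r²) = 1.
  let p : K := (1 / c + 1) / 2
  let r : K := (1 / c - 1) / 2
  have hp : c * (p * p) - c * (r * r) = 1 := by
    simp only [p, r]; field_simp; ring
  refine cls_eq _ _ ⟨Matrix.fromBlocks (.of fun _ _ => p) (.of fun _ _ => r)
    (.of fun _ _ => r) (.of fun _ _ => p), Matrix.fromBlocks (.of fun _ _ => c * p)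
    (.of fun _ _ => -c * r) (.of fun _ _ => -c * r) (.of fun _ _ => c * p), ?_, ?_, ?_⟩
  · rw [Matrix.fromBlocks_multiply, ← Matrix.fromBlocks_one]
    congr 1 <;> ext <;> simp [Matrix.mul_apply] <;> first | ring1 | linear_combination hp
  · rw [Matrix.fromBlocks_multiply, ← Matrix.fromBlocks_one]
    congr 1 <;> ext <;> simp [Matrix.mul_apply] <;> first | ring1 | linear_combination hp
  · rw [Matrix.fromBlocks_transpose, Matrix.fromBlocks_multiply, Matrix.fromBlocks_multiply]
    congr 1 <;> ext <;> simp [Matrix.mul_apply] <;>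
      first | ring1 | linear_combination hp | linear_combination -hp

theorem FormClass.exists_mul_hyp (h2 : (2 : K) ≠ 0) (x : FormClass K) :
    ∃ n : ℕ, x * FormClass.hyp K = n • FormClass.hyp K := by
  obtain ⟨n, d, rfl⟩ := FormClass.exists_eq_sum_diag h2 x
  refine ⟨n, ?_⟩
  have : ∀ c : Kˣ, FormClass.diag c * FormClass.hyp K = FormClass.hyp K := fun c => by
    rw [FormClass.hyp, mul_add, ← FormClass.diag_mul, ← FormClass.diag_mul, mul_one, mul_neg_one]
    exact FormClass.diag_add_diag_neg h2 c
  simp [Finset.sum_mul, this]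

/-- An isometry with the zero space factors an identity matrix through an empty index set, so a
diagonal entry 1 would be an empty sum. -/
theorem FormClass.isEmpty_of_sum_diag_add_eq_zero {ι : Type*} [Fintype ι] {d : ι → Kˣ}
    {x : FormClass K} (h : ∑ i, FormClass.diag (d i) + x = 0) : IsEmpty ι := by
  classical
  by_contra hι
  rw [not_isEmpty_iff] at hι
  obtain ⟨i⟩ := hι
  induction x using FormClass.ind with | _ n A hA => ?_
  rw [← cls_diagonal, cls_add, cls_zero, cls_eq_iff] at h
  obtain ⟨P, Q, h1, -, -⟩ := h
  have := congrFun (congrFun h1 (Sum.inl i)) (Sum.inl i)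
  simp [Matrix.mul_apply] at this

/-- Vanishing in the Witt ring means q + m h = n h as forms. Cancellation leaves either q + k h = 0,
impossible for a form of positive dimension, or q = (k + 1) h, which is isotropic. -/
theorem exists_isotropic_of_sum_diag_eq_zero (h2 : (2 : K) ≠ 0) {ι : Type*} [Fintype ι]
    [Nonempty ι] {d : ι → Kˣ} (h : ∑ i, W.diag (d i) = 0) :
    ∃ v : ι → K, v ≠ 0 ∧ ∑ i, (d i : K) * v i ^ 2 = 0 := by
  classical
  have h' : W.mk (∑ i, FormClass.diag (d i)) = W.mk 0 := by rw [map_sum, map_zero]; exact h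
  obtain ⟨a, b, hab⟩ := W.mk_eq_iff.1 h'
  obtain ⟨m, hm⟩ := FormClass.exists_mul_hyp h2 a
  obtain ⟨n, hn⟩ := FormClass.exists_mul_hyp h2 b
  rw [hm, hn, zero_add] at hab
  rcases le_or_gt n m with hle | hlt
  · obtain ⟨k, rfl⟩ := Nat.exists_eq_add_of_le hle
    exfalso
    refine not_isEmpty_of_nonempty ι (FormClass.isEmpty_of_sum_diag_add_eq_zero (d := d)
      (x := k • FormClass.hyp K) (FormClass.add_right_cancel' h2 (z := n • FormClass.hyp K) ?_))
    rw [zero_add, add_assoc, ← add_nsmul, add_comm k, hab]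
  · obtain ⟨k, rfl⟩ := Nat.exists_eq_add_of_lt hlt
    have hx : ∑ i, FormClass.diag (d i) =
        FormClass.diag 1 + FormClass.diag (-1) + k • FormClass.hyp K := by
      refine FormClass.add_right_cancel' h2 (z := m • FormClass.hyp K) ?_
      rw [hab, add_nsmul, add_nsmul, one_nsmul, FormClass.hyp]
      ring
    generalize k • FormClass.hyp K = y at hx
    induction y using FormClass.ind with | _ l B hB => ?_
    rw [← cls_diagonal, FormClass.diag, FormClass.diag, cls_add, cls_add, cls_eq_iff] at hx
    obtain ⟨P, Q, -, h3, h4⟩ := hx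
    -- The sum of the basis vectors of ⟨1⟩ and ⟨-1⟩, an isotropic vector.
    set w : (Unit ⊕ Unit) ⊕ Fin l → K := Sum.elim (fun _ => 1) (fun _ => 0) with hw
    refine ⟨P.mulVec w, fun h0 => ?_, ?_⟩
    · have : Q.mulVec (P.mulVec w) = 0 := by rw [h0, Matrix.mulVec_zero]
      rw [Matrix.mulVec_mulVec, h3, Matrix.one_mulVec] at this
      simpa [hw] using congrFun this (Sum.inl (Sum.inl ()))
    · have e : P.mulVec w ⬝ᵥ (Matrix.diagonal fun i => (d i : K)).mulVec (P.mulVec w) = 0 := by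
        have : P.mulVec w ⬝ᵥ (Matrix.diagonal fun i => (d i : K)).mulVec (P.mulVec w) =
            w ⬝ᵥ (P.transpose * (Matrix.diagonal fun i => (d i : K)) * P).mulVec w := by
          simp only [← Matrix.mulVec_mulVec]
          rw [Matrix.dotProduct_mulVec w, Matrix.vecMul_transpose]
        rw [this, h4]
        simp [hw, Matrix.mulVec, dotProduct, Fintype.sum_sum_type]
      rw [← e, dotProduct]
      refine Finset.sum_congr rfl fun i _ => ?_
      rw [Matrix.mulVec_diagonal]
      ring

end Isotropy

/-! ### Maps that satisfy the relations between the generators of the Witt group -/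

section WittMap

variable {K : Type u} [Field K]

/-- Maps `T` such that `⟨a⟩ ↦ T a` respects the defining relations of the Witt group. -/
structure IsWittMap {G : Type*} [AddCommGroup G] (T : Kˣ → G) : Prop where
  mul_sq : ∀ a b, T (a * b ^ 2) = T a
  add : ∀ a b c : Kˣ, (a + b : K) = c → T a + T b = T c + T (a * b * c)
  add_neg : ∀ a, T a + T (-a) = 0

variable (K) in
theorem isWittMap_diag : IsWittMap (W.diag : Kˣ → W K) where
  mul_sq a b := congrArg W.mk (FormClass.diag_mul_sq a b)
  add a b c h := by
    have := congrArg W.mk (FormClass.diag_add a b c h)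
    rwa [map_add, map_add] at this
  add_neg a := by rw [W.diag_neg, add_neg_cancel]

theorem IsWittMap.prodMk {G H : Type*} [AddCommGroup G] [AddCommGroup H] {S : Kˣ → G} {T : Kˣ → H}
    (hS : IsWittMap S) (hT : IsWittMap T) : IsWittMap fun a => (S a, T a) where
  mul_sq a b := by rw [hS.mul_sq, hT.mul_sq]
  add a b c h := by rw [Prod.mk_add_mk, Prod.mk_add_mk, hS.add a b c h, hT.add a b c h]
  add_neg a := by rw [Prod.mk_add_mk, hS.add_neg, hT.add_neg]; rfl

/-- The entries are added up one by one. The relation T a + T b = T c + T(abc) trades a partial sum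
and the next entry for the new partial sum and one entry put aside. When a partial sum vanishes, T a
+ T(-a) = 0 removes two entries for good. -/
theorem IsWittMap.exists_shorter {G : Type*} [AddCommGroup G] {T : Kˣ → G} (hT : IsWittMap T)
    {ι : Type*} (S : Finset ι) (e : ι → Kˣ) :
    (∀ c : Kˣ, ∑ i ∈ S, (e i : K) = c → ∃ r : Multiset Kˣ, r.card + 1 ≤ S.card ∧
      ∑ i ∈ S, T (e i) = T c + (r.map T).sum) ∧
    (∑ i ∈ S, (e i : K) = 0 → S.Nonempty → ∃ r : Multiset Kˣ, r.card + 2 ≤ S.card ∧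
      ∑ i ∈ S, T (e i) = (r.map T).sum) := by
  classical
  induction S using Finset.induction_on with
  | empty => exact ⟨fun c h => absurd h.symm c.ne_zero, fun _ h => by simp at h⟩
  | insert i S hi ih =>
    rw [Finset.sum_insert hi, Finset.sum_insert hi, Finset.card_insert_of_notMem hi]
    by_cases h0 : ∑ i ∈ S, (e i : K) = 0
    · rw [h0, add_zero]
      refine ⟨fun c hc => ?_, fun h => absurd h (e i).ne_zero⟩
      obtain rfl : e i = c := Units.ext hc
      rcases S.eq_empty_or_nonempty with rfl | hne
      · exact ⟨0, by simp⟩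
      · obtain ⟨r, hr, hr'⟩ := ih.2 h0 hne
        exact ⟨r, by omega, by rw [hr']⟩
    · obtain ⟨r, hr, hr'⟩ := ih.1 (Units.mk0 _ h0) rfl
      rw [hr']
      refine ⟨fun c hc => ⟨(e i * Units.mk0 _ h0 * c) ::ₘ r, ?_, ?_⟩, fun hc _ => ⟨r, by omega, ?_⟩⟩
      · rw [Multiset.card_cons]; omega
      · rw [Multiset.map_cons, Multiset.sum_cons, ← add_assoc, ← add_assoc,
          hT.add _ _ c hc]
      · have : e i = -Units.mk0 _ h0 := Units.ext (eq_neg_of_add_eq_zero_left hc)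
        rw [this, ← add_assoc, add_comm (T _), hT.add_neg, zero_add]

/-- Rescaling the entries with `v i ≠ 0` by the squares of the `v i` turns isotropy into a vanishing
sum of entries, to which the shortening applies. -/
theorem IsWittMap.exists_shorter_of_isotropic {G : Type*} [AddCommGroup G] {T : Kˣ → G}
    (hT : IsWittMap T) {ι : Type*} [Fintype ι] (d : ι → Kˣ) {v : ι → K} (hv : v ≠ 0)
    (h : ∑ i, (d i : K) * v i ^ 2 = 0) :
    ∃ r : Multiset Kˣ, r.card < Fintype.card ι ∧ ∑ i, T (d i) = (r.map T).sum := by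
  classical
  let S : Finset ι := Finset.univ.filter fun i => v i ≠ 0
  let e : ι → Kˣ := fun i => if h : v i = 0 then d i else d i * Units.mk0 _ h ^ 2
  have he : ∀ i, T (e i) = T (d i) := fun i => by
    simp only [e]
    split_ifs
    · rfl
    · exact hT.mul_sq _ _
  have hS : ∑ i ∈ S, (e i : K) = 0 := by
    rw [← h, Finset.sum_filter]
    refine Finset.sum_congr rfl fun i _ => ?_
    by_cases hi : v i = 0 <;> simp [e, hi]
  have hne : S.Nonempty := by
    obtain ⟨i, hi⟩ := Function.ne_iff.1 hv
    exact ⟨i, by simpa [S] using hi⟩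
  obtain ⟨r, hr, hr'⟩ := (hT.exists_shorter S e).2 hS hne
  refine ⟨r + (Finset.univ.filter fun i => i ∉ S).val.map d, ?_, ?_⟩
  · have := Finset.card_filter_add_card_filter_not (s := (Finset.univ : Finset ι)) (· ∈ S)
    rw [Finset.filter_mem_eq_inter, Finset.univ_inter, Finset.card_univ] at this
    rw [Multiset.card_add, Multiset.card_map, Finset.card_val]
    omega
  · rw [Multiset.map_add, Multiset.sum_add, ← hr',
      ← Finset.sum_filter_add_sum_filter_not Finset.univ (· ∈ S), Multiset.map_map]
    congr 1
    rw [Finset.filter_mem_eq_inter, Finset.univ_inter]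
    exact Finset.sum_congr rfl fun i _ => (he i).symm

theorem Multiset.exists_fin_map {α : Type*} (s : Multiset α) :
    ∃ f : Fin s.card → α, ∀ {G : Type u} [AddCommMonoid G] (T : α → G),
      (s.map T).sum = ∑ i, T (f i) := by
  induction s using Quotient.inductionOn with | _ l => ?_
  refine ⟨l.get, fun T => ?_⟩
  change (l.map T).sum = ∑ i : Fin l.length, T l[i]
  rw [← List.sum_ofFn]
  exact congrArg List.sum (List.ofFn_getElem_eq_map l T).symm

/-- This is the presentation of the Witt group by generators and relations. The shortening is
applied to the pair of `W.diag` and `T`, so that the shorter list still has sum zero in the Witt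
ring and the induction on the length goes on. -/
theorem IsWittMap.sum_eq_zero (h2 : (2 : K) ≠ 0) {G : Type u} [AddCommGroup G] {T : Kˣ → G}
    (hT : IsWittMap T) (n : ℕ) (d : Fin n → Kˣ) (h : ∑ i, W.diag (d i) = 0) :
    ∑ i, T (d i) = 0 := by
  induction n using Nat.strong_induction_on with | _ n ih => ?_
  rcases Nat.eq_zero_or_pos n with rfl | hn
  · simp
  · have : Nonempty (Fin n) := ⟨⟨0, hn⟩⟩
    obtain ⟨v, hv, hv'⟩ := exists_isotropic_of_sum_diag_eq_zero h2 h
    obtain ⟨r, hr, hr'⟩ :=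
      ((isWittMap_diag K).prodMk hT).exists_shorter_of_isotropic d hv hv'
    obtain ⟨f, hf⟩ := Multiset.exists_fin_map r
    rw [hf] at hr'
    have h1 := congrArg Prod.fst hr'
    have h3 := congrArg Prod.snd hr'
    rw [Prod.fst_sum, Prod.fst_sum] at h1
    rw [Prod.snd_sum, Prod.snd_sum] at h3
    simp only at h1 h3
    rw [h3]
    exact ih _ (by simpa using hr) f (h1 ▸ h)

theorem W.exists_anisotropic (h2 : (2 : K) ≠ 0) (x : W K) :
    ∃ (n : ℕ) (d : Fin n → Kˣ), x = ∑ i, W.diag (d i) ∧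
      ∀ v : Fin n → K, ∑ i, (d i : K) * v i ^ 2 = 0 → v = 0 := by
  obtain ⟨n, d, rfl⟩ := W.exists_eq_sum_diag h2 x
  induction n using Nat.strong_induction_on with | _ n ih => ?_
  by_cases h : ∀ v : Fin n → K, ∑ i, (d i : K) * v i ^ 2 = 0 → v = 0
  · exact ⟨n, d, rfl, h⟩
  · push Not at h
    obtain ⟨v, hv', hv⟩ := h
    obtain ⟨r, hr, hr'⟩ := (isWittMap_diag K).exists_shorter_of_isotropic d hv hv'
    obtain ⟨f, hf⟩ := Multiset.exists_fin_map r
    rw [hr', hf]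
    exact ih _ (by simpa using hr) f

end WittMap

/-! ### Forms over Laurent series -/

section Laurent

open PowerSeries

/-- Hensel's lemma for the polynomial Y² - f with approximate root 1, where the derivative is the
unit 2. -/
theorem exists_sq_eq_of_constantCoeff_eq_one {B : Type*} [CommRing B] (h2 : IsUnit (2 : B))
    (f : PowerSeries B) (hf : constantCoeff f = 1) :
    ∃ g : PowerSeries B, g ^ 2 = f ∧ constantCoeff g = 1 := by
  have h := HenselianRing.is_henselian (I := Ideal.span {(X : PowerSeries B)})
    (Polynomial.X ^ 2 - Polynomial.C f) (Polynomial.monic_X_pow_sub_C f two_ne_zero) 1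
    (by
      have : (X : PowerSeries B) ∣ 1 - f := X_dvd_iff.2 (by simp [hf])
      simpa [Ideal.mem_span_singleton] using this)
    (by
      have : IsUnit (2 : PowerSeries B) := by
        have := h2.map (C : B →+* PowerSeries B)
        rwa [map_ofNat] at this
      simpa [Polynomial.derivative_X_pow, one_add_one_eq_two] using this.map _)
  obtain ⟨g, hg, hg'⟩ := h
  refine ⟨g, ?_, ?_⟩
  · simpa [sub_eq_zero] using hg
  · rw [Ideal.mem_span_singleton, X_dvd_iff] at hg'
    simpa [sub_eq_zero] using hg'

variable {k : Type u} [Field k]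

variable (k) in
/-- The inclusion of the constants in the field of Laurent series. -/
noncomputable def constLaurent : k →+* LaurentSeries k :=
  (algebraMap (PowerSeries k) (LaurentSeries k)).comp (C : k →+* PowerSeries k)

variable (k) in
/-- The uniformizer of the field of Laurent series. -/
noncomputable def unifLaurent : (LaurentSeries k)ˣ :=
  Units.mk0 (algebraMap (PowerSeries k) (LaurentSeries k) X)
    ((map_ne_zero_iff _ (IsFractionRing.injective _ _)).2 X_ne_zero)

/-- The series c⁻¹ f has constant term 1 and is therefore a square: units of k[[s]] contribute only
classes defined over k. -/
theorem diag_eq_of_constantCoeff (h2 : (2 : k) ≠ 0) (f : PowerSeries k) (c : kˣ)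
    (hf : constantCoeff f = c) (u : (LaurentSeries k)ˣ)
    (hu : algebraMap (PowerSeries k) (LaurentSeries k) f = u) :
    W.diag u = W.map (constLaurent k) (W.diag c) := by
  obtain ⟨g, hg, hg'⟩ := exists_sq_eq_of_constantCoeff_eq_one h2.isUnit (C (c⁻¹ : k) * f)
    (by simp [hf])
  have hg0 : g ≠ 0 := fun h => by simp [h] at hg'
  rw [W.map_diag]
  have : u = Units.map (constLaurent k) c * Units.mk0 (algebraMap (PowerSeries k) (LaurentSeries k) g)
      ((map_ne_zero_iff _ (IsFractionRing.injective _ _)).2 hg0) ^ 2 := by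
    ext1
    rw [Units.val_mul, Units.val_pow_eq_pow_val, Units.val_mk0, ← map_pow, hg, ← hu]
    simp only [constLaurent, Units.coe_map, MonoidHom.coe_coe, RingHom.comp_apply]
    rw [← map_mul, ← mul_assoc, ← map_mul, mul_inv_cancel₀ c.ne_zero, map_one, one_mul]
  rw [this, (isWittMap_diag _).mul_sq]

/-- With x and y represented by anisotropic forms, the form x + ⟨s⟩ y stays anisotropic over k((s))
by infinite descent. If its class is zero, both forms have dimension zero. -/
theorem eq_zero_of_map_add_unif_mul_map_eq_zero (h2 : (2 : k) ≠ 0) {x y : W k}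
    (h : W.map (constLaurent k) x +
      W.diag (unifLaurent k) * W.map (constLaurent k) y = 0) : x = 0 ∧ y = 0 := by
  obtain ⟨m, d, rfl, hd⟩ := W.exists_anisotropic h2 x
  obtain ⟨n, e, rfl, he⟩ := W.exists_anisotropic h2 y
  suffices IsEmpty (Fin m ⊕ Fin n) by
    rw [isEmpty_sum] at this
    obtain ⟨h1, h3⟩ := this
    simp
  by_contra hne
  rw [not_isEmpty_iff] at hne
  have h2' : (2 : LaurentSeries k) ≠ 0 := by
    rw [← map_ofNat (constLaurent k) 2]
    exact (map_ne_zero _).2 h2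
  obtain ⟨v, hv, hv0⟩ := exists_isotropic_of_sum_diag_eq_zero h2' (ι := Fin m ⊕ Fin n)
    (d := Sum.elim (fun i => Units.map (constLaurent k) (d i))
      (fun j => unifLaurent k * Units.map (constLaurent k) (e j))) (by
      rw [Fintype.sum_sum_type]
      simpa [W.map_diag, W.diag_mul, Finset.mul_sum] using h)
  -- Clearing denominators moves the isotropic vector into power series.
  obtain ⟨b, hb⟩ := IsLocalization.exist_integer_multiples_of_finite
    (nonZeroDivisors (PowerSeries k)) v
  choose w hw using hb
  have hw0 : w ≠ 0 := by
    rintro rfl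
    apply hv
    funext i
    have := hw i
    rw [Algebra.smul_def, Pi.zero_apply, map_zero, eq_comm, mul_eq_zero] at this
    exact this.resolve_left
      ((map_ne_zero_iff _ (IsFractionRing.injective _ _)).2 (nonZeroDivisors.coe_ne_zero b))
  have hwq : ∑ i, C (d i : k) * w (.inl i) ^ 2 + X * ∑ j, C (e j : k) * w (.inr j) ^ 2 = 0 := by
    apply IsFractionRing.injective (PowerSeries k) (LaurentSeries k)
    rw [map_zero, ← mul_zero (algebraMap _ _ (b : PowerSeries k) ^ 2), ← hv0, Fintype.sum_sum_type]
    simp only [map_add, map_mul, map_sum, map_pow, hw, Algebra.smul_def, Finset.mul_sum, mul_add]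
    congr 1 <;> refine Finset.sum_congr rfl fun i _ => ?_
    · simp only [Sum.elim_inl, Units.coe_map, MonoidHom.coe_coe, constLaurent,
        RingHom.comp_apply]
      ring
    · simp only [Sum.elim_inr, Units.val_mul, Units.coe_map, MonoidHom.coe_coe, constLaurent,
        RingHom.comp_apply, unifLaurent, Units.val_mk0]
      ring
  clear hw hv0 hv h
  have key : ∀ (N : ℕ) (w : Fin m ⊕ Fin n → PowerSeries k),
      ∑ i, C (d i : k) * w (.inl i) ^ 2 + X * ∑ j, C (e j : k) * w (.inr j) ^ 2 = 0 →
      ∀ i, coeff N (w i) = 0 := by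
    intro N
    -- At s = 0 the equation kills the constant terms of the first block. After division by s it
    -- kills those of the second block, and then the whole vector can be divided by s.
    have h0 : ∀ w : Fin m ⊕ Fin n → PowerSeries k,
        ∑ i, C (d i : k) * w (.inl i) ^ 2 + X * ∑ j, C (e j : k) * w (.inr j) ^ 2 = 0 →
        ∀ i, X ∣ w i := by
      intro w hwq
      have h1 := congrArg constantCoeff hwq
      simp only [map_add, map_sum, map_mul, map_pow, constantCoeff_C, constantCoeff_X, zero_mul,
        add_zero, map_zero] at h1
      have h3 := hd (fun i => constantCoeff (w (.inl i))) h1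
      have h4 : ∀ i, X ∣ w (.inl i) := fun i => X_dvd_iff.2 (congrFun h3 i)
      choose z hz using h4
      have h5 : X * (X * ∑ i, C (d i : k) * z i ^ 2 + ∑ j, C (e j : k) * w (.inr j) ^ 2) = 0 := by
        rw [← hwq]
        simp only [hz, mul_add, Finset.mul_sum]
        congr 1
        refine Finset.sum_congr rfl fun i _ => ?_
        ring
      have h6 := congrArg constantCoeff ((mul_eq_zero.1 h5).resolve_left X_ne_zero)
      simp only [map_add, map_sum, map_mul, map_pow, constantCoeff_C, constantCoeff_X, zero_mul,
        zero_add, map_zero] at h6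
      have h7 := he (fun i => constantCoeff (w (.inr i))) h6
      rintro (i | j)
      · exact X_dvd_iff.2 (congrFun h3 i)
      · exact X_dvd_iff.2 (congrFun h7 j)
    induction N with
    | zero =>
      intro w hwq i
      simpa using X_dvd_iff.1 (h0 w hwq i)
    | succ N ih =>
      intro w hwq i
      choose z hz using h0 w hwq
      rw [hz, mul_comm, coeff_succ_mul_X]
      refine ih z ?_ i
      have : (X : PowerSeries k) ^ 2 ≠ 0 := pow_ne_zero _ X_ne_zero
      refine (mul_eq_zero.1 ?_).resolve_left this
      rw [← hwq]
      simp only [hz, mul_add, Finset.mul_sum]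
      congr 1 <;> refine Finset.sum_congr rfl fun i _ => ?_ <;> ring
  exact hw0 (funext fun i => PowerSeries.ext fun N => key N w hwq i)

theorem map_constLaurent_injective (h2 : (2 : k) ≠ 0) :
    Function.Injective (W.map (constLaurent k)) := by
  rw [injective_iff_map_eq_zero]
  intro x hx
  refine (eq_zero_of_map_add_unif_mul_map_eq_zero h2 (x := x) (y := 0) ?_).1
  rw [hx, map_zero, mul_zero, add_zero]

end Laurent

/-! ### Extensions of odd degree -/

section OddDegree

open Polynomial

variable {K : Type u} [Field K]

/-- The coefficient of X^(2m) is the value of the anisotropic form at the vector of coefficients of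
X^m, so leading terms cannot cancel. -/
theorem natDegree_sum_sq_of_anisotropic {n : ℕ} {d : Fin n → Kˣ}
    (hd : ∀ v : Fin n → K, ∑ i, (d i : K) * v i ^ 2 = 0 → v = 0) (v : Fin n → K[X]) (m : ℕ)
    (hm : ∀ i, (v i).natDegree ≤ m) (hm' : ∃ i, (v i).coeff m ≠ 0) :
    (∑ i, C (d i : K) * v i ^ 2).natDegree = 2 * m ∧ ∑ i, C (d i : K) * v i ^ 2 ≠ 0 := by
  have hc : (∑ i, C (d i : K) * v i ^ 2).coeff (2 * m) = ∑ i, (d i : K) * (v i).coeff m ^ 2 := by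
    rw [finsetSum_coeff]
    refine Finset.sum_congr rfl fun i _ => ?_
    rw [coeff_C_mul, coeff_pow_of_natDegree_le (hm i)]
  have hc0 : (∑ i, C (d i : K) * v i ^ 2).coeff (2 * m) ≠ 0 := by
    rw [hc]
    intro h
    obtain ⟨i, hi⟩ := hm'
    exact hi (congrFun (hd _ h) i)
  refine ⟨natDegree_eq_of_le_of_coeff_ne_zero ?_ hc0, fun h => hc0 (by rw [h, coeff_zero])⟩
  · refine natDegree_sum_le_of_forall_le _ _ fun i _ => ?_
    refine (natDegree_C_mul_le _ _).trans (natDegree_pow_le.trans ?_)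
    have := hm i
    omega

theorem exists_irreducible_factor_odd {f : K[X]} (hf : Odd f.natDegree) :
    ∃ p, Irreducible p ∧ p ∣ f ∧ Odd p.natDegree := by
  induction h : f.natDegree using Nat.strong_induction_on generalizing f with | _ N ih => ?_
  subst h
  have hf0 : f ≠ 0 := by rintro rfl; simp at hf
  have hfu : ¬ IsUnit f := fun hu => by simp [natDegree_eq_zero_of_isUnit hu] at hf
  by_cases hirr : Irreducible f
  · exact ⟨f, hirr, dvd_rfl, hf⟩
  · rw [irreducible_iff] at hirr
    push Not at hirr
    obtain ⟨a, b, rfl, ha, hb⟩ := hirr hfu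
    have ha0 := left_ne_zero_of_mul hf0
    have hb0 := right_ne_zero_of_mul hf0
    have ha1 : 0 < a.natDegree := Nat.pos_of_ne_zero fun h =>
      ha (isUnit_iff_degree_eq_zero.2 (by rw [degree_eq_natDegree ha0, h]; rfl))
    have hb1 : 0 < b.natDegree := Nat.pos_of_ne_zero fun h =>
      hb (isUnit_iff_degree_eq_zero.2 (by rw [degree_eq_natDegree hb0, h]; rfl))
    rw [natDegree_mul ha0 hb0] at hf ih
    rcases Nat.even_or_odd a.natDegree with ha2 | ha2
    · obtain ⟨p, h1, h2, h3⟩ := ih b.natDegree (by omega) ((Nat.odd_add'.1 hf).2 ha2) rfl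
      exact ⟨p, h1, h2.mul_left a, h3⟩
    · obtain ⟨p, h1, h2, h3⟩ := ih a.natDegree (by omega) ha2 rfl
      exact ⟨p, h1, h2.mul_right b, h3⟩

/-- This is the descent in Springer's theorem. Once the entries are reduced modulo p and divided by
their gcd, the value of the form has even degree less than 2 deg p. The cofactor of p thus has odd
degree less than deg p, and an irreducible factor of odd degree of the cofactor divides all entries
by induction, against coprimality. -/
theorem dvd_of_dvd_sum_sq {n : ℕ} {d : Fin n → Kˣ}
    (hd : ∀ v : Fin n → K, ∑ i, (d i : K) * v i ^ 2 = 0 → v = 0) (p : K[X]) (hp : Irreducible p)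
    (hodd : Odd p.natDegree) (v : Fin n → K[X]) (hv : p ∣ ∑ i, C (d i : K) * v i ^ 2) (i : Fin n) :
    p ∣ v i := by
  induction h : p.natDegree using Nat.strong_induction_on generalizing p v i with | _ N ih => ?_
  subst h
  by_contra hi
  let := Classical.arbitrary (NormalizedGCDMonoid K[X])
  let r : Fin n → K[X] := fun j => v j % p
  have hri : r i ≠ 0 := fun h => hi (EuclideanDomain.mod_eq_zero.1 h)
  have hr : p ∣ ∑ j, C (d j : K) * r j ^ 2 := by
    have : p ∣ ∑ j, C (d j : K) * v j ^ 2 - ∑ j, C (d j : K) * r j ^ 2 := by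
      rw [← Finset.sum_sub_distrib]
      refine Finset.dvd_sum fun j _ => ?_
      rw [← mul_sub]
      refine Dvd.dvd.mul_left ?_ _
      rw [sq_sub_sq]
      refine Dvd.dvd.mul_left ?_ _
      exact ⟨v j / p, by rw [sub_eq_iff_eq_add]; exact (EuclideanDomain.div_add_mod _ _).symm⟩
    exact (dvd_sub_right hv).1 this
  have hrd : ∀ j, r j = 0 ∨ (r j).natDegree < p.natDegree := fun j => by
    by_cases h : r j = 0
    · exact Or.inl h
    · exact Or.inr (natDegree_lt_natDegree h (EuclideanDomain.mod_lt (v j) hp.ne_zero))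
  obtain ⟨w, hw, hw1⟩ := Finset.extract_gcd r ⟨i, Finset.mem_univ i⟩
  set g := Finset.univ.gcd r with hg
  have hg0 : g ≠ 0 := fun h => hri (Finset.gcd_eq_zero_iff.1 h i (Finset.mem_univ i))
  have hgp : ¬ p ∣ g := fun h => by
    have := natDegree_le_of_dvd (h.trans (Finset.gcd_dvd (Finset.mem_univ i))) hri
    rcases hrd i with h | h
    · exact hri h
    · omega
  have hwd : ∀ j, (w j).natDegree < p.natDegree := fun j => by
    rcases hrd j with h | h
    · have : w j = 0 := by
        rw [hw j (Finset.mem_univ j)] at h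
        exact (mul_eq_zero.1 h).resolve_left hg0
      rw [this, natDegree_zero]
      exact hodd.pos
    · refine lt_of_le_of_lt ?_ h
      rw [hw j (Finset.mem_univ j)]
      by_cases hwj : w j = 0
      · simp [hwj]
      · rw [natDegree_mul hg0 hwj]; omega
  have hwp : p ∣ ∑ j, C (d j : K) * w j ^ 2 := by
    have : ∑ j, C (d j : K) * r j ^ 2 = g ^ 2 * ∑ j, C (d j : K) * w j ^ 2 := by
      rw [Finset.mul_sum]
      refine Finset.sum_congr rfl fun j hj => ?_
      rw [hw j hj]; ring
    rw [this] at hr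
    exact (hp.prime.dvd_or_dvd hr).resolve_left fun h => hgp (hp.prime.dvd_of_dvd_pow h)
  obtain ⟨j, -, hj⟩ := Finset.exists_max_image Finset.univ (fun j => (w j).natDegree)
    ⟨i, Finset.mem_univ i⟩
  have hwi : ∃ j, w j ≠ 0 := ⟨i, fun h => hri (by rw [hw i (Finset.mem_univ i), h, mul_zero])⟩
  obtain ⟨hdeg, hne⟩ := natDegree_sum_sq_of_anisotropic hd w (w j).natDegree
    (fun i => hj i (Finset.mem_univ i)) (by
      by_cases hwj : w j = 0
      · obtain ⟨l, hl⟩ := hwi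
        refine ⟨l, ?_⟩
        have h1 := hj l (Finset.mem_univ l)
        rw [hwj, natDegree_zero] at h1 ⊢
        rw [← Nat.le_zero.1 h1]
        exact leadingCoeff_ne_zero.2 hl
      · exact ⟨j, leadingCoeff_ne_zero.2 hwj⟩)
  obtain ⟨h, hh⟩ := hwp
  have hh0 : h ≠ 0 := fun h0 => hne (by rw [hh, h0, mul_zero])
  rw [hh, natDegree_mul hp.ne_zero hh0] at hdeg
  have hjp := hwd j
  have hhodd : Odd h.natDegree := by
    rw [Nat.odd_iff] at hodd ⊢
    omega
  obtain ⟨p', hp', hp'h, hp'odd⟩ := exists_irreducible_factor_odd hhodd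
  have hle := natDegree_le_of_dvd hp'h hh0
  have hall := ih p'.natDegree (by omega) p' hp' hp'odd w (hh ▸ hp'h.mul_left p)
  refine hp'.not_isUnit (isUnit_of_dvd_one ?_)
  rw [← hw1]
  exact Finset.dvd_gcd fun l _ => hall l rfl

/-- With L = K[θ], an isotropic vector over L of an anisotropic form over K lifts to polynomials at
which the form is divisible by the minimal polynomial of θ. This polynomial has odd degree, so it
divides every entry and the vector is zero. -/
theorem W.map_injective_of_odd_finrank (h2 : (2 : K) ≠ 0) (L : Type u) [Field L] [Algebra K L]
    [FiniteDimensional K L] [Algebra.IsSeparable K L] (hodd : Odd (Module.finrank K L)) :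
    Function.Injective (W.map (algebraMap K L)) := by
  rw [injective_iff_map_eq_zero]
  intro x hx
  obtain ⟨n, d, rfl, hd⟩ := W.exists_anisotropic h2 x
  suffices IsEmpty (Fin n) by simp
  by_contra hne
  rw [not_isEmpty_iff] at hne
  have h2' : (2 : L) ≠ 0 := by
    rw [← map_ofNat (algebraMap K L) 2]
    exact (_root_.map_ne_zero _).2 h2
  obtain ⟨v, hv, hv0⟩ := exists_isotropic_of_sum_diag_eq_zero h2'
    (d := fun i => Units.map (algebraMap K L) (d i)) (by simpa [W.map_diag] using hx)
  obtain ⟨θ, hθ⟩ := Field.exists_primitive_element K L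
  have hint : IsIntegral K θ := Algebra.IsIntegral.isIntegral θ
  have hsurj : ∀ x : L, ∃ f : K[X], aeval θ f = x := fun x => by
    have hx : x ∈ (⊤ : IntermediateField K L) := trivial
    rw [← hθ, ← IntermediateField.mem_toSubalgebra,
      IntermediateField.adjoin_simple_toSubalgebra_of_isAlgebraic hint.isAlgebraic,
      Algebra.adjoin_singleton_eq_range_aeval] at hx
    exact hx
  choose f hf using fun i => hsurj (v i)
  apply hv
  funext i
  have hdeg : Odd (minpoly K θ).natDegree := by
    rwa [← IntermediateField.adjoin.finrank hint, hθ, IntermediateField.finrank_top']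
  have := dvd_of_dvd_sum_sq hd (minpoly K θ) (minpoly.irreducible hint) hdeg f
    (minpoly.dvd _ _ (by simpa [hf] using hv0)) i
  rw [← hf]
  exact aeval_eq_zero_of_dvd_aeval_eq_zero this (minpoly.aeval K θ)

end OddDegree

/-! ### Functoriality of the extension of scalars on Witt rings. -/

section MapComp

theorem W.map_comp {K : Type u} [Field K] {L : Type v} [Field L] {M : Type*} [Field M]
    (φ : K →+* L) (ψ : L →+* M) (x : W K) : W.map (ψ.comp φ) x = W.map ψ (W.map φ x) := by
  obtain ⟨x, rfl⟩ := W.mk_surjective x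
  induction x using FormClass.ind with | _ n A hA => ?_
  simp only [W.map_mk, FormClass.map_cls]
  rfl

end MapComp

/-! ### Specializations of rational functions -/

section Specialization

open Polynomial

variable {K : Type u} [Field K]

/-- The homomorphism `f ↦ f(θ + s)` from polynomials to power series in `s`. -/
noncomputable def taylorHom {k : Type u} [Field k] (φ : K →+* k) (θ : k) :
    K[X] →+* PowerSeries k :=
  Polynomial.coeToPowerSeries.ringHom.comp ((taylorAlgHom θ).toRingHom.comp (mapRingHom φ))

variable {k : Type u} [Field k] (φ : K →+* k) (θ : k)

theorem taylorHom_apply (f : K[X]) :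
    taylorHom φ θ f = ((taylor θ (f.map φ) : k[X]) : PowerSeries k) := rfl

theorem taylorHom_injective : Function.Injective (taylorHom φ θ) := by
  intro f g h
  rw [taylorHom_apply, taylorHom_apply] at h
  exact map_injective φ φ.injective (taylor_injective θ (Polynomial.coe_injective _ h))

theorem constantCoeff_taylorHom (f : K[X]) :
    PowerSeries.constantCoeff (taylorHom φ θ f) = f.eval₂ φ θ := by
  rw [taylorHom_apply, ← PowerSeries.coeff_zero_eq_constantCoeff_apply, Polynomial.coeff_coe,
    taylor_coeff_zero, eval_map]

theorem taylorHom_X : taylorHom φ θ X = PowerSeries.C θ + PowerSeries.X := by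
  rw [taylorHom_apply, map_X, taylor_X, Polynomial.coe_add, Polynomial.coe_X, Polynomial.coe_C,
    add_comm]

theorem taylorHom_C (c : K) : taylorHom φ θ (C c) = PowerSeries.C (φ c) := by
  rw [taylorHom_apply, map_C, taylor_C, Polynomial.coe_C]

/-- The embedding of `K(t)` into the Laurent series over `k` with `t ↦ θ + s`. -/
noncomputable def specialize : FractionRing K[X] →+* LaurentSeries k :=
  IsFractionRing.lift (A := K[X]) (g := (algebraMap (PowerSeries k) (LaurentSeries k)).comp
    (taylorHom φ θ)) ((IsFractionRing.injective _ _).comp (taylorHom_injective φ θ))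

theorem specialize_algebraMap (f : K[X]) :
    specialize φ θ (algebraMap K[X] (FractionRing K[X]) f) =
      algebraMap (PowerSeries k) (LaurentSeries k) (taylorHom φ θ f) :=
  IsFractionRing.lift_algebraMap _ _

variable (K) in
/-- The inclusion of `K` in `K(t)`. -/
noncomputable def constRat : K →+* FractionRing K[X] := (algebraMap K[X] (FractionRing K[X])).comp C

theorem specialize_comp_constRat :
    (specialize φ θ).comp (constRat K) = (constLaurent k).comp φ := by
  ext c
  simp only [RingHom.comp_apply, constRat, specialize_algebraMap, taylorHom_C, constLaurent]

/-! ### Forms over rational functions -/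

/-- The class `⟨f⟩` over `K(t)`, and zero for `f = 0`. -/
noncomputable def polyDiag (f : K[X]) : W (FractionRing K[X]) :=
  open Classical in
  if h : algebraMap K[X] (FractionRing K[X]) f = 0 then 0 else W.diag (Units.mk0 _ h)

theorem polyDiag_zero : polyDiag (0 : K[X]) = 0 := by simp [polyDiag]

theorem polyDiag_of_ne_zero {f : K[X]} (h : algebraMap K[X] (FractionRing K[X]) f ≠ 0) :
    polyDiag f = W.diag (Units.mk0 _ h) := by simp [polyDiag, h]

theorem algebraMap_ne_zero {f : K[X]} (h : f ≠ 0) : algebraMap K[X] (FractionRing K[X]) f ≠ 0 :=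
  (map_ne_zero_iff _ (IsFractionRing.injective _ _)).2 h

theorem polyDiag_one : polyDiag (1 : K[X]) = 1 := by
  rw [polyDiag_of_ne_zero (algebraMap_ne_zero one_ne_zero), ← W.diag_one]
  congr 1
  ext
  simp

theorem polyDiag_mul (f g : K[X]) : polyDiag (f * g) = polyDiag f * polyDiag g := by
  rcases eq_or_ne f 0 with rfl | hf
  · rw [zero_mul, polyDiag_zero, zero_mul]
  rcases eq_or_ne g 0 with rfl | hg
  · rw [mul_zero, polyDiag_zero, mul_zero]
  rw [polyDiag_of_ne_zero (algebraMap_ne_zero hf), polyDiag_of_ne_zero (algebraMap_ne_zero hg),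
    polyDiag_of_ne_zero (algebraMap_ne_zero (mul_ne_zero hf hg)), ← W.diag_mul]
  congr 1
  ext
  simp

theorem polyDiag_mul_self {f : K[X]} (hf : f ≠ 0) : polyDiag f * polyDiag f = 1 := by
  rw [polyDiag_of_ne_zero (algebraMap_ne_zero hf), ← W.diag_mul, ← W.diag_one,
    ← (isWittMap_diag _).mul_sq 1 (Units.mk0 _ (algebraMap_ne_zero hf)), one_mul, sq]

theorem polyDiag_neg (f : K[X]) : polyDiag (-f) = -polyDiag f := by
  rcases eq_or_ne f 0 with rfl | hf
  · rw [neg_zero, polyDiag_zero, neg_zero]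
  rw [polyDiag_of_ne_zero (algebraMap_ne_zero hf),
    polyDiag_of_ne_zero (algebraMap_ne_zero (neg_ne_zero.2 hf)), ← W.diag_neg]
  congr 1
  ext
  simp

/-- The convention ⟨0⟩ = 0 keeps the relation valid in all cases; for f + g = 0 it reads ⟨f⟩ + ⟨-f⟩
= 0. -/
theorem polyDiag_add (f g : K[X]) :
    polyDiag f + polyDiag g = polyDiag (f + g) + polyDiag (f * g * (f + g)) := by
  rcases eq_or_ne f 0 with rfl | hf
  · simp [polyDiag_zero]
  rcases eq_or_ne g 0 with rfl | hg
  · simp [polyDiag_zero]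
  rcases eq_or_ne (f + g) 0 with hfg | hfg
  · rw [hfg, mul_zero, polyDiag_zero, eq_neg_of_add_eq_zero_left hfg, polyDiag_neg]
    simp
  rw [polyDiag_of_ne_zero (algebraMap_ne_zero hf), polyDiag_of_ne_zero (algebraMap_ne_zero hg),
    polyDiag_of_ne_zero (algebraMap_ne_zero hfg),
    polyDiag_of_ne_zero (algebraMap_ne_zero (mul_ne_zero (mul_ne_zero hf hg) hfg)),
    (isWittMap_diag _).add _ _ (Units.mk0 _ (algebraMap_ne_zero hfg)) (by simp)]
  congr 2
  ext
  simp

/-- A polynomial that does not vanish at θ becomes a unit of k[[s]] under t = θ + s, and only its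
value at θ matters for the class. -/
theorem map_specialize_polyDiag (h2 : (2 : k) ≠ 0) (f : K[X]) (c : kˣ) (hc : f.eval₂ φ θ = c) :
    W.map (specialize φ θ) (polyDiag f) = W.map (constLaurent k) (W.diag c) := by
  have hf : f ≠ 0 := by
    rintro rfl
    exact c.ne_zero (by simpa using hc.symm)
  rw [polyDiag_of_ne_zero (algebraMap_ne_zero hf), W.map_diag]
  refine diag_eq_of_constantCoeff h2 (taylorHom φ θ f) c ?_ _ ?_
  · rw [constantCoeff_taylorHom, hc]
  · simp [specialize_algebraMap]

variable (K) in
/-- The subring of the Witt ring of `K(t)` generated by polynomials of degree less than `d`. -/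
noncomputable def degFilt (d : ℕ) : Subring (W (FractionRing K[X])) :=
  Subring.closure (polyDiag '' {f | f.natDegree < d})

theorem polyDiag_mem_degFilt {d : ℕ} {f : K[X]} (hf : f.natDegree < d) :
    polyDiag f ∈ degFilt K d := Subring.subset_closure ⟨f, hf, rfl⟩

theorem exists_mem_degFilt (h2 : (2 : K) ≠ 0) (x : W (FractionRing K[X])) :
    ∃ d, x ∈ degFilt K (d + 1) := by
  have h2' : (2 : FractionRing K[X]) ≠ 0 := by
    rw [← map_ofNat (constRat K) 2]
    exact (_root_.map_ne_zero _).2 h2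
  obtain ⟨n, e, rfl⟩ := W.exists_eq_sum_diag h2' x
  have h : ∀ i, ∃ f : K[X], W.diag (e i) = polyDiag f := by
    intro i
    obtain ⟨a, b, hb, hab⟩ := IsFractionRing.div_surjective (A := K[X]) (e i : FractionRing K[X])
    have hb0 : algebraMap K[X] (FractionRing K[X]) b ≠ 0 :=
      algebraMap_ne_zero (nonZeroDivisors.ne_zero hb)
    have ha0 : algebraMap K[X] (FractionRing K[X]) a ≠ 0 := fun h => by
      rw [h, zero_div] at hab
      exact (e i).ne_zero hab.symm
    -- The fraction a / b differs from the polynomial ab by the square b².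
    refine ⟨a * b, ?_⟩
    rw [polyDiag_of_ne_zero (by rw [map_mul]; exact mul_ne_zero ha0 hb0),
      ← (isWittMap_diag _).mul_sq (e i) (Units.mk0 _ hb0)]
    congr 1
    ext
    simp only [Units.val_mul, Units.val_pow_eq_pow_val, Units.val_mk0, map_mul, ← hab]
    field_simp
  choose f hf using h
  refine ⟨∑ i, (f i).natDegree, sum_mem fun i _ => ?_⟩
  rw [hf]
  refine polyDiag_mem_degFilt (Nat.lt_succ_of_le ?_)
  exact Finset.single_le_sum (f := fun i => (f i).natDegree) (fun _ _ => Nat.zero_le _)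
    (Finset.mem_univ i)

theorem degFilt_one_le (x : W (FractionRing K[X])) (hx : x ∈ degFilt K 1) :
    ∃ y : W K, W.map (constRat K) y = x := by
  have : degFilt K 1 ≤ (W.map (constRat K)).range := by
    refine Subring.closure_le.2 ?_
    rintro _ ⟨f, hf, rfl⟩
    obtain ⟨c, rfl⟩ := natDegree_eq_zero.1 (Nat.lt_one_iff.1 hf)
    rcases eq_or_ne c 0 with rfl | hc
    · exact ⟨0, by rw [map_zero, C_0, polyDiag_zero]⟩
    · refine ⟨W.diag (Units.mk0 c hc), ?_⟩
      rw [W.map_diag, polyDiag_of_ne_zero (algebraMap_ne_zero (C_ne_zero.2 hc))]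
      exact congrArg W.diag (Units.ext rfl)
  exact this hx

/-- Monic irreducible polynomials of degree `d`, together with `1`. -/
def IsPrimeOrOne (d : ℕ) (p : K[X]) : Prop := p = 1 ∨ (p.Monic ∧ Irreducible p ∧ p.natDegree = d)

theorem natDegree_sub_lt_of_monic {p q : K[X]} {d : ℕ} (hd : 0 < d) (hp : p.Monic) (hq : q.Monic)
    (hpd : p.natDegree = d) (hqd : q.natDegree = d) : (p - q).natDegree < d := by
  rcases eq_or_ne p q with rfl | hpq
  · simpa using hd
  · rw [← hpd]
    refine natDegree_lt_natDegree (sub_ne_zero.2 hpq) (degree_sub_lt_left ?_ hp.ne_zero ?_)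
    · rw [degree_eq_natDegree hp.ne_zero, degree_eq_natDegree hq.ne_zero, hpd, hqd]
    · rw [hp.leadingCoeff, hq.leadingCoeff]

/-- Two monic primes p, q of degree d have a difference of smaller degree, and the relation for q +
(p - q) = p makes ⟨p⟩⟨q⟩ linear in ⟨p⟩ and ⟨q⟩. Reducible polynomials of degree d already belong to
the smaller ring. So the span is stable under multiplication by all generators. -/
theorem degFilt_succ_le {d : ℕ} (hd : 0 < d) {x : W (FractionRing K[X])}
    (hx : x ∈ degFilt K (d + 1)) :
    x ∈ Submodule.span (degFilt K d)
      (Set.range fun p : {p : K[X] // IsPrimeOrOne d p} => polyDiag p.1) := by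
  set M := Submodule.span (degFilt K d)
      (Set.range fun p : {p : K[X] // IsPrimeOrOne d p} => polyDiag p.1) with hM
  have hgen : ∀ p : K[X], IsPrimeOrOne d p → polyDiag p ∈ M := fun p hp =>
    Submodule.subset_span ⟨⟨p, hp⟩, rfl⟩
  have hmul : ∀ l ∈ degFilt K d, ∀ m ∈ M, l * m ∈ M := fun l hl m hm =>
    M.smul_mem ⟨l, hl⟩ hm
  have hone : (1 : W (FractionRing K[X])) ∈ M := polyDiag_one (K := K) ▸ hgen 1 (Or.inl rfl)
  have hle : ∀ l ∈ degFilt K d, l ∈ M := fun l hl => by simpa using hmul l hl 1 hone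
  have hprime : ∀ p : K[X], p.Monic → Irreducible p → p.natDegree = d → ∀ m ∈ M,
      polyDiag p * m ∈ M := by
    intro p hp1 hp2 hp3 m hm
    induction hm using Submodule.span_induction with
    | mem m hm =>
      obtain ⟨⟨q, hq⟩, rfl⟩ := hm
      rcases hq with rfl | ⟨hq1, hq2, hq3⟩
      · change polyDiag p * polyDiag 1 ∈ M
        rw [polyDiag_one, mul_one]
        exact hgen p (Or.inr ⟨hp1, hp2, hp3⟩)
      · change polyDiag p * polyDiag q ∈ M
        rcases eq_or_ne p q with rfl | hpq
        · rwa [polyDiag_mul_self hp1.ne_zero]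
        · have hr := natDegree_sub_lt_of_monic hd hp1 hq1 hp3 hq3
          have h1 := polyDiag_add q (p - q)
          rw [add_sub_cancel, polyDiag_mul, polyDiag_mul] at h1
          -- The relation `h1` is multiplied by ⟨p - q⟩, whose square is 1.
          have h3 : polyDiag p * polyDiag q = polyDiag (p - q) *
              (polyDiag q + polyDiag (p - q) - polyDiag p) := by
            linear_combination (-polyDiag (p - q)) * h1 +
              (-polyDiag p * polyDiag q) * polyDiag_mul_self (sub_ne_zero.2 hpq)
          rw [h3]
          refine hmul _ (polyDiag_mem_degFilt hr) _ (sub_mem (add_mem (hgen q ?_) (hle _ ?_))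
            (hgen p ?_))
          · exact Or.inr ⟨hq1, hq2, hq3⟩
          · exact polyDiag_mem_degFilt hr
          · exact Or.inr ⟨hp1, hp2, hp3⟩
    | zero => rw [mul_zero]; exact zero_mem _
    | add m m' _ _ h h' => rw [mul_add]; exact add_mem h h'
    | smul l m _ h =>
      rw [mul_smul_comm]
      exact M.smul_mem _ h
  suffices h : ∀ x ∈ degFilt K (d + 1), ∀ m ∈ M, x * m ∈ M by simpa using h x hx 1 hone
  intro x hx
  induction hx using Subring.closure_induction with
  | mem x hx =>
    obtain ⟨f, hf, rfl⟩ := hx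
    intro m hm
    have hf : f.natDegree < d + 1 := hf
    rcases lt_or_eq_of_le (Nat.lt_succ_iff.1 hf) with hlt | heq
    · exact hmul _ (polyDiag_mem_degFilt hlt) m hm
    · have hf0 : f ≠ 0 := by
        rintro rfl
        simp at heq
        omega
      by_cases hirr : Irreducible f
      · have hfm : f = C f.leadingCoeff * (f * C f.leadingCoeff⁻¹) := by
          rw [mul_comm f, ← mul_assoc, ← C_mul, mul_inv_cancel₀ (leadingCoeff_ne_zero.2 hf0), C_1,
            one_mul]
        rw [hfm, polyDiag_mul, mul_assoc]
        have hu : IsUnit (C f.leadingCoeff⁻¹) :=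
          isUnit_C.2 (inv_ne_zero (leadingCoeff_ne_zero.2 hf0)).isUnit
        refine hmul _ (polyDiag_mem_degFilt (by simpa using hd)) _
          (hprime _ (monic_mul_leadingCoeff_inv hf0) ?_ ?_ m hm)
        · exact (irreducible_mul_isUnit hu).2 hirr
        · rw [natDegree_mul_leadingCoeff_inv f hf0, heq]
      · have hfu : ¬ IsUnit f := fun hu => by
          rw [natDegree_eq_zero_of_isUnit hu] at heq
          omega
        rw [irreducible_iff] at hirr
        push Not at hirr
        obtain ⟨a, b, rfl, ha, hb⟩ := hirr hfu
        have ha0 := left_ne_zero_of_mul hf0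
        have hb0 := right_ne_zero_of_mul hf0
        have ha1 : 0 < a.natDegree := Nat.pos_of_ne_zero fun h =>
          ha (isUnit_iff_degree_eq_zero.2 (by rw [degree_eq_natDegree ha0, h]; rfl))
        have hb1 : 0 < b.natDegree := Nat.pos_of_ne_zero fun h =>
          hb (isUnit_iff_degree_eq_zero.2 (by rw [degree_eq_natDegree hb0, h]; rfl))
        rw [natDegree_mul ha0 hb0] at heq
        rw [polyDiag_mul]
        exact hmul _ (mul_mem (polyDiag_mem_degFilt (by omega)) (polyDiag_mem_degFilt (by omega)))
          m hm
  | zero => intro m _; rw [zero_mul]; exact zero_mem _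
  | one => intro m hm; rwa [one_mul]
  | add x y _ _ h h' => intro m hm; rw [add_mul]; exact add_mem (h m hm) (h' m hm)
  | neg x _ h => intro m hm; rw [neg_mul]; exact neg_mem (h m hm)
  | mul x y _ _ h h' => intro m hm; rw [mul_assoc]; exact h _ (h' m hm)

end Specialization

/-! ### Residues -/

section Residue

open Polynomial

variable {K : Type u} [Field K]

/-- Write p = g(X^(q^n)) with g separable and q the exponential characteristic: every root has
multiplicity q^n, and q is odd. Oddness rather than multiplicity one is what survives for
inseparable residue fields, and it suffices for quadratic forms. -/
theorem odd_rootMultiplicity (h2 : (2 : K) ≠ 0) {p : K[X]} (hp : Irreducible p) {k : Type u}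
    [Field k] (φ : K →+* k) (θ : k) (hθ : p.eval₂ φ θ = 0) :
    Odd ((p.map φ).rootMultiplicity θ) := by
  obtain ⟨q, hq⟩ := ExpChar.exists K
  have : ExpChar k q := expChar_of_injective_ringHom φ.injective q
  obtain ⟨g, hg, n, rfl⟩ := hp.hasSeparableContraction q
  have hqodd : Odd q := by
    cases hq with
    | zero => exact odd_one
    | prime hq =>
      refine hq.odd_of_ne_two ?_
      rintro rfl
      exact h2 (CharTwo.two_eq_zero)
  rw [map_expand, rootMultiplicity_expand_pow]
  have h1 : (g.map φ).rootMultiplicity (θ ^ q ^ n) = 1 := by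
    refine le_antisymm (rootMultiplicity_le_one_of_separable (hg.map (f := φ)) _) ?_
    have hg0 : g.map φ ≠ 0 := (Polynomial.map_ne_zero_iff φ.injective).2 hg.ne_zero
    refine (rootMultiplicity_pos hg0).2 ?_
    rw [← eval_map, map_expand, expand_eval] at hθ
    exact hθ
  rw [h1, mul_one]
  exact hqodd.pow

theorem exists_taylorHom_eq (h2 : (2 : K) ≠ 0) {p : K[X]} (hp : Irreducible p) {k : Type u}
    [Field k] (φ : K →+* k) (θ : k) (hθ : p.eval₂ φ θ = 0) :
    ∃ (e : ℕ) (f : PowerSeries k), PowerSeries.constantCoeff f ≠ 0 ∧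
      taylorHom φ θ p = (PowerSeries.X ^ e) ^ 2 * PowerSeries.X * f := by
  obtain ⟨e, he⟩ := odd_rootMultiplicity h2 hp φ θ hθ
  have hp0 : p.map φ ≠ 0 := (Polynomial.map_ne_zero_iff φ.injective).2 hp.ne_zero
  obtain ⟨g, hg, hg'⟩ := exists_eq_pow_rootMultiplicity_mul_and_not_dvd _ hp0 θ
  refine ⟨e, (taylor θ g : k[X]), ?_, ?_⟩
  · rw [← PowerSeries.coeff_zero_eq_constantCoeff_apply, Polynomial.coeff_coe, taylor_coeff_zero]
    rwa [dvd_iff_isRoot] at hg'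
  · rw [taylorHom_apply, hg, he, taylor_mul, taylor_pow, map_sub, taylor_X, taylor_C,
      add_sub_cancel_right, Polynomial.coe_mul, Polynomial.coe_pow, Polynomial.coe_X]
    ring

/-- As the order of vanishing is odd, p is the uniformizer times a unit times a square. -/
theorem map_specialize_polyDiag_of_root (h2 : (2 : K) ≠ 0) {p : K[X]} (hp : Irreducible p)
    {k : Type u} [Field k] (φ : K →+* k) (θ : k) (hθ : p.eval₂ φ θ = 0) :
    ∃ c : kˣ, W.map (specialize φ θ) (polyDiag p) =
      W.diag (unifLaurent k) * W.map (constLaurent k) (W.diag c) := by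
  have h2' : (2 : k) ≠ 0 := by
    rw [← map_ofNat φ 2]
    exact (_root_.map_ne_zero _).2 h2
  obtain ⟨e, f, hf, hpf⟩ := exists_taylorHom_eq h2 hp φ θ hθ
  have hf0 : f ≠ 0 := fun h => hf (by rw [h, map_zero])
  have hfl : algebraMap (PowerSeries k) (LaurentSeries k) f ≠ 0 :=
    (map_ne_zero_iff _ (IsFractionRing.injective _ _)).2 hf0
  refine ⟨Units.mk0 _ hf, ?_⟩
  rw [polyDiag_of_ne_zero (algebraMap_ne_zero hp.ne_zero), W.map_diag,
    ← diag_eq_of_constantCoeff h2' f (Units.mk0 _ hf) rfl (Units.mk0 _ hfl) rfl, ← W.diag_mul,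
    ← (isWittMap_diag _).mul_sq (unifLaurent k * Units.mk0 _ hfl) (unifLaurent k ^ e)]
  congr 1
  ext1
  simp only [Units.coe_map, MonoidHom.coe_coe, Units.val_mk0, specialize_algebraMap, hpf, map_mul,
    map_pow, Units.val_mul, Units.val_pow_eq_pow_val, unifLaurent]
  ring

/-- Products of polynomials of degree less than `d`. -/
noncomputable def smallProducts (K : Type u) [Field K] (d : ℕ) : Submonoid K[X] :=
  Submonoid.closure {f | f.natDegree < d}

theorem exists_multiset_of_mem_degFilt {d : ℕ} (hd : 0 < d) {x : W (FractionRing K[X])}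
    (hx : x ∈ degFilt K d) :
    ∃ s : Multiset K[X], (∀ f ∈ s, f ∈ smallProducts K d) ∧ x = (s.map polyDiag).sum := by
  obtain ⟨L, hL, rfl⟩ := Subring.exists_list_of_mem_closure hx
  clear hx
  induction L with
  | nil => exact ⟨0, by simp⟩
  | cons t L ih =>
    obtain ⟨s, hs, hs'⟩ := ih fun t' ht' => hL t' (List.mem_cons_of_mem _ ht')
    have ht : ∃ f ∈ smallProducts K d, t.prod = polyDiag f := by
      have ht := hL t List.mem_cons_self
      clear hL
      induction t with
      | nil => exact ⟨1, one_mem _, by rw [polyDiag_one, List.prod_nil]⟩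
      | cons y t ih =>
        obtain ⟨f, hf, hf'⟩ := ih fun y hy => ht y (List.mem_cons_of_mem _ hy)
        have hy : ∃ g : K[X], g.natDegree < d ∧ y = polyDiag g := by
          rcases ht y List.mem_cons_self with ⟨g, hg, rfl⟩ | rfl
          · exact ⟨g, hg, rfl⟩
          -- A sign is absorbed as the class ⟨-1⟩ of a constant, of degree 0 < d.
          · exact ⟨-1, by simpa using hd, by rw [polyDiag_neg, polyDiag_one]⟩
        obtain ⟨g, hg, rfl⟩ := hy
        exact ⟨g * f, mul_mem (Submonoid.subset_closure hg) hf,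
          by rw [List.prod_cons, hf', polyDiag_mul]⟩
    obtain ⟨f, hf, hf'⟩ := ht
    refine ⟨f ::ₘ s, ?_, ?_⟩
    · intro g hg
      rcases Multiset.mem_cons.1 hg with rfl | hg
      · exact hf
      · exact hs g hg
    · rw [List.map_cons, List.sum_cons, hs', hf', Multiset.map_cons, Multiset.sum_cons]

/-! ### Lifting residues at a monic irreducible polynomial. -/

section

theorem eq_zero_or_not_dvd_of_natDegree_lt {p f : K[X]} (h : f.natDegree < p.natDegree) :
    f = 0 ∨ ¬ p ∣ f := by
  by_contra! hne
  exact absurd (natDegree_le_of_dvd hne.2 hne.1) (not_le.2 h)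

theorem eq_zero_or_not_dvd_of_mem_smallProducts {p f : K[X]} (hp : Irreducible p)
    (hf : f ∈ smallProducts K p.natDegree) : f = 0 ∨ ¬ p ∣ f := by
  induction hf using Submonoid.closure_induction with
  | mem f hf => exact eq_zero_or_not_dvd_of_natDegree_lt hf
  | one => exact Or.inr fun h => hp.not_isUnit (isUnit_of_dvd_one h)
  | mul f g _ _ hf hg =>
    rcases hf with rfl | hf
    · simp
    rcases hg with rfl | hg
    · simp
    exact Or.inr (hp.prime.not_dvd_mul hf hg)

variable {p : K[X]}

/-- With fg = r + ph, the relation for r + ph multiplied by ⟨p⟩ is ⟨pr⟩ + ⟨h⟩ = ⟨pfg⟩ +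
⟨r⟩⟨h⟩⟨f⟩⟨g⟩, and r, h, f, g all have degree less than deg p. -/
theorem polyDiag_mul_mul_sub_mem (hp : p.Monic) (hirr : Irreducible p) {f g : K[X]} (hf : f.natDegree < p.natDegree)
    (hg : g.natDegree < p.natDegree) :
    polyDiag (p * (f * g)) - polyDiag (p * ((f * g) %ₘ p)) ∈ degFilt K p.natDegree := by
  have hp1 : p ≠ 1 := fun h => hirr.not_isUnit (h ▸ isUnit_one)
  set r := (f * g) %ₘ p with hr
  set h := (f * g) /ₘ p with hh
  have heq : r + p * h = f * g := modByMonic_add_div _ _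
  have hrd : r.natDegree < p.natDegree := natDegree_modByMonic_lt _ hp hp1
  have hhd : h.natDegree < p.natDegree := by
    rw [hh, natDegree_divByMonic _ hp]
    have := natDegree_mul_le (p := f) (q := g)
    omega
  have key := polyDiag_add r (p * h)
  rw [heq] at key
  have hpp := polyDiag_mul_self hp.ne_zero
  have : polyDiag (p * (f * g)) - polyDiag (p * r) =
      polyDiag h - polyDiag r * polyDiag h * polyDiag f * polyDiag g := by
    simp only [polyDiag_mul] at key ⊢
    linear_combination (-polyDiag p) * key + (polyDiag h - polyDiag r * polyDiag h *
      (polyDiag f * polyDiag g)) * hpp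
  rw [this]
  exact sub_mem (polyDiag_mem_degFilt hhd) (mul_mem (mul_mem (mul_mem (polyDiag_mem_degFilt hrd)
    (polyDiag_mem_degFilt hhd)) (polyDiag_mem_degFilt hf)) (polyDiag_mem_degFilt hg))

/-- A product of small polynomials is reduced modulo p one factor at a time. Modulo lower degree,
⟨pf⟩ depends only on the residue of f. -/
theorem polyDiag_mul_sub_mem (hp : p.Monic) (hirr : Irreducible p) {f : K[X]} (hf : f ∈ smallProducts K p.natDegree) :
    polyDiag (p * f) - polyDiag (p * (f %ₘ p)) ∈ degFilt K p.natDegree := by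
  have hp1 : p ≠ 1 := fun h => hirr.not_isUnit (h ▸ isUnit_one)
  induction hf using Submonoid.closure_induction_left with
  | one =>
    rw [(modByMonic_eq_self_iff hp).2, sub_self]
    · exact zero_mem _
    · rw [degree_one]
      exact natDegree_pos_iff_degree_pos.1 hirr.natDegree_pos
  | mul_left g hg f hf ih =>
    have hg : g.natDegree < p.natDegree := hg
    have h1 := mul_mem (polyDiag_mem_degFilt hg) ih
    have h3 := polyDiag_mul_mul_sub_mem hp hirr hg (natDegree_modByMonic_lt f hp hp1)
    have h4 : (g * (f %ₘ p)) %ₘ p = (g * f) %ₘ p := by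
      rw [mul_modByMonic g f, mul_modByMonic g (f %ₘ p),
        (modByMonic_eq_self_iff hp).2 (degree_modByMonic_lt f hp)]
    rw [h4] at h3
    convert! add_mem h1 h3 using 1
    simp only [polyDiag_mul]
    ring

/-- The map `f ↦ ⟨p f⟩` from the residue field at `p`, modulo forms of lower degree. -/
noncomputable def residueLift (hp : p.Monic) [Fact (Irreducible p)] (a : (AdjoinRoot p)ˣ) :
    W (FractionRing K[X]) ⧸ (degFilt K p.natDegree).toAddSubgroup :=
  QuotientAddGroup.mk (polyDiag (p * AdjoinRoot.modByMonicHom hp a))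

theorem residueLift_eq (hp : p.Monic) [Fact (Irreducible p)] (a : (AdjoinRoot p)ˣ) {f : K[X]}
    (hf : f ∈ smallProducts K p.natDegree) (ha : AdjoinRoot.mk p f = a) :
    residueLift hp a = QuotientAddGroup.mk (polyDiag (p * f)) := by
  rw [residueLift, ← ha, AdjoinRoot.modByMonicHom_mk]
  refine (QuotientAddGroup.eq_iff_sub_mem.2 ?_).symm
  exact polyDiag_mul_sub_mem hp Fact.out hf

theorem natDegree_modByMonicHom_lt (hp : p.Monic) [Fact (Irreducible p)] (a : AdjoinRoot p) :
    (AdjoinRoot.modByMonicHom hp a).natDegree < p.natDegree := by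
  have hirr : Irreducible p := Fact.out
  obtain ⟨f, rfl⟩ := AdjoinRoot.mk_surjective a
  rw [AdjoinRoot.modByMonicHom_mk]
  exact natDegree_modByMonic_lt _ hp fun h => hirr.not_isUnit (h ▸ isUnit_one)

/-- By the presentation of the Witt group, residue classes that sum to zero lift to a sum of zero
modulo lower degree. The relations hold because a residue may be represented by any product of small
polynomials. -/
theorem isWittMap_residueLift (hp : p.Monic) [Fact (Irreducible p)] : IsWittMap (residueLift hp) where
  mul_sq a b := by
    have hr : ∀ a : (AdjoinRoot p)ˣ, AdjoinRoot.modByMonicHom hp a ∈ smallProducts K p.natDegree :=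
      fun a => Submonoid.subset_closure (natDegree_modByMonicHom_lt hp a)
    have hb : AdjoinRoot.modByMonicHom hp (b : AdjoinRoot p) ≠ 0 := fun h => b.ne_zero (by
      rw [← AdjoinRoot.mk_leftInverse hp b, h, map_zero])
    rw [residueLift_eq hp (a * b ^ 2) (f := AdjoinRoot.modByMonicHom hp a *
      (AdjoinRoot.modByMonicHom hp b) ^ 2) (mul_mem (hr a) (pow_mem (hr b) 2)) (by
        simp only [map_mul, map_pow, AdjoinRoot.mk_leftInverse hp _, Units.val_mul,
          Units.val_pow_eq_pow_val]), residueLift]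
    congr 1
    simp only [polyDiag_mul, sq, polyDiag_mul_self hb, mul_one]
  add a b c h := by
    have hr : ∀ a : (AdjoinRoot p)ˣ, AdjoinRoot.modByMonicHom hp a ∈ smallProducts K p.natDegree :=
      fun a => Submonoid.subset_closure (natDegree_modByMonicHom_lt hp a)
    rw [residueLift_eq hp (a * b * c) (f := AdjoinRoot.modByMonicHom hp a *
      AdjoinRoot.modByMonicHom hp b * AdjoinRoot.modByMonicHom hp c)
      (mul_mem (mul_mem (hr a) (hr b)) (hr c)) (by
        simp only [map_mul, AdjoinRoot.mk_leftInverse hp _, Units.val_mul]),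
      residueLift, residueLift, residueLift, ← QuotientAddGroup.mk_add, ← QuotientAddGroup.mk_add]
    congr 1
    have := polyDiag_add (AdjoinRoot.modByMonicHom hp (a : AdjoinRoot p))
      (AdjoinRoot.modByMonicHom hp (b : AdjoinRoot p))
    rw [← map_add, h] at this
    simp only [polyDiag_mul] at this ⊢
    linear_combination polyDiag p * this
  add_neg a := by
    rw [residueLift, residueLift, ← QuotientAddGroup.mk_add, Units.val_neg, map_neg, mul_neg,
      polyDiag_neg, add_neg_cancel, QuotientAddGroup.mk_zero]

theorem Multiset.sum_map_eq_zero_of_isWittMap {k : Type u} [Field k] (h2 : (2 : k) ≠ 0) {G : Type u}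
    [AddCommGroup G] {T : kˣ → G} (hT : IsWittMap T) (s : Multiset kˣ)
    (h : (s.map W.diag).sum = 0) : (s.map T).sum = 0 := by
  obtain ⟨f, hf⟩ := Multiset.exists_fin_map s
  rw [hf] at h ⊢
  exact hT.sum_eq_zero h2 _ f h

/-- A single list of residues computes both the specialization of x at p and the product x⟨p⟩ modulo
lower degree, so the vanishing of the former can be transferred to the latter. -/
theorem exists_residues (hp : p.Monic) [Fact (Irreducible p)] (h2 : (2 : AdjoinRoot p) ≠ 0)
    {x : W (FractionRing K[X])} (hx : x ∈ degFilt K p.natDegree) :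
    ∃ s : Multiset (AdjoinRoot p)ˣ,
      W.map (specialize (AdjoinRoot.of p) (AdjoinRoot.root p)) x =
        W.map (constLaurent _) (s.map W.diag).sum ∧
      (QuotientAddGroup.mk (x * polyDiag p) : W (FractionRing K[X]) ⧸
        (degFilt K p.natDegree).toAddSubgroup) = (s.map (residueLift hp)).sum := by
  have hirr : Irreducible p := Fact.out
  obtain ⟨s, hs, rfl⟩ := exists_multiset_of_mem_degFilt hirr.natDegree_pos hx
  clear hx
  induction s using Multiset.induction_on with
  | empty => exact ⟨0, by simp⟩
  | cons f s ih =>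
    obtain ⟨r, hr, hr'⟩ := ih fun g hg => hs g (Multiset.mem_cons_of_mem hg)
    have hf := hs f (Multiset.mem_cons_self _ _)
    rw [Multiset.map_cons, Multiset.sum_cons, add_mul, map_add, QuotientAddGroup.mk_add, hr, hr']
    by_cases hf0 : AdjoinRoot.mk p f = 0
    · have : f = 0 := (eq_zero_or_not_dvd_of_mem_smallProducts hirr hf).resolve_right
        fun h => h (AdjoinRoot.mk_eq_zero.1 hf0)
      refine ⟨r, ?_, ?_⟩
      · rw [this, polyDiag_zero, map_zero, zero_add]
      · rw [this, polyDiag_zero, zero_mul, QuotientAddGroup.mk_zero, zero_add]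
    · refine ⟨Units.mk0 _ hf0 ::ₘ r, ?_, ?_⟩
      · rw [Multiset.map_cons, Multiset.sum_cons, map_add,
          map_specialize_polyDiag _ _ h2 f (Units.mk0 _ hf0)]
        rw [← AdjoinRoot.algebraMap_eq, ← aeval_def, AdjoinRoot.aeval_eq]; rfl
      · rw [Multiset.map_cons, Multiset.sum_cons, residueLift_eq hp (Units.mk0 _ hf0) hf rfl,
          mul_comm p, polyDiag_mul]

theorem mul_polyDiag_mem_degFilt (hp : p.Monic) [Fact (Irreducible p)] (h2 : (2 : AdjoinRoot p) ≠ 0)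
    {x : W (FractionRing K[X])} (hx : x ∈ degFilt K p.natDegree)
    (h : W.map (specialize (AdjoinRoot.of p) (AdjoinRoot.root p)) x = 0) :
    x * polyDiag p ∈ degFilt K p.natDegree := by
  obtain ⟨s, hs, hs'⟩ := exists_residues hp h2 hx
  rw [h, eq_comm, map_eq_zero_iff _ (map_constLaurent_injective h2)] at hs
  rw [Multiset.sum_map_eq_zero_of_isWittMap h2 (isWittMap_residueLift hp) s hs,
    QuotientAddGroup.eq_zero_iff] at hs'
  exact hs'

/-- Expand x in the classes ⟨p⟩ with coefficients of lower degree. At the root of p all other terms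
are unramified, hence so is the term of p. As ⟨p⟩ itself is ramified there, its coefficient
specializes to zero, and `mul_polyDiag_mem_degFilt` lowers the degree of the term. -/
theorem mem_degFilt_of_succ (h2 : (2 : K) ≠ 0) {d : ℕ} (hd : 0 < d) {x : W (FractionRing K[X])}
    (hx : x ∈ degFilt K (d + 1))
    (hunr : ∀ (p : K[X]) [Fact (Irreducible p)], 
      W.map (specialize (AdjoinRoot.of p) (AdjoinRoot.root p)) x ∈
        (W.map (constLaurent (AdjoinRoot p))).range) :
    x ∈ degFilt K d := by
  classical
  obtain ⟨c, hc⟩ := (Finsupp.mem_span_range_iff_exists_finsupp).1 (degFilt_succ_le hd hx)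
  rw [Finsupp.sum] at hc
  have h2' : ∀ (p : K[X]) [Fact (Irreducible p)], (2 : AdjoinRoot p) ≠ 0 := fun p _ => by
    rw [← map_ofNat (AdjoinRoot.of p) 2]
    exact (_root_.map_ne_zero _).2 h2
  rw [← hc]
  refine sum_mem fun p hpc => ?_
  obtain ⟨p, rfl | ⟨hp, hirr, rfl⟩⟩ := p
  · change (c _ : W (FractionRing K[X])) * polyDiag 1 ∈ _
    rw [polyDiag_one, mul_one]
    exact (c _).2
  have : Fact (Irreducible p) := ⟨hirr⟩
  set P : {q : K[X] // IsPrimeOrOne p.natDegree q} := ⟨p, Or.inr ⟨hp, hirr, rfl⟩⟩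
  refine mul_polyDiag_mem_degFilt hp (h2' p) (c P).2 ?_
  set S := W.map (specialize (AdjoinRoot.of p) (AdjoinRoot.root p)) with hS
  set R := (W.map (constLaurent (AdjoinRoot p))).range with hR
  have hsmall : ∀ f : K[X], ¬ p ∣ f → S (polyDiag f) ∈ R := fun f hf => by
    have hf0 : AdjoinRoot.mk p f ≠ 0 := fun h => hf (AdjoinRoot.mk_eq_zero.1 h)
    rw [hS, map_specialize_polyDiag _ _ (h2' p) f (Units.mk0 _ hf0)]
    · exact ⟨_, rfl⟩
    · rw [← AdjoinRoot.algebraMap_eq, ← aeval_def, AdjoinRoot.aeval_eq]; rfl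
  have hfilt : ∀ l ∈ degFilt K p.natDegree, S l ∈ R := fun l hl => by
    have : degFilt K p.natDegree ≤ R.comap S := by
      refine Subring.closure_le.2 ?_
      rintro _ ⟨f, hf, rfl⟩
      rcases eq_zero_or_not_dvd_of_natDegree_lt hf with rfl | hf
      · simp [polyDiag_zero]
      · exact hsmall f hf
    exact this hl
  have hrest : S ((c P : W (FractionRing K[X])) * polyDiag p) ∈ R := by
    have h1 := hunr p
    rw [← hc, ← Finset.add_sum_erase _ _ hpc, map_add] at h1
    refine (add_mem_cancel_right ?_).1 h1
    rw [map_sum]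
    refine sum_mem fun q hq => ?_
    change S ((c q : W (FractionRing K[X])) * polyDiag q.1) ∈ R
    rw [map_mul]
    refine mul_mem (hfilt _ (c q).2) (hsmall _ ?_)
    obtain ⟨q, rfl | ⟨hq1, hq2, hq3⟩⟩ := q
    · exact fun h => hirr.not_isUnit (isUnit_of_dvd_one h)
    · intro hpq
      refine Finset.ne_of_mem_erase hq (Subtype.ext ?_)
      exact (eq_of_monic_of_associated hq1 hp ((hirr.associated_of_dvd hq2 hpq).symm))
  obtain ⟨u, hu⟩ := map_specialize_polyDiag_of_root h2 hirr (AdjoinRoot.of p) (AdjoinRoot.root p)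
    (AdjoinRoot.eval₂_root p)
  obtain ⟨y, hy⟩ := hfilt _ (c P).2
  obtain ⟨z, hz⟩ := hrest
  rw [map_mul, ← hy, hS, hu] at hz
  -- The term of p specializes both to the constant class z and to ⟨s⟩ times the constant class
  -- y⟨u⟩.
  have h0 := eq_zero_of_map_add_unif_mul_map_eq_zero (h2' p) (x := -z) (y := y * W.diag u) (by
    rw [map_neg, hz, map_mul]
    ring)
  have hy0 : y = 0 := by
    have h1 : W.diag u * W.diag u = 1 := by
      rw [← W.diag_mul, ← W.diag_one, ← (isWittMap_diag _).mul_sq 1 u, one_mul, sq]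
    rw [← mul_one y, ← h1, ← mul_assoc, h0.2, zero_mul]
  rw [← hy, hy0, map_zero]

/-- A form over `K(t)` that is unramified at all points of the affine line is constant. -/
theorem exists_map_constRat_eq (h2 : (2 : K) ≠ 0) (x : W (FractionRing K[X]))
    (hunr : ∀ (p : K[X]) [Fact (Irreducible p)], 
      W.map (specialize (AdjoinRoot.of p) (AdjoinRoot.root p)) x ∈
        (W.map (constLaurent (AdjoinRoot p))).range) :
    ∃ y : W K, W.map (constRat K) y = x := by
  obtain ⟨d, hd⟩ := exists_mem_degFilt h2 x
  refine degFilt_one_le x ?_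
  induction d with
  | zero => exact hd
  | succ d ih => exact ih (mem_degFilt_of_succ h2 (Nat.succ_pos d) hd hunr)

end

end Residue

/-! ### Extension of scalars -/

section BaseChange

open Module TensorProduct

variable {n : ℕ} {K L : Type u} [Field K] [Field L]

/-- The ring homomorphism `g` identifies `B` with the extension of scalars of `A` along `φ`. -/
structure IsScalarExt (φ : K →+* L) {A : EtAlg n K} {B : EtAlg n L} (g : A →+* B) : Prop where
  map_algebraMap : ∀ c, g (algebraMap K A c) = algebraMap L B (φ c)
  span : Submodule.span L (Set.range g) = ⊤

/-- The induced map L ⊗ A → B is surjective by the spanning condition, and both sides have dimension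
n. -/
theorem IsScalarExt.exists_algEquiv {φ : K →+* L} {A : EtAlg n K} {B : EtAlg n L} {g : A →+* B}
    (hg : IsScalarExt φ g) : ∃ (e : A.baseChange φ ≃ₐ[L] B),
      letI := φ.toAlgebra
      ∀ a, e ((1 : L) ⊗ₜ[K] a : L ⊗[K] A) = g a := by
  let := φ.toAlgebra
  let : Algebra K B := ((algebraMap L B).comp φ).toAlgebra
  have : IsScalarTower K L B := IsScalarTower.of_algebraMap_eq fun _ => rfl
  let g' : A →ₐ[K] B := { g with commutes' := hg.map_algebraMap }
  let f : L ⊗[K] A →ₐ[L] B := Algebra.TensorProduct.lift (Algebra.ofId L B) g'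
    (fun _ _ => Commute.all _ _)
  have hf : ∀ a : A, f ((1 : L) ⊗ₜ[K] a) = g a := fun a => by
    simp [f, g']
  have hsurj : Function.Surjective f := by
    rw [← AlgHom.coe_toLinearMap, ← LinearMap.range_eq_top, eq_top_iff, ← hg.span,
      Submodule.span_le]
    rintro _ ⟨a, rfl⟩
    exact ⟨(1 : L) ⊗ₜ[K] a, hf a⟩
  have hrank : finrank L (L ⊗[K] A) = finrank L B := by
    rw [Module.finrank_baseChange, A.finrank_eq, B.finrank_eq]
  have hinj : Function.Injective f :=
    (LinearMap.injective_iff_surjective_of_finrank_eq_finrank (f := f.toLinearMap) hrank).2 hsurj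
  exact ⟨AlgEquiv.ofBijective f ⟨hinj, hsurj⟩, hf⟩

theorem IsScalarExt.map_mk {φ : K →+* L} {A : EtAlg n K} {B : EtAlg n L} {g : A →+* B}
    (hg : IsScalarExt φ g) : Et.map φ (Et.mk A) = Et.mk B := by
  obtain ⟨e, -⟩ := hg.exists_algEquiv
  exact Quotient.sound ⟨e⟩

theorem IsScalarExt.injective {φ : K →+* L} {A : EtAlg n K} {B : EtAlg n L} {g : A →+* B}
    (hg : IsScalarExt φ g) : Function.Injective g := by
  obtain ⟨e, he⟩ := hg.exists_algEquiv
  let := φ.toAlgebra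
  have h1 : Function.Injective (Algebra.TensorProduct.includeRight : A →ₐ[K] L ⊗[K] A) :=
    Algebra.TensorProduct.includeRight_injective (algebraMap K L).injective
  intro a b hab
  rw [← he, ← he] at hab
  exact h1 (e.injective hab)

/-- The inclusion `a ↦ 1 ⊗ a`. -/
noncomputable def EtAlg.incl (φ : K →+* L) (A : EtAlg n K) : A →+* A.baseChange φ :=
  letI := φ.toAlgebra
  (Algebra.TensorProduct.includeRight : A →ₐ[K] L ⊗[K] A).toRingHom

theorem EtAlg.isScalarExt_incl (φ : K →+* L) (A : EtAlg n K) : IsScalarExt φ (A.incl φ) where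
  map_algebraMap c := by
    let := φ.toAlgebra
    change (1 : L) ⊗ₜ[K] (algebraMap K A c) = (φ c) ⊗ₜ[K] (1 : A)
    rw [Algebra.algebraMap_eq_smul_one, ← smul_tmul, Algebra.smul_def, mul_one]
    rfl
  span := by
    let := φ.toAlgebra
    rw [eq_top_iff]
    rintro (x : L ⊗[K] A) -
    induction x using TensorProduct.induction_on with
    | zero => exact zero_mem _
    | add x y hx hy => exact add_mem hx hy
    | tmul l a =>
      have : l ⊗ₜ[K] a = l • ((1 : L) ⊗ₜ[K] a) := by rw [smul_tmul', smul_eq_mul, mul_one]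
      rw [this]
      exact Submodule.smul_mem _ l (Submodule.subset_span ⟨a, rfl⟩)

/-- The inclusion of one extension of scalars in a larger one. -/
noncomputable def EtAlg.inclMap {M : Type u} [Field M] (φ : K →+* L) (ψ : L →+* M)
    (A : EtAlg n K) : A.baseChange φ →+* A.baseChange (ψ.comp φ) :=
  letI := φ.toAlgebra
  letI : Algebra K M := (ψ.comp φ).toAlgebra
  (Algebra.TensorProduct.map (S := K) { ψ with commutes' := fun _ => rfl } (AlgHom.id K A) :
    L ⊗[K] A →ₐ[K] M ⊗[K] A).toRingHom

theorem EtAlg.inclMap_incl {M : Type u} [Field M] (φ : K →+* L) (ψ : L →+* M)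
    (A : EtAlg n K) (a : A) : A.inclMap φ ψ (A.incl φ a) = A.incl (ψ.comp φ) a := by
  let := φ.toAlgebra
  let : Algebra K M := (ψ.comp φ).toAlgebra
  change (ψ 1) ⊗ₜ[K] a = (1 : M) ⊗ₜ[K] a
  rw [map_one]

theorem EtAlg.isScalarExt_inclMap {M : Type u} [Field M] (φ : K →+* L) (ψ : L →+* M)
    (A : EtAlg n K) : IsScalarExt ψ (A.inclMap φ ψ) where
  map_algebraMap c := rfl
  span := by
    rw [eq_top_iff, ← (A.isScalarExt_incl (ψ.comp φ)).span]
    refine Submodule.span_mono ?_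
    rintro _ ⟨a, rfl⟩
    exact ⟨A.incl φ a, A.inclMap_incl φ ψ a⟩

/-- As c is not in K, some linear form on A vanishes at c but not at 1, and its extension to L does
not vanish at 1 + mc. Where the base change of A is a field, this makes 1 + mc a unit. -/
theorem EtAlg.one_add_mul_incl_ne_zero (φ : K →+* L) (A : EtAlg n K) {c : A}
    (hc : c ∉ Set.range (algebraMap K A)) (m : L) :
    1 + algebraMap L _ m * A.incl φ c ≠ 0 := by
  let := φ.toAlgebra
  have h1 : (1 : A) ∉ Submodule.span K {c} := by
    rw [Submodule.mem_span_singleton]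
    rintro ⟨a, ha⟩
    have ha0 : a ≠ 0 := by
      rintro rfl
      rw [zero_smul] at ha
      have : c = 0 := by rw [← one_mul c, ← ha, zero_mul]
      exact hc ⟨0, by rw [map_zero, this]⟩
    exact hc ⟨a⁻¹, by rw [Algebra.algebraMap_eq_smul_one, ← ha, smul_smul, inv_mul_cancel₀ ha0,
      one_smul]⟩
  obtain ⟨f, hf, hf'⟩ := Submodule.exists_le_ker_of_notMem h1
  have hfc : f c = 0 := hf' (Submodule.mem_span_singleton_self c)
  intro h
  have h : (1 : L) ⊗ₜ[K] (1 : A) + (m ⊗ₜ[K] (1 : A)) * ((1 : L) ⊗ₜ[K] c) = 0 := h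
  rw [Algebra.TensorProduct.tmul_mul_tmul, mul_one, one_mul] at h
  have h3 := congrArg (LinearMap.baseChange L f) h
  rw [map_add, LinearMap.baseChange_tmul, LinearMap.baseChange_tmul, map_zero, hfc, tmul_zero,
    add_zero] at h3
  have h4 := congrArg (TensorProduct.rid K L) h3
  simp [hf] at h4

end BaseChange

/-! ### Quadratic extensions of étale algebras -/

section QuadExt

open Polynomial

variable {d s n : ℕ} {K : Type u} [Field K]

/-- The quadratic extension `R[√β]`. -/
abbrev QuadExt {R : Type u} [CommRing R] (β : R) : Type u := AdjoinRoot (X ^ 2 - C β : R[X])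

theorem QuadExt.root_sq {R : Type u} [CommRing R] (β : R) :
    (AdjoinRoot.root (X ^ 2 - C β : R[X])) ^ 2 = AdjoinRoot.of _ β := by
  have h := AdjoinRoot.eval₂_root (X ^ 2 - C β : R[X])
  simp only [eval₂_sub, eval₂_pow, eval₂_X, eval₂_C] at h
  exact sub_eq_zero.1 h

theorem QuadExt.exists_eq {R : Type u} [CommRing R] (β : R) (x : QuadExt β) :
    ∃ a b : R, x = AdjoinRoot.of _ a + AdjoinRoot.of _ b * AdjoinRoot.root _ := by
  rcases subsingleton_or_nontrivial R with h | h
  · have : Subsingleton (QuadExt β) := Module.subsingleton R _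
    exact ⟨0, 0, Subsingleton.elim _ _⟩
  obtain ⟨f, rfl⟩ := AdjoinRoot.mk_surjective x
  have hm : (X ^ 2 - C β : R[X]).Monic := monic_X_pow_sub_C β two_ne_zero
  have hd : (f %ₘ (X ^ 2 - C β)).natDegree < 2 := by
    have := natDegree_modByMonic_lt f hm (fun h => by
      have := congrArg natDegree h
      simp at this)
    simpa using this
  refine ⟨(f %ₘ (X ^ 2 - C β)).coeff 0, (f %ₘ (X ^ 2 - C β)).coeff 1, ?_⟩
  have h1 : AdjoinRoot.mk (X ^ 2 - C β) f = AdjoinRoot.mk (X ^ 2 - C β) (f %ₘ (X ^ 2 - C β)) := by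
    conv_lhs => rw [← modByMonic_add_div f (X ^ 2 - C β)]
    simp
  rw [h1]
  conv_lhs => rw [(f %ₘ (X ^ 2 - C β)).as_sum_range' 2 hd]
  simp [Finset.sum_range_succ, ← C_mul_X_pow_eq_monomial]

theorem QuadExt.finite (R : Type u) [CommRing R] [Algebra K R] [FiniteDimensional K R] (β : R) :
    FiniteDimensional K (QuadExt β) := by
  have : Module.Finite R (QuadExt β) :=
    (AdjoinRoot.powerBasis' (monic_X_pow_sub_C β two_ne_zero)).finite
  exact Module.Finite.trans R _

theorem QuadExt.finrank (R : Type u) [CommRing R] [Algebra K R] [FiniteDimensional K R] (β : R) :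
    Module.finrank K (QuadExt β) = 2 * Module.finrank K R := by
  rcases subsingleton_or_nontrivial R with h | h
  · have : Subsingleton (QuadExt β) := Module.subsingleton R _
    rw [Module.finrank_zero_of_subsingleton, Module.finrank_zero_of_subsingleton]
  · have hfree : Module.Free R (QuadExt β) :=
      .of_basis (AdjoinRoot.powerBasis' (monic_X_pow_sub_C β two_ne_zero)).basis
    have h2 : Module.finrank R (QuadExt β) = 2 := by
      rw [(AdjoinRoot.powerBasis' (monic_X_pow_sub_C β two_ne_zero)).finrank]
      simp
    rw [← Module.finrank_mul_finrank K R (QuadExt β), h2, mul_comm]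

/-- Two lifts of √β modulo a square-zero ideal have the same square, and their difference squares to
zero. So the unit 2β kills the difference, and the lifts agree. -/
theorem QuadExt.etale (h2 : (2 : K) ≠ 0) (R : Type u) [CommRing R] [Algebra K R]
    [FiniteDimensional K R] [Algebra.Etale K R] (β : Rˣ) :
    Algebra.Etale K (QuadExt (β : R)) := by
  have hfin := QuadExt.finite (K := K) R (β : R)
  have hunr : Algebra.FormallyUnramified K (QuadExt (β : R)) := by
    rw [Algebra.FormallyUnramified.iff_comp_injective]
    intro B _ _ I hI f g hfg
    let ι : R →ₐ[K] QuadExt (β : R) := IsScalarTower.toAlgHom K R _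
    have hR : f.comp ι = g.comp ι := by
      refine (Algebra.FormallyUnramified.iff_comp_injective.1 inferInstance) I hI ?_
      ext x
      exact AlgHom.congr_fun hfg (ι x)
    have hfι : ∀ x : R, f (AdjoinRoot.of _ x) = g (AdjoinRoot.of _ x) := fun x =>
      AlgHom.congr_fun hR x
    set r : QuadExt (β : R) := AdjoinRoot.root (X ^ 2 - C (β : R) : R[X]) with hr
    have hroot : r ^ 2 = AdjoinRoot.of _ (β : R) := QuadExt.root_sq _
    set y := f (AdjoinRoot.of _ (β : R)) with hy
    have hf : f r ^ 2 = y := by rw [← map_pow, hroot]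
    have hg : g r ^ 2 = y := by rw [← map_pow, hroot, hy, hfι]
    have hmem : f r - g r ∈ I := Ideal.Quotient.eq.1 (AlgHom.congr_fun hfg r)
    have hsq : (f r - g r) ^ 2 = 0 := by
      have h := Ideal.pow_mem_pow hmem 2
      rwa [hI, Ideal.mem_bot] at h
    have h3 : (algebraMap K B 2 * y) * (f r - g r) = 0 := by
      rw [map_ofNat]
      linear_combination (-2) * (f r - g r) * hg + g r * (hf - hg - hsq)
    have hu : IsUnit (algebraMap K B 2 * y) :=
      (h2.isUnit.map _).mul (((β.isUnit).map (AdjoinRoot.of _)).map f)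
    have hrr : f r = g r := sub_eq_zero.1 ((hu.mul_right_eq_zero).1 h3)
    refine AlgHom.ext fun x => ?_
    obtain ⟨a, b, rfl⟩ := QuadExt.exists_eq (β : R) x
    rw [map_add, map_mul, map_add, map_mul, hfι, hfι, hrr]
  exact { formallyEtale := Algebra.FormallyEtale.iff_formallyUnramified_of_field.2 hunr
          finitePresentation := Algebra.FinitePresentation.of_finiteType.1 inferInstance }

/-- The étale algebra `R[√β] × S`. -/
noncomputable def quadProd (h2 : (2 : K) ≠ 0) (hn : 2 * d + s = n) (R : EtAlg d K) (S : EtAlg s K)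
    (β : (R : Type u)ˣ) : EtAlg n K where
  carrier := QuadExt (β : R) × S
  etale :=
    have := QuadExt.etale h2 R β
    etale_prod
  finrank_eq := by
    have := QuadExt.finite (K := K) R (β : R)
    rw [Module.finrank_prod, QuadExt.finrank, R.finrank_eq, S.finrank_eq, hn]

/-- The map sends √β to u√β'. As β matters only up to squares, 1 + tc can be exchanged for a
constant unit after specialization. -/
theorem map_quadProd {L : Type u} [Field L] (h2 : (2 : K) ≠ 0) (h2' : (2 : L) ≠ 0)
    (hn : 2 * d + s = n) {φ : K →+* L} {R : EtAlg d K} {S : EtAlg s K} {R' : EtAlg d L}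
    {S' : EtAlg s L} {g : R →+* R'} {h : S →+* S'} (hg : IsScalarExt φ g) (hh : IsScalarExt φ h)
    (β : (R : Type u)ˣ) (β' u : (R' : Type u)ˣ) (hu : g β = β' * u ^ 2) :
    Et.map φ (Et.mk (quadProd h2 hn R S β)) = Et.mk (quadProd h2' hn R' S' β') := by
  let f : QuadExt (β : R) →+* QuadExt (β' : R') :=
    AdjoinRoot.lift ((AdjoinRoot.of _).comp g) (AdjoinRoot.of _ (u : R') * AdjoinRoot.root _) (by
      rw [eval₂_sub, eval₂_pow, eval₂_X, eval₂_C, mul_pow, QuadExt.root_sq, RingHom.comp_apply, hu,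
        ← map_pow, ← map_mul, mul_comm, sub_self])
  have hf1 : ∀ r, f (AdjoinRoot.of _ r) = AdjoinRoot.of _ (g r) := fun r =>
    AdjoinRoot.lift_of _
  have hf2 : f (AdjoinRoot.root _) = AdjoinRoot.of _ (u : R') * AdjoinRoot.root _ :=
    AdjoinRoot.lift_root _
  refine IsScalarExt.map_mk (A := quadProd h2 hn R S β) (B := quadProd h2' hn R' S' β')
    (g := RingHom.prodMap f h) ⟨?_, ?_⟩
  · intro c
    refine Prod.ext ?_ (hh.map_algebraMap c)
    change f (AdjoinRoot.of _ (algebraMap K R c)) = AdjoinRoot.of _ (algebraMap L R' (φ c))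
    rw [hf1, hg.map_algebraMap]
  · set V := Submodule.span L (Set.range (RingHom.prodMap f h)) with hV
    have hS : ∀ y : S', ((0, y) : QuadExt (β' : R') × S') ∈ V := by
      intro y
      have hy : y ∈ Submodule.span L (Set.range h) := hh.span ▸ trivial
      induction hy using Submodule.span_induction with
      | mem y hy =>
        obtain ⟨x, rfl⟩ := hy
        exact Submodule.subset_span ⟨(0, x), by
          change (f 0, h x) = _
          rw [map_zero]⟩
      | zero => exact zero_mem _
      | add x y _ _ hx hy => simpa using add_mem hx hy
      | smul c x _ hx => simpa using V.smul_mem c hx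
    have hR : ∀ z : QuadExt (β' : R'), (∀ r, ((AdjoinRoot.of _ (g r) * z, 0) :
        QuadExt (β' : R') × S') ∈ V) → ∀ y : R', ((AdjoinRoot.of _ y * z, 0) :
        QuadExt (β' : R') × S') ∈ V := by
      intro z hz y
      have hy : y ∈ Submodule.span L (Set.range g) := hg.span ▸ trivial
      induction hy using Submodule.span_induction with
      | mem y hy => obtain ⟨x, rfl⟩ := hy; exact hz x
      | zero => rw [map_zero, zero_mul]; exact zero_mem _
      | add x y _ _ hx hy => simpa [add_mul] using add_mem hx hy
      | smul c x _ hx =>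
        have : AdjoinRoot.of (X ^ 2 - C (β' : R')) (c • x) = c • AdjoinRoot.of _ x := by
          rw [Algebra.smul_def, Algebra.smul_def, map_mul]; rfl
        rw [this, smul_mul_assoc]
        simpa using V.smul_mem c hx
    have h1 := hR 1 fun r => by
      rw [mul_one]
      exact Submodule.subset_span ⟨(AdjoinRoot.of _ r, 0), by
        rw [RingHom.coe_prodMap, Prod.map_apply, map_zero, hf1]⟩
    have h3 := hR (AdjoinRoot.of _ (u : R') * AdjoinRoot.root _) fun r =>
      Submodule.subset_span ⟨(AdjoinRoot.of _ r * AdjoinRoot.root _, 0), by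
        rw [RingHom.coe_prodMap, Prod.map_apply, map_zero, map_mul, hf1, hf2]⟩
    rw [eq_top_iff]
    rintro ⟨x, y⟩ -
    obtain ⟨a, b, rfl⟩ := QuadExt.exists_eq (β' : R') x
    have h4 := add_mem (add_mem (h1 a) (h3 (b * (u⁻¹ : (R' : Type u)ˣ)))) (hS y)
    have h5 : AdjoinRoot.of (X ^ 2 - C (β' : R')) (b * (u⁻¹ : (R' : Type u)ˣ)) *
        (AdjoinRoot.of _ (u : R') * AdjoinRoot.root _) = AdjoinRoot.of _ b * AdjoinRoot.root _ := by
      rw [← mul_assoc, ← map_mul, mul_assoc b, Units.inv_mul, mul_one]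
    rw [mul_one, h5, Prod.mk_add_mk, Prod.mk_add_mk, add_zero, add_zero, zero_add] at h4
    exact h4

end QuadExt

/-! ### Square roots over Laurent series -/

section Sqrt

open TensorProduct Module

variable {k : Type u} [Field k]

/-- Since R is finite over k, the ring k[[s]] ⊗ R is R[[s]]. There 1 + sx has an invertible square
root by Hensel's lemma, which is then mapped to B. -/
theorem exists_unit_sq_eq (h2 : (2 : k) ≠ 0) (R : Type u) [CommRing R] [Algebra k R]
    [FiniteDimensional k R] {B : Type u} [CommRing B] [Algebra (LaurentSeries k) B] (g : R →+* B)
    (hg : ∀ c, g (algebraMap k R c) = algebraMap (LaurentSeries k) B (constLaurent k c)) (x : R) :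
    ∃ w : Bˣ, (w : B) ^ 2 = 1 + algebraMap (LaurentSeries k) B (unifLaurent k) * g x := by
  let ι : PowerSeries k →+* B :=
    (algebraMap (LaurentSeries k) B).comp (algebraMap (PowerSeries k) (LaurentSeries k))
  let : Algebra k B := (ι.comp PowerSeries.C).toAlgebra
  let ι' : PowerSeries k →ₐ[k] B := { ι with commutes' := fun _ => rfl }
  let g' : R →ₐ[k] B := { g with commutes' := hg }
  let ρ : PowerSeries k ⊗[k] R →ₐ[k] B := Algebra.TensorProduct.productMap ι' g'
  let Ψ : PowerSeries k ⊗[k] R →ₐ[k] PowerSeries R := Algebra.TensorProduct.productMap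
    (PowerSeries.mapAlgHom (Algebra.ofId k R))
    { (PowerSeries.C : R →+* PowerSeries R) with
      commutes' := fun c => (PowerSeries.algebraMap_apply (A := R)).symm }
  have hΨt : ∀ (f : PowerSeries k) (r : R),
      Ψ (f ⊗ₜ r) = PowerSeries.map (algebraMap k R) f * PowerSeries.C r := fun f r => rfl
  have hρt : ∀ (f : PowerSeries k) (r : R), ρ (f ⊗ₜ r) = ι f * g r := fun f r => rfl
  let v := finBasis k R
  let b := Algebra.TensorProduct.basis (PowerSeries k) v
  have hcoeff : ∀ (f : Fin (finrank k R) → PowerSeries k) (n : ℕ),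
      PowerSeries.coeff n (Ψ (∑ i, f i ⊗ₜ v i)) = ∑ i, PowerSeries.coeff n (f i) • v i := by
    intro f n
    rw [map_sum, map_sum]
    refine Finset.sum_congr rfl fun i _ => ?_
    rw [hΨt, PowerSeries.coeff_mul_C, PowerSeries.coeff_map, Algebra.smul_def]
  have hinj : Function.Injective Ψ := by
    rw [injective_iff_map_eq_zero]
    intro t ht
    have ht' : t = ∑ i, (b.repr t i) ⊗ₜ[k] v i := by
      conv_lhs => rw [← b.sum_repr t]
      refine Finset.sum_congr rfl fun i _ => ?_
      rw [Algebra.TensorProduct.basis_apply, smul_tmul', smul_eq_mul, mul_one]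
    rw [ht'] at ht ⊢
    refine Finset.sum_eq_zero fun i _ => ?_
    have : b.repr t i = 0 := by
      ext n
      have h := hcoeff (fun i => b.repr t i) n
      rw [ht, map_zero] at h
      exact Fintype.linearIndependent_iff.1 v.linearIndependent _ h.symm i
    rw [this, zero_tmul]
  have hsurj : Function.Surjective Ψ := by
    intro z
    refine ⟨∑ i, (PowerSeries.mk fun n => v.repr (PowerSeries.coeff n z) i) ⊗ₜ v i, ?_⟩
    ext n
    rw [hcoeff]
    simp only [PowerSeries.coeff_mk]
    exact v.sum_repr _
  have h2R : IsUnit (2 : R) := by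
    have := h2.isUnit.map (algebraMap k R)
    rwa [map_ofNat] at this
  obtain ⟨z, hz, hz1⟩ := exists_sq_eq_of_constantCoeff_eq_one h2R
    (1 + PowerSeries.X * PowerSeries.C x) (by simp)
  obtain ⟨t, rfl⟩ := hsurj z
  have hzu : IsUnit (Ψ t) := PowerSeries.isUnit_iff_constantCoeff.2 (hz1 ▸ isUnit_one)
  obtain ⟨y, hy⟩ := hzu.exists_right_inv
  obtain ⟨t', rfl⟩ := hsurj y
  have hu : t * t' = 1 := hinj (by rw [map_mul, hy, map_one])
  have hu' : IsUnit (ρ t) := by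
    refine IsUnit.of_mul_eq_one (ρ t') ?_
    rw [← map_mul, hu, map_one]
  refine ⟨hu'.unit, ?_⟩
  have ht2 : t ^ 2 = 1 + PowerSeries.X ⊗ₜ x := by
    apply hinj
    rw [map_pow, hz, map_add, map_one, hΨt, PowerSeries.map_X]
  rw [IsUnit.unit_spec, ← map_pow, ht2, map_add, map_one, hρt]
  rfl

end Sqrt

/-! ### Idempotents -/

section Idempotents

/-- The number of idempotents of a ring. -/
noncomputable def numIdem (A : Type*) [CommRing A] : ℕ := Nat.card {e : A // IsIdempotentElem e}

variable {A B : Type*} [CommRing A] [CommRing B]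

theorem numIdem_congr (e : A ≃+* B) : numIdem A = numIdem B :=
  Nat.card_congr (e.toEquiv.subtypeEquiv fun a =>
    ⟨fun h => h.map e, fun h => by simpa using h.map e.symm⟩)

theorem numIdem_prod : numIdem (A × B) = numIdem A * numIdem B := by
  rw [numIdem, numIdem, numIdem, ← Nat.card_prod]
  exact Nat.card_congr
    { toFun := fun e => (⟨e.1.1, congrArg Prod.fst e.2⟩, ⟨e.1.2, congrArg Prod.snd e.2⟩)
      invFun := fun e => ⟨(e.1.1, e.2.1), Prod.ext e.1.2 e.2.2⟩
      left_inv := fun _ => rfl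
      right_inv := fun _ => rfl }

theorem numIdem_le_of_injective [Finite {e : B // IsIdempotentElem e}] (f : A →+* B)
    (hf : Function.Injective f) : numIdem A ≤ numIdem B :=
  Nat.card_le_card_of_injective (fun e => (⟨f e.1, e.2.map f⟩ : {e : B // IsIdempotentElem e}))
    fun _ _ h => Subtype.ext (hf (congrArg Subtype.val h))

theorem numIdem_le_two [IsDomain A] : numIdem A ≤ 2 := by
  have h : ∀ e : {e : A // IsIdempotentElem e}, e.1 = 0 ∨ e.1 = 1 := fun e =>
    IsIdempotentElem.iff_eq_zero_or_one.1 e.2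
  classical
  have := Nat.card_le_card_of_injective
    (fun e : {e : A // IsIdempotentElem e} => decide (e.1 = 0)) (by
      intro e e' hee
      simp only [decide_eq_decide] at hee
      rcases h e with h1 | h1 <;> rcases h e' with h3 | h3 <;> simp_all [Subtype.ext_iff])
  simpa [numIdem] using this

theorem three_le_numIdem [Finite {e : A // IsIdempotentElem e}] {e : A} (he : IsIdempotentElem e)
    (h0 : e ≠ 0) (h1 : e ≠ 1) : 3 ≤ numIdem A := by
  have h01 : (0 : A) ≠ 1 := fun h => h0 (by rw [← one_mul e, ← h, zero_mul])
  have : Function.Injective (fun i : Fin 3 => (![⟨0, .zero⟩, ⟨1, .one⟩, ⟨e, he⟩] i :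
      {e : A // IsIdempotentElem e})) := by
    intro i j hij
    fin_cases i <;> fin_cases j <;> simp_all [Subtype.ext_iff]
  simpa [numIdem] using Nat.card_le_card_of_injective _ this

theorem one_le_numIdem [Finite {e : A // IsIdempotentElem e}] : 1 ≤ numIdem A := by
  have : Nonempty {e : A // IsIdempotentElem e} := ⟨⟨0, .zero⟩⟩
  exact Nat.card_pos

variable {n : ℕ} {K : Type u} [Field K]

/-- In a product of at most n fields the components of an idempotent are 0 or 1. The bound is what
makes the descending induction terminate. -/
theorem EtAlg.finite_idem_and_le (E : EtAlg n K) :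
    Finite {e : E // IsIdempotentElem e} ∧ numIdem E ≤ 2 ^ n := by
  obtain ⟨I, _, Ai, _, _, e, h⟩ := (Algebra.Etale.iff_exists_algEquiv_prod (K := K) (A := E)).1
    inferInstance
  have := Fintype.ofFinite I
  have := fun i => (h i).1
  classical
  let f : {e : E // IsIdempotentElem e} → I → Bool := fun x i => decide (e x.1 i = 0)
  have hf : Function.Injective f := by
    intro x y hxy
    refine Subtype.ext (e.injective (funext fun i => ?_))
    have h1 := congrFun hxy i
    simp only [f, decide_eq_decide] at h1
    have h3 : ∀ x : {e : E // IsIdempotentElem e}, e x.1 i = 0 ∨ e x.1 i = 1 := fun x =>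
      IsIdempotentElem.iff_eq_zero_or_one.1 (congrFun (x.2.map e) i)
    rcases h3 x with h4 | h4 <;> rcases h3 y with h5 | h5 <;> simp_all
  refine ⟨Finite.of_injective f hf, (Nat.card_le_card_of_injective f hf).trans ?_⟩
  rw [Nat.card_eq_fintype_card, Fintype.card_fun, Fintype.card_bool]
  refine Nat.pow_le_pow_right two_pos ?_
  rw [← E.finrank_eq, e.toLinearEquiv.finrank_eq, Module.finrank_pi_fintype, Fintype.card_eq_sum_ones]
  exact Finset.sum_le_sum fun i _ => Module.finrank_pos

instance (E : EtAlg n K) : Finite {e : E // IsIdempotentElem e} := E.finite_idem_and_le.1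

theorem EtAlg.exists_idempotent (E : EtAlg n K) [Nontrivial E] (h : ¬ IsField E) :
    ∃ e : E, IsIdempotentElem e ∧ e ≠ 0 ∧ e ≠ 1 := by
  obtain ⟨I, _, Ai, _, _, f, -⟩ := (Algebra.Etale.iff_exists_algEquiv_prod (K := K) (A := E)).1
    inferInstance
  classical
  rcases isEmpty_or_nonempty I with hI | ⟨⟨i⟩⟩
  · have := f.injective.subsingleton
    exact absurd ‹Nontrivial E› (not_nontrivial E)
  by_cases hI : ∃ j, j ≠ i
  · obtain ⟨j, hj⟩ := hI
    have hx : IsIdempotentElem (Pi.single i 1 : ∀ i, Ai i) := by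
      rw [IsIdempotentElem, ← Pi.single_mul, mul_one]
    refine ⟨f.symm (Pi.single i 1), hx.map f.symm, ?_, ?_⟩
    · rw [map_ne_zero_iff _ f.symm.injective]
      intro h0
      simpa using congrFun h0 i
    · rw [← map_one f.symm]
      intro h0
      have := congrFun (f.symm.injective h0) j
      simp [hj] at this
  · push Not at hI
    have : Unique I := ⟨⟨i⟩, hI⟩
    exact absurd ((f.toRingEquiv.trans (RingEquiv.piUnique Ai)).toMulEquiv.isField
      (Field.toIsField _)) h

theorem EtAlg.three_le_numIdem_of_not_isField (E : EtAlg n K) [Nontrivial E] (h : ¬ IsField E) :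
    3 ≤ numIdem E := by
  obtain ⟨e, he, h0, h1⟩ := E.exists_idempotent h
  exact three_le_numIdem he h0 h1

end Idempotents

/-! ### Idempotents of quadratic extensions. -/

section Quad

open Polynomial

theorem QuadExt.of_injective {R : Type u} [CommRing R] (β : R) :
    Function.Injective (AdjoinRoot.of (X ^ 2 - C β : R[X])) := by
  rw [injective_iff_map_eq_zero]
  intro a ha
  have hm : (X ^ 2 - C β : R[X]).Monic := monic_X_pow_sub_C β two_ne_zero
  rcases subsingleton_or_nontrivial R with h | h
  · exact Subsingleton.elim _ _
  by_contra ha0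
  have hdvd : (X ^ 2 - C β : R[X]) ∣ C a := AdjoinRoot.mk_eq_zero.1 ha
  have := hm.not_dvd_of_natDegree_lt (C_ne_zero.2 ha0) (by simp)
  exact this hdvd

variable {d s n : ℕ} {K : Type u} [Field K] (R : EtAlg d K) (S : EtAlg s K) (β : (R : Type u)ˣ)

theorem numIdem_quadProd (h2 : (2 : K) ≠ 0) (hn : 2 * d + s = n) : numIdem (quadProd h2 hn R S β) =
    numIdem (QuadExt (β : R)) * numIdem S := numIdem_prod

theorem finite_idem_quadExt (h2 : (2 : K) ≠ 0) : Finite {e : QuadExt (β : R) // IsIdempotentElem e} := by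
  let S : EtAlg 0 K := { carrier := PUnit, finrank_eq := Module.finrank_zero_of_subsingleton }
  let E := quadProd h2 (n := 2 * d) (by simp) R S β
  refine Finite.of_injective (β := {e : E // IsIdempotentElem e})
    (fun e => ⟨(e.1, 0), Prod.ext e.2 (mul_zero _)⟩) fun e e' h => ?_
  have := congrArg Subtype.val h
  exact Subtype.ext (congrArg Prod.fst this)

/-- The element (1 + r)/2 is idempotent. The homomorphisms r ↦ 1 and r ↦ -1 to R send it to 1 and 0,
so it is neither 0 nor 1. -/
theorem three_le_numIdem_quadExt_one (h2 : (2 : K) ≠ 0) [Nontrivial R] :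
    3 ≤ numIdem (QuadExt ((1 : (R : Type u)ˣ) : R)) := by
  have := finite_idem_quadExt R 1 h2
  set r := AdjoinRoot.root (X ^ 2 - C ((1 : (R : Type u)ˣ) : R)) with hr
  have hr2 : r ^ 2 = 1 := by rw [hr, QuadExt.root_sq]; exact map_one _
  set t := AdjoinRoot.of (X ^ 2 - C ((1 : (R : Type u)ˣ) : R)) (algebraMap K R 2⁻¹) with ht
  have ht2 : 2 * t = 1 := by
    have : (2 : QuadExt ((1 : (R : Type u)ˣ) : R)) =
        AdjoinRoot.of _ (algebraMap K R 2) :=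
      (map_ofNat ((AdjoinRoot.of _).comp (algebraMap K R)) 2).symm
    rw [this, ht, ← map_mul, ← map_mul, mul_inv_cancel₀ h2, map_one, map_one]
  have hlift : ∀ z : R, z ^ 2 = 1 → (algebraMap K R 2⁻¹) * (1 + z) ≠ 1 →
      t * (1 + r) ≠ 1 := by
    intro z hz hz1 h
    let f : QuadExt ((1 : (R : Type u)ˣ) : R) →+* R := AdjoinRoot.lift (RingHom.id R) z (by
      simp [hz])
    have := congrArg f h
    rw [map_mul, map_add, map_one, AdjoinRoot.lift_of, AdjoinRoot.lift_root] at this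
    exact hz1 this
  have hlift' : ∀ z : R, z ^ 2 = 1 → (algebraMap K R 2⁻¹) * (1 + z) ≠ 0 →
      t * (1 + r) ≠ 0 := by
    intro z hz hz1 h
    let f : QuadExt ((1 : (R : Type u)ˣ) : R) →+* R := AdjoinRoot.lift (RingHom.id R) z (by
      simp [hz])
    have := congrArg f h
    rw [map_mul, map_add, map_one, map_zero, AdjoinRoot.lift_of, AdjoinRoot.lift_root] at this
    exact hz1 this
  refine three_le_numIdem (e := t * (1 + r)) ?_ (hlift' 1 (one_pow 2) ?_) (hlift (-1) (by ring) ?_)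
  · rw [IsIdempotentElem]
    linear_combination (t ^ 2) * hr2 + (t * (1 + r)) * ht2
  · have : (1 + 1 : R) = algebraMap K R 2 := by rw [map_ofNat]; norm_num
    rw [this, ← map_mul, inv_mul_cancel₀ h2, map_one]
    exact one_ne_zero
  · rw [add_neg_cancel, mul_zero]
    exact zero_ne_one

end Quad

/-! ### Deformation of quadratic extensions -/

section Deform

open Polynomial

variable {d s n : ℕ} {K : Type u} [Field K]

theorem EtAlg.exists_isScalarExt {L M : Type u} [Field L] [Field M] (A : EtAlg n K) {φ : K →+* L}
    {ψ : L →+* M} {χ : K →+* M} (h : ψ.comp φ = χ) :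
    ∃ g : A.baseChange φ →+* A.baseChange χ, IsScalarExt ψ g ∧
      ∀ a, g (A.incl φ a) = A.incl χ a := by
  subst h
  exact ⟨_, A.isScalarExt_inclMap φ ψ, A.inclMap_incl φ ψ⟩

variable (F : EtAlg d K) (S : EtAlg s K) (c : F)

/-- The element `1 + t c` of `F ⊗ K(t)`. -/
noncomputable def deform : F.baseChange (constRat K) :=
  1 + algebraMap (FractionRing K[X]) _ (algebraMap K[X] _ X) * F.incl (constRat K) c

/-- For t = θ + s one has 1 + tc = β + sc = β(1 + sβ⁻¹c), and the last factor is the square of a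
unit. -/
theorem exists_specialize_deform {k : Type u} [Field k] (h2 : (2 : k) ≠ 0) (φ : K →+* k) (θ : k)
    (β : (F.baseChange φ : Type u)ˣ)
    (hβ : (β : F.baseChange φ) = 1 + algebraMap k _ θ * F.incl φ c) :
    ∃ (g : F.baseChange (constRat K) →+* F.baseChange ((constLaurent k).comp φ))
      (w : (F.baseChange ((constLaurent k).comp φ) : Type u)ˣ), IsScalarExt (specialize φ θ) g ∧
      g (deform F c) = F.inclMap φ (constLaurent k) β * w ^ 2 := by
  obtain ⟨g, hg, hgi⟩ := F.exists_isScalarExt (specialize_comp_constRat φ θ)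
  have hh := F.isScalarExt_inclMap φ (constLaurent k)
  obtain ⟨w, hw⟩ := exists_unit_sq_eq h2 (F.baseChange φ) (F.inclMap φ (constLaurent k))
    hh.map_algebraMap ((β⁻¹ : (F.baseChange φ : Type u)ˣ) * F.incl φ c)
  refine ⟨g, w, hg, ?_⟩
  have hX : specialize φ θ (algebraMap K[X] _ X) = constLaurent k θ + unifLaurent k := by
    rw [specialize_algebraMap, taylorHom_X, map_add]
    rfl
  have hβ' : F.inclMap φ (constLaurent k) β =
      1 + algebraMap _ _ (constLaurent k θ) * F.incl ((constLaurent k).comp φ) c := by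
    rw [hβ, map_add, map_one, map_mul, hh.map_algebraMap, F.inclMap_incl]
  have hinv : F.inclMap φ (constLaurent k) β *
      F.inclMap φ (constLaurent k) ((β⁻¹ : (F.baseChange φ : Type u)ˣ) * F.incl φ c) =
      F.incl ((constLaurent k).comp φ) c := by
    rw [← map_mul, Units.mul_inv_cancel_left, F.inclMap_incl]
  rw [deform, map_add, map_one, map_mul, hg.map_algebraMap, hgi, hX, map_add, hw]
  linear_combination (-1 : F.baseChange ((constLaurent k).comp φ)) * hβ' -
    algebraMap _ (F.baseChange ((constLaurent k).comp φ)) (unifLaurent k : LaurentSeries k) * hinv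

/-- Specialized at θ = 0 the element becomes the square of a unit. Scalar extension being injective,
it is no zero divisor in an Artinian ring. -/
theorem isUnit_deform (h2 : (2 : K) ≠ 0) : IsUnit (deform F c) := by
  obtain ⟨g, w, hg, h⟩ := exists_specialize_deform F c h2 (RingHom.id K) 0 1 (by simp)
  have : IsArtinianRing (F.baseChange (constRat K)) :=
    isArtinian_of_tower (FractionRing K[X]) inferInstance
  rw [Units.val_one, map_one, one_mul] at h
  refine IsArtinianRing.isUnit_of_mem_nonZeroDivisors (mem_nonZeroDivisors_iff_right.2 fun x hx => ?_)
  have hx' := congrArg g hx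
  rw [map_mul, h, map_zero, ← Units.val_pow_eq_pow_val, Units.mul_left_eq_zero] at hx'
  exact (map_eq_zero_iff g hg.injective).1 hx'

theorem map_specialize_deform (h2 : (2 : K) ≠ 0) (hQ : (2 : FractionRing K[X]) ≠ 0)
    (hn : 2 * d + s = n) {k : Type u} [Field k]
    (hk : (2 : k) ≠ 0) (φ : K →+* k) (θ : k) (β : (F.baseChange φ : Type u)ˣ)
    (hβ : (β : F.baseChange φ) = 1 + algebraMap k _ θ * F.incl φ c) :
    Et.map (specialize φ θ) (Et.mk (quadProd hQ hn (F.baseChange (constRat K))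
      (S.baseChange (constRat K)) (isUnit_deform F c h2).unit)) =
    Et.map (constLaurent k) (Et.mk (quadProd hk hn (F.baseChange φ) (S.baseChange φ) β)) := by
  obtain ⟨g, w, hg, h⟩ := exists_specialize_deform F c hk φ θ β hβ
  obtain ⟨f, hf, -⟩ := S.exists_isScalarExt (specialize_comp_constRat φ θ)
  have hL : (2 : LaurentSeries k) ≠ 0 := by
    have := (map_ne_zero (constLaurent k)).2 hk
    rwa [map_ofNat] at this
  rw [map_quadProd hQ hL hn hg hf _ (Units.map (F.inclMap φ (constLaurent k)) β) w h,
    map_quadProd hk hL hn (F.isScalarExt_inclMap φ (constLaurent k))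
      (S.isScalarExt_inclMap φ (constLaurent k)) β
      (Units.map (F.inclMap φ (constLaurent k)) β) 1 (by simp)]

/-- An invariant that vanishes on the algebras with more than `2 e` idempotents, where `e` is the
number of idempotents of `S`, vanishes on `F[√b] × S` if `b ∉ K`. -/
theorem eq_zero_of_quadProd (α : Inv.{u} n) (K : Fld.{u}) (hn : 2 * d + s = n) (F : EtAlg d K)
    (S : EtAlg s K) (b : (F : Type u)ˣ) (hb : (b : F) ∉ Set.range (algebraMap K F))
    (ih : ∀ (L : Fld.{u}) (E : EtAlg n L), 2 * numIdem S < numIdem E → α.1 L (Et.mk E) = 0) :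
    α.1 K (Et.mk (quadProd K.two_ne_zero hn F S b)) = 0 := by
  have h2 : (2 : K) ≠ 0 := K.two_ne_zero
  -- The family 1 + tc runs from 1 at t = 0 to b at t = 1.
  set c : F := b - 1 with hc
  have hcr : c ∉ Set.range (algebraMap K F) := by
    rintro ⟨a, ha⟩
    exact hb ⟨a + 1, by rw [map_add, map_one, ha, hc, sub_add_cancel]⟩
  have hF : Nontrivial F := by
    by_contra h
    rw [not_nontrivial_iff_subsingleton] at h
    exact hb ⟨0, Subsingleton.elim _ _⟩
  have hnt : ∀ {k : Type u} [Field k] (φ : K →+* k), Nontrivial (F.baseChange φ) := fun φ =>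
    (F.isScalarExt_incl φ).injective.nontrivial
  have hidem : ∀ {k : Type u} [Field k] (hk : (2 : k) ≠ 0) (φ : K →+* k)
      (β : (F.baseChange φ : Type u)ˣ), 3 ≤ numIdem (QuadExt (β : F.baseChange φ)) →
      2 * numIdem S < numIdem (quadProd hk hn (F.baseChange φ) (S.baseChange φ) β) := by
    intro k _ hk φ β h
    rw [numIdem_quadProd]
    have h1 : numIdem S ≤ numIdem (S.baseChange φ) :=
      numIdem_le_of_injective _ (S.isScalarExt_incl φ).injective
    have h3 : 1 ≤ numIdem S := one_le_numIdem
    nlinarith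
  have h2k : ∀ {k : Type u} [Field k] (φ : K →+* k), (2 : k) ≠ 0 := fun φ => by
    have := (map_ne_zero φ).2 h2
    rwa [map_ofNat] at this
  have hQ : (2 : FractionRing K[X]) ≠ 0 := h2k (constRat K)
  set Et' := Et.mk (quadProd hQ hn (F.baseChange (constRat K))
      (S.baseChange (constRat K)) (isUnit_deform F c h2).unit) with hEt
  set q := α.1 ⟨FractionRing K[X], hQ⟩ Et' with hq
  have key : ∀ {k : Type u} [Field k] (hk : (2 : k) ≠ 0) (φ : K →+* k) (θ : k)
      (β : (F.baseChange φ : Type u)ˣ) (hβ : (β : F.baseChange φ) =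
        1 + algebraMap k _ θ * F.incl φ c), W.map (specialize φ θ) q =
        W.map (constLaurent k) (α.1 ⟨k, hk⟩
          (Et.mk (quadProd hk hn (F.baseChange φ) (S.baseChange φ) β))) := by
    intro k _ hk φ θ β hβ
    have hL : (2 : LaurentSeries k) ≠ 0 := h2k ((constLaurent k).comp φ)
    have h1 := α.2 ⟨FractionRing K[X], hQ⟩ ⟨LaurentSeries k, hL⟩ (specialize φ θ) Et'
    have h3 := α.2 ⟨k, hk⟩ ⟨LaurentSeries k, hL⟩ (constLaurent k)
      (Et.mk (quadProd hk hn (F.baseChange φ) (S.baseChange φ) β))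
    rw [hEt] at h1
    refine h1.symm.trans (Eq.trans ?_ h3)
    exact congrArg _ (map_specialize_deform F S c h2 hQ hn hk φ θ β hβ)
  -- The value q on the family is unramified at every closed point of the affine line, hence
  -- constant.
  obtain ⟨y, hy⟩ := exists_map_constRat_eq h2 q fun p _ => by
    have hk : (2 : AdjoinRoot p) ≠ 0 := h2k (AdjoinRoot.of p)
    by_cases hfield : IsField (F.baseChange (AdjoinRoot.of p))
    -- Here 1 + θc is nonzero in a field, hence a unit; this is where b ∉ K enters.
    · let := hfield.toField
      have hne := F.one_add_mul_incl_ne_zero (AdjoinRoot.of p) hcr (AdjoinRoot.root p)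
      obtain ⟨z, hz⟩ := hfield.mul_inv_cancel hne
      exact ⟨_, (key hk (AdjoinRoot.of p) (AdjoinRoot.root p)
        ((IsUnit.of_mul_eq_one _ hz).unit) rfl).symm⟩
    -- If F is no longer a field over the residue field, the algebra over the Laurent series has
    -- enough idempotents for the induction hypothesis, whether or not 1 + θc is a unit.
    · have hL : (2 : LaurentSeries (AdjoinRoot p)) ≠ 0 :=
        h2k ((constLaurent _).comp (AdjoinRoot.of p))
      set ψ := specialize (AdjoinRoot.of p) (AdjoinRoot.root p)
      obtain ⟨f, hf, -⟩ := F.exists_isScalarExt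
        (specialize_comp_constRat (AdjoinRoot.of p) (AdjoinRoot.root p)).symm
      set β := Units.map (F.inclMap (constRat K) ψ).toMonoidHom (isUnit_deform F c h2).unit
      have := hnt (AdjoinRoot.of p)
      have := finite_idem_quadExt (F.baseChange (ψ.comp (constRat K))) β hL
      have hq0 : W.map ψ q = 0 := by
        refine (α.2 ⟨FractionRing K[X], hQ⟩ ⟨LaurentSeries (AdjoinRoot p), hL⟩ ψ Et').symm.trans ?_
        rw [hEt]
        refine (congrArg _ (map_quadProd hQ hL hn (F.isScalarExt_inclMap (constRat K) ψ)
          (S.isScalarExt_inclMap (constRat K) ψ) _ β 1 (by simp [β]))).trans ?_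
        refine ih ⟨_, hL⟩ _ (hidem hL _ β ?_)
        exact ((EtAlg.three_le_numIdem_of_not_isField _ hfield).trans
          (numIdem_le_of_injective f hf.injective)).trans
          (numIdem_le_of_injective _ (QuadExt.of_injective _))
      exact ⟨0, by rw [map_zero, hq0]⟩
  have := hnt (RingHom.id K)
  have hspec : ∀ θ : K, W.map (specialize (RingHom.id K) θ) q = W.map (constLaurent K) y := by
    intro θ
    rw [← hy, ← W.map_comp, specialize_comp_constRat, RingHom.comp_id]
  have hinj := map_constLaurent_injective h2
  -- At t = 0 the algebra is F[√1] × S, to which the induction hypothesis applies.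
  have hy0 : y = 0 := by
    apply hinj
    rw [← hspec 0, key h2 (RingHom.id K) 0 1 (by simp), map_zero]
    refine (congrArg _ (ih ⟨K, h2⟩ _ (hidem h2 (RingHom.id K) 1 ?_))).trans (map_zero _)
    exact three_le_numIdem_quadExt_one _ h2
  have hi := F.isScalarExt_incl (RingHom.id K)
  -- At t = 1 the algebra is F[√b] × S, extended along the identity.
  have h1 := key h2 (RingHom.id K) 1 (Units.map (F.incl (RingHom.id K)) b) (by
    simp [hc])
  rw [hspec, hy0] at h1
  have h3 := hinj h1.symm
  have h4 := α.2 K K (RingHom.id K) (Et.mk (quadProd h2 hn F S b))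
  rw [map_quadProd h2 h2 hn hi (S.isScalarExt_incl (RingHom.id K)) b
    (Units.map (F.incl (RingHom.id K)) b) 1 (by simp)] at h4
  apply hinj
  rw [map_zero]
  have h5 := congrArg (W.map (constLaurent K)) (h4.symm.trans h3)
  rwa [← W.map_comp, RingHom.comp_id, map_zero] at h5

end Deform

/-! ### Field extensions of odd degree and of degree two -/

section FieldExt

open IntermediateField Module

variable {K : Type u} [Field K]

theorem exists_isGalois (A : Type u) [Field A] [Algebra K A] [FiniteDimensional K A]
    [Algebra.IsSeparable K A] : ∃ (N : Type u) (_ : Field N) (_ : Algebra K N),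
      FiniteDimensional K N ∧ IsGalois K N ∧ Nonempty (A →ₐ[K] N) := by
  let f : A →ₐ[K] SeparableClosure K := IsSepClosed.lift
  refine ⟨IntermediateField.normalClosure K A (SeparableClosure K), inferInstance, inferInstance,
    inferInstance, IsGalois.normalClosure K A (SeparableClosure K), ⟨?_⟩⟩
  exact (IntermediateField.inclusion f.fieldRange_le_normalClosure).comp
    f.equivFieldRange.toAlgHom

theorem exists_odd_finrank (N : Type u) [Field N] [Algebra K N] [FiniteDimensional K N]
    [IsGalois K N] : ∃ L : IntermediateField K N, Odd (finrank K L) ∧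
      ∃ k, finrank L N = 2 ^ k := by
  let P : Sylow 2 Gal(N/K) := default
  have h1 := finrank_fixedField_eq_card (P : Subgroup Gal(N/K))
  obtain ⟨k, hk⟩ := IsPGroup.iff_card.1 P.isPGroup'
  refine ⟨fixedField (P : Subgroup Gal(N/K)), ?_, k, h1.trans hk⟩
  have h2 := finrank_mul_finrank K (fixedField (P : Subgroup Gal(N/K))) N
  rw [h1, ← IsGalois.card_aut_eq_finrank K N, ← (P : Subgroup Gal(N/K)).index_mul_card] at h2
  have h3 := Nat.eq_of_mul_eq_mul_right Nat.card_pos h2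
  rw [h3, ← Nat.not_even_iff_odd, even_iff_two_dvd]
  exact P.not_dvd_index

/-- In a 2-group, a proper subgroup of order 2^a lies in one of order 2^(a+1). Applied to the group
that fixes the image of A, this yields a subfield over which A is quadratic. -/
theorem exists_finrank_eq_two {N : Type u} [Field N] [Algebra K N] [FiniteDimensional K N]
    [IsGalois K N] {k : ℕ} (hk : finrank K N = 2 ^ k) {A : Type u} [Field A] [Algebra K A]
    (f : A →ₐ[K] N) (hA : 1 < finrank K A) :
    ∃ F : IntermediateField K A, finrank F A = 2 := by
  have : FiniteDimensional K A := FiniteDimensional.of_injective f.toLinearMap f.injective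
  have h1 := finrank_mul_finrank K f.fieldRange N
  have h2 := f.equivFieldRange.toLinearEquiv.finrank_eq
  rw [← h2, hk] at h1
  obtain ⟨a, ha, haN⟩ := (Nat.dvd_prime_pow Nat.prime_two).1 (Dvd.intro_left _ h1)
  have hak : a < k := by
    refine lt_of_le_of_ne ha fun h => ?_
    rw [haN, h] at h1
    have : finrank K A = 1 := Nat.eq_of_mul_eq_mul_right (pow_pos two_pos k) (by rw [h1, one_mul])
    omega
  obtain ⟨H, hH, hle⟩ := Sylow.exists_subgroup_card_pow_succ (G := Gal(N/K)) (p := 2) (n := a)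
    (by rw [IsGalois.card_aut_eq_finrank, hk]; exact pow_dvd_pow 2 hak)
    (H := f.fieldRange.fixingSubgroup) (by rw [IsGalois.card_fixingSubgroup_eq_finrank, haN])
  have hle' : fixedField H ≤ f.fieldRange := by
    rw [← IsGalois.fixedField_fixingSubgroup f.fieldRange]
    exact fixedField_le hle
  refine ⟨(fixedField H).comap f, ?_⟩
  have hmap : ((fixedField H).comap f).map f = fixedField H := by
    apply le_antisymm
    · rintro _ ⟨x, hx, rfl⟩
      exact hx
    · intro x hx
      obtain ⟨y, rfl⟩ := hle' hx
      exact ⟨y, hx, rfl⟩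
  have h3 := (equivMap ((fixedField H).comap f) f).toLinearEquiv.finrank_eq
  rw [hmap] at h3
  have h4 := finrank_mul_finrank K ((fixedField H).comap f) A
  have h5 := finrank_mul_finrank K (fixedField H) N
  rw [finrank_fixedField_eq_card, hH, hk] at h5
  rw [haN] at h1
  rw [h3] at h4
  have hpos : 0 < finrank K (fixedField H) := finrank_pos
  have h6 : finrank K (fixedField H) * finrank ((fixedField H).comap f) A * 2 ^ a =
      finrank K (fixedField H) * 2 * 2 ^ a := by
    rw [h4, h1, ← h5, pow_succ]
    ring
  exact Nat.eq_of_mul_eq_mul_left hpos (Nat.eq_of_mul_eq_mul_right (pow_pos two_pos a) h6)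

variable {F A : Type u} [Field F] [Field A] [Algebra F A]

theorem exists_sq_of_finrank_eq_two (h2 : (2 : F) ≠ 0) (h : finrank F A = 2) :
    ∃ (y : A) (b : F), y ^ 2 = algebraMap F A b ∧ y ∉ Set.range (algebraMap F A) := by
  have hfin : FiniteDimensional F A := FiniteDimensional.of_finrank_pos (by omega)
  obtain ⟨z, hz⟩ : ∃ z : A, z ∉ Set.range (algebraMap F A) := by
    by_contra hno
    push Not at hno
    have := finrank_le_one (R := F) (1 : A) fun w => by
      obtain ⟨c, hc⟩ := hno w
      exact ⟨c, by rw [← hc, Algebra.algebraMap_eq_smul_one]⟩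
    omega
  have hint : IsIntegral F z := .of_finite F z
  have hdeg : (minpoly F z).natDegree = 2 :=
    le_antisymm ((minpoly.natDegree_le z).trans h.le) ((minpoly.two_le_natDegree_iff hint).2 hz)
  have hz2 := minpoly.aeval F z
  rw [(minpoly.monic hint).as_sum, hdeg] at hz2
  simp only [Finset.sum_range_succ, Finset.sum_range_zero, map_add, map_mul, map_pow,
    Polynomial.aeval_X, Polynomial.aeval_C, pow_zero, pow_one, mul_one, zero_add] at hz2
  set p := (minpoly F z).coeff 1
  set q := (minpoly F z).coeff 0
  have h2A : 2 * algebraMap F A 2⁻¹ = 1 := by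
    rw [← map_ofNat (algebraMap F A) 2, ← map_mul, mul_inv_cancel₀ h2, map_one]
  refine ⟨z + algebraMap F A (2⁻¹ * p), (2⁻¹ * p) ^ 2 - q, ?_, ?_⟩
  · rw [map_sub, map_pow, map_mul]
    linear_combination hz2 + algebraMap F A p * z * h2A
  · rintro ⟨c, hc⟩
    exact hz ⟨c - 2⁻¹ * p, by rw [map_sub, hc, add_sub_cancel_right]⟩

theorem bijective_lift_quadExt (h : finrank F A = 2) {y : A} {b : F} (hy : y ^ 2 = algebraMap F A b)
    (hy' : y ∉ Set.range (algebraMap F A)) : ∃ f : QuadExt b →ₐ[F] A, Function.Bijective f := by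
  have hfin : FiniteDimensional F A := FiniteDimensional.of_finrank_pos (by omega)
  have := QuadExt.finite (K := F) F b
  let f : QuadExt b →ₐ[F] A := AdjoinRoot.liftAlgHom _ (Algebra.ofId F A) y (by simp [hy])
  have hinj : Function.Injective f := by
    rw [injective_iff_map_eq_zero]
    intro x hx
    obtain ⟨a, r, rfl⟩ := QuadExt.exists_eq b x
    have hx' : algebraMap F A a + algebraMap F A r * y = 0 := by
      simpa [f] using hx
    have hr : r = 0 := by
      by_contra hr
      refine hy' ⟨-(r⁻¹ * a), ?_⟩
      have hrA : algebraMap F A r⁻¹ * algebraMap F A r = 1 := by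
        rw [← map_mul, inv_mul_cancel₀ hr, map_one]
      rw [map_neg, map_mul]
      linear_combination (-algebraMap F A r⁻¹) * hx' + y * hrA
    rw [hr, map_zero, zero_mul, add_zero, map_eq_zero] at hx'
    rw [hr, hx', map_zero, zero_mul, add_zero]
  refine ⟨f, hinj, ?_⟩
  exact (LinearMap.injective_iff_surjective_of_finrank_eq_finrank (f := f.toLinearMap)
    (by rw [QuadExt.finrank, h, finrank_self])).1 hinj

/-- Completing the square gives A = F(√b). If b lies in K, it is replaced by bc² with c² ∉ K. Such a
c exists: otherwise w = ((w + 1)² - w² - 1)/2 would put all of F into K. -/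
theorem exists_algEquiv_quadExt [Algebra K F] [Algebra K A] [IsScalarTower K F A]
    (h2 : (2 : K) ≠ 0) (h : finrank F A = 2) (hF : 1 < finrank K F) :
    ∃ b : Fˣ, (b : F) ∉ Set.range (algebraMap K F) ∧ Nonempty (QuadExt (b : F) ≃ₐ[K] A) := by
  have h2F : (2 : F) ≠ 0 := by
    have := (map_ne_zero (algebraMap K F)).2 h2
    rwa [map_ofNat] at this
  obtain ⟨y, b, hy, hy'⟩ := exists_sq_of_finrank_eq_two h2F h
  have main : ∀ (y : A) (b : F), y ^ 2 = algebraMap F A b → y ∉ Set.range (algebraMap F A) →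
      b ∉ Set.range (algebraMap K F) → ∃ b : Fˣ, (b : F) ∉ Set.range (algebraMap K F) ∧
        Nonempty (QuadExt (b : F) ≃ₐ[K] A) := by
    intro y b hy hy' hb
    have hb0 : b ≠ 0 := by
      rintro rfl
      exact hb ⟨0, map_zero _⟩
    obtain ⟨f, hf⟩ := bijective_lift_quadExt h hy hy'
    exact ⟨Units.mk0 b hb0, hb, ⟨(AlgEquiv.ofBijective f hf).restrictScalars K⟩⟩
  by_cases hb : b ∈ Set.range (algebraMap K F)
  swap
  · exact main y b hy hy' hb
  obtain ⟨b, rfl⟩ := hb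
  have hfin : FiniteDimensional K F := FiniteDimensional.of_finrank_pos (by omega)
  have hb0 : b ≠ 0 := by
    rintro rfl
    rw [map_zero, map_zero, sq_eq_zero_iff] at hy
    exact hy' ⟨0, by rw [map_zero, hy]⟩
  obtain ⟨c, hc⟩ : ∃ c : F, c ^ 2 ∉ Set.range (algebraMap K F) := by
    by_contra hno
    push Not at hno
    have := finrank_le_one (R := K) (1 : F) fun w => by
      obtain ⟨p, hp⟩ := hno w
      obtain ⟨q, hq⟩ := hno (w + 1)
      refine ⟨2⁻¹ * (q - p - 1), ?_⟩
      have h2A : 2 * algebraMap K F 2⁻¹ = 1 := by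
        rw [← map_ofNat (algebraMap K F) 2, ← map_mul, mul_inv_cancel₀ h2, map_one]
      rw [← Algebra.algebraMap_eq_smul_one, map_mul, map_sub, map_sub, map_one]
      linear_combination (algebraMap K F 2⁻¹) * (hq - hp) + w * h2A
    omega
  have hc0 : c ≠ 0 := by
    rintro rfl
    exact hc ⟨0, by simp⟩
  refine main (y * algebraMap F A c) (algebraMap K F b * c ^ 2) ?_ ?_ ?_
  · rw [mul_pow, hy, map_mul, map_pow]
  · rintro ⟨r, hr⟩
    refine hy' ⟨r * c⁻¹, ?_⟩
    rw [map_mul, hr, mul_assoc, ← map_mul, mul_inv_cancel₀ hc0, map_one, mul_one]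
  · rintro ⟨r, hr⟩
    refine hc ⟨b⁻¹ * r, ?_⟩
    rw [map_mul, hr, ← mul_assoc, ← map_mul, inv_mul_cancel₀ hb0, map_one, one_mul]

end FieldExt

/-! ### Reduction to multiquadratic algebras -/

section Prod

variable {d s n : ℕ} {K L : Type u} [Field K] [Field L]

/-- The product of étale algebras. -/
noncomputable def EtAlg.prod (hn : d + s = n) (R : EtAlg d K) (S : EtAlg s K) : EtAlg n K where
  carrier := R × S
  etale := etale_prod
  finrank_eq := by rw [Module.finrank_prod, R.finrank_eq, S.finrank_eq, hn]

theorem IsScalarExt.prodMap (hn : d + s = n) {φ : K →+* L} {R : EtAlg d K} {S : EtAlg s K}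
    {R' : EtAlg d L} {S' : EtAlg s L} {g : R →+* R'} {h : S →+* S'} (hg : IsScalarExt φ g)
    (hh : IsScalarExt φ h) :
    IsScalarExt φ (A := EtAlg.prod hn R S) (B := EtAlg.prod hn R' S') (RingHom.prodMap g h) where
  map_algebraMap c := Prod.ext (hg.map_algebraMap c) (hh.map_algebraMap c)
  span := by
    set V := Submodule.span L (Set.range (RingHom.prodMap g h)) with hV
    have h1 : ∀ x : R', ((x, 0) : R' × S') ∈ V := fun x => by
      have hx : x ∈ Submodule.span L (Set.range g) := hg.span ▸ trivial
      induction hx using Submodule.span_induction with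
      | mem x hx =>
        obtain ⟨x, rfl⟩ := hx
        exact Submodule.subset_span ⟨(x, 0), Prod.ext rfl (map_zero h)⟩
      | zero => exact zero_mem _
      | add x y _ _ hx hy => simpa using add_mem hx hy
      | smul c x _ hx => simpa using V.smul_mem c hx
    have h2 : ∀ x : S', ((0, x) : R' × S') ∈ V := fun x => by
      have hx : x ∈ Submodule.span L (Set.range h) := hh.span ▸ trivial
      induction hx using Submodule.span_induction with
      | mem x hx =>
        obtain ⟨x, rfl⟩ := hx
        exact Submodule.subset_span ⟨(0, x), Prod.ext (map_zero g) rfl⟩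
      | zero => exact zero_mem _
      | add x y _ _ hx hy => simpa using add_mem hx hy
      | smul c x _ hx => simpa using V.smul_mem c hx
    rw [eq_top_iff]
    rintro ⟨x, y⟩ -
    have := add_mem (h1 x) (h2 y)
    rwa [Prod.mk_add_mk, add_zero, zero_add] at this

theorem etale_of_isSeparable (A : Type u) [Field A] [Algebra K A] [FiniteDimensional K A]
    [Algebra.IsSeparable K A] : Algebra.Etale K A where
  formallyEtale := Algebra.FormallyEtale.of_isSeparable K A
  finitePresentation := Algebra.FinitePresentation.of_finiteType.1 inferInstance

end Prod

/-! ### Elimination of field factors of degree at least three. -/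

section Reduction

open TensorProduct in
theorem EtAlg.exists_algHom {n : ℕ} {K L : Type u} [Field K] [Field L] (φ : K →+* L)
    (A : EtAlg n K) {N : Type u} [CommRing N] [Algebra L N] (j : A →+* N)
    (hj : ∀ c, j (algebraMap K A c) = algebraMap L N (φ c)) :
    Nonempty (A.baseChange φ →ₐ[L] N) := by
  let := φ.toAlgebra
  let : Algebra K N := ((algebraMap L N).comp φ).toAlgebra
  have : IsScalarTower K L N := IsScalarTower.of_algebraMap_eq fun _ => rfl
  let j' : A →ₐ[K] N := { j with commutes' := hj }
  exact ⟨(Algebra.TensorProduct.lift (Algebra.ofId L N) j' (fun _ _ => Commute.all _ _) :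
    L ⊗[K] A →ₐ[L] N)⟩

open Module

variable {d s n : ℕ}

/-- An invariant that vanishes on the algebras with more idempotents than `E × S` vanishes on
`E × S` if `E` is a field of degree at least three. -/
theorem eq_zero_of_prod (α : Inv.{u} n) (K : Fld.{u}) (hn : d + s = n) (E : EtAlg d K)
    (S : EtAlg s K) (hE : IsField E) (hd : 2 < d)
    (ih : ∀ (L : Fld.{u}) (E' : EtAlg n L), 2 * numIdem S < numIdem E' →
      α.1 L (Et.mk E') = 0) : α.1 K (Et.mk (EtAlg.prod hn E S)) = 0 := by
  -- N is a Galois extension containing E, and L is the fixed field of a Sylow 2-subgroup of its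
  -- group.
  obtain ⟨N, _, _, _, _, L, f, hodd, k, hk⟩ : ∃ (N : Type u) (_ : Field N) (_ : Algebra K N)
      (_ : FiniteDimensional K N) (_ : IsGalois K N) (L : IntermediateField K N) (_ : E →ₐ[K] N),
      Odd (finrank K L) ∧ ∃ k, finrank L N = 2 ^ k := by
    let := hE.toField
    have : Algebra.IsSeparable K E := Algebra.FormallyUnramified.isSeparable K E
    obtain ⟨N, _, _, _, _, ⟨f⟩⟩ := exists_isGalois (K := K) E
    obtain ⟨L, h⟩ := exists_odd_finrank (K := K) N
    exact ⟨N, _, _, inferInstance, inferInstance, L, f, h⟩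
  set φ := algebraMap K L
  have hL : (2 : L) ≠ 0 := by
    have := (map_ne_zero φ).2 K.two_ne_zero
    rwa [map_ofNat] at this
  have hS : numIdem S ≤ numIdem (S.baseChange φ) :=
    numIdem_le_of_injective _ (S.isScalarExt_incl φ).injective
  -- By Springer's theorem the vanishing may be checked over L.
  suffices h : α.1 ⟨L, hL⟩ (Et.mk (EtAlg.prod hn (E.baseChange φ) (S.baseChange φ))) = 0 by
    apply W.map_injective_of_odd_finrank K.two_ne_zero L hodd
    rw [map_zero, ← h, ← ((E.isScalarExt_incl φ).prodMap hn (S.isScalarExt_incl φ)).map_mk]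
    exact (α.2 K ⟨L, hL⟩ φ _).symm
  have hE' : Nontrivial E := ⟨hE.exists_pair_ne⟩
  have := (E.isScalarExt_incl φ).injective.nontrivial
  by_cases hfield : IsField (E.baseChange φ)
  swap
  · refine ih ⟨L, hL⟩ _ ?_
    have h1 : numIdem (EtAlg.prod hn (E.baseChange φ) (S.baseChange φ)) =
      numIdem (E.baseChange φ) * numIdem (S.baseChange φ) := numIdem_prod
    have h3 := EtAlg.three_le_numIdem_of_not_isField _ hfield
    have h4 : 1 ≤ numIdem S := one_le_numIdem
    rw [h1]
    nlinarith
  obtain ⟨f'⟩ := E.exists_algHom φ (N := N) f.toRingHom fun c =>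
    (f.commutes c).trans (IsScalarTower.algebraMap_apply K L N c)
  -- As d = 2d' exceeds 2, the subfield F is larger than L, which is needed to choose b outside L.
  obtain ⟨d', hd', F, b, hb, ⟨e⟩⟩ : ∃ (d' : ℕ) (_ : 2 * d' = d) (F : EtAlg d' L)
      (b : (F : Type u)ˣ), (b : F) ∉ Set.range (algebraMap L F) ∧
      Nonempty (QuadExt (b : F) ≃ₐ[L] E.baseChange φ) := by
    let := hfield.toField
    have hfin : finrank L (E.baseChange φ) = d := EtAlg.finrank_eq _
    obtain ⟨F, hF⟩ := exists_finrank_eq_two hk f' (by omega)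
    have h1 := finrank_mul_finrank L F (E.baseChange φ)
    rw [hF, hfin] at h1
    obtain ⟨b, hb, he⟩ := exists_algEquiv_quadExt hL hF (by omega)
    have : Algebra.IsSeparable L (E.baseChange φ) := Algebra.FormallyUnramified.isSeparable L _
    have : Algebra.IsSeparable L F :=
      Algebra.isSeparable_tower_bot_of_isSeparable L F (E.baseChange φ)
    exact ⟨finrank L F, by omega, { carrier := F, etale := etale_of_isSeparable F, finrank_eq := rfl },
      b, hb, he⟩
  have hn' : 2 * d' + s = n := by omega
  have h1 := eq_zero_of_quadProd α ⟨L, hL⟩ hn' F (S.baseChange φ) b hb fun L' E' h =>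
    ih L' E' (by omega)
  rw [← h1]
  exact congrArg _ (Quotient.sound ⟨AlgEquiv.prodCongr e.symm AlgEquiv.refl⟩)

end Reduction

/-! ### The splitting principle -/

section Splitting

open Module Polynomial

/-- The products of quadratic algebras and of at most one copy of the base field. -/
def IsMultiquad (K : Fld.{u}) (A : Type u) [CommRing A] [Algebra K A] : Prop :=
  ∃ (ι : Type) (_ : Fintype ι) (r : ℕ) (a : ι → Kˣ), r ≤ 1 ∧
    Nonempty (A ≃ₐ[K] (∀ j, QuadAlg K (a j)) × (Fin r → K))

/-- Separation of the factor of index `none`. -/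
def piOptionAlgEquiv (R : Type*) [CommSemiring R] {ι : Type*} (A : Option ι → Type*)
    [∀ i, CommRing (A i)] [∀ i, Algebra R (A i)] :
    (∀ i, A i) ≃ₐ[R] A none × ∀ i, A (some i) where
  __ := RingEquiv.piOptionEquivProd (R := A)
  commutes' _ := rfl

/-- Associativity of products of algebras. -/
def prodAssocAlgEquiv (R A B C : Type*) [CommSemiring R] [CommRing A] [CommRing B] [CommRing C]
    [Algebra R A] [Algebra R B] [Algebra R C] : ((A × B) × C) ≃ₐ[R] A × (B × C) where
  __ := Equiv.prodAssoc A B C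
  map_mul' _ _ := rfl
  map_add' _ _ := rfl
  commutes' _ := rfl

/-- Commutativity of products of algebras. -/
def prodCommAlgEquiv (R A B : Type*) [CommSemiring R] [CommRing A] [CommRing B]
    [Algebra R A] [Algebra R B] : (A × B) ≃ₐ[R] B × A where
  __ := Equiv.prodComm A B
  map_mul' _ _ := rfl
  map_add' _ _ := rfl
  commutes' _ := rfl

theorem nonempty_quadAlg_one (K : Fld.{u}) : Nonempty (QuadAlg K 1 ≃ₐ[K] K × K) := by
  let f : QuadAlg K 1 →ₐ[K] K × K := AdjoinRoot.liftAlgHom _ (Algebra.ofId K (K × K)) (1, -1) (by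
    ext <;> simp)
  have hf : ∀ c d : K, f (AdjoinRoot.of _ c + AdjoinRoot.of _ d * AdjoinRoot.root _) =
      (c + d, c - d) := fun c d => by
    rw [map_add, map_mul, AdjoinRoot.liftAlgHom_of, AdjoinRoot.liftAlgHom_of,
      AdjoinRoot.liftAlgHom_root]
    ext <;> simp [Algebra.ofId_apply, sub_eq_add_neg]
  have hinj : Function.Injective f := by
    rw [injective_iff_map_eq_zero]
    intro x hx
    obtain ⟨c, d, rfl⟩ := QuadExt.exists_eq ((1 : Kˣ) : K) x
    rw [hf, Prod.mk_eq_zero] at hx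
    have h2 := K.two_ne_zero
    have hc : c = 0 := by
      have : 2 * c = 0 := by linear_combination hx.1 + hx.2
      exact (mul_eq_zero.1 this).resolve_left h2
    have hd : d = 0 := by
      rw [hc, zero_add] at hx
      exact hx.1
    rw [hc, hd, map_zero, zero_mul, add_zero]
  exact ⟨AlgEquiv.ofBijective f ⟨hinj, (LinearMap.injective_iff_surjective_of_finrank_eq_finrank
    (f := f.toLinearMap) (by rw [finrank_quadAlg, finrank_prod, finrank_self])).1 hinj⟩⟩

variable {K : Fld.{u}} {A B : Type u} [CommRing A] [Algebra K A] [CommRing B] [Algebra K B]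

theorem IsMultiquad.congr (h : IsMultiquad K A) (e : A ≃ₐ[K] B) : IsMultiquad K B := by
  obtain ⟨ι, _, r, a, hr, ⟨f⟩⟩ := h
  exact ⟨ι, inferInstance, r, a, hr, ⟨e.symm.trans f⟩⟩

theorem IsMultiquad.quad_prod (h : IsMultiquad K A) (a : Kˣ) : IsMultiquad K (QuadAlg K a × A) := by
  obtain ⟨ι, _, r, b, hr, ⟨f⟩⟩ := h
  let e := piOptionAlgEquiv K fun o : Option ι => QuadAlg K (o.elim a b)
  exact ⟨Option ι, inferInstance, r, fun o => o.elim a b, hr,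
    ⟨((AlgEquiv.prodCongr AlgEquiv.refl f).trans (prodAssocAlgEquiv K _ _ _).symm).trans
      (AlgEquiv.prodCongr e.symm AlgEquiv.refl)⟩⟩

/-- Two copies of K are traded for K[x]/(x² - 1), so at most one copy is ever left over. -/
theorem IsMultiquad.self_prod (h : IsMultiquad K A) : IsMultiquad K (K × A) := by
  obtain ⟨ι, _, r, b, hr, ⟨f⟩⟩ := h
  rcases Nat.le_one_iff_eq_zero_or_eq_one.1 hr with rfl | rfl
  · exact ⟨ι, inferInstance, 1, b, le_rfl, ⟨(AlgEquiv.prodCongr AlgEquiv.refl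
      (f.trans AlgEquiv.prodUnique)).trans ((prodCommAlgEquiv K _ _).trans
      (AlgEquiv.prodCongr AlgEquiv.refl (AlgEquiv.funUnique K (Fin 1) K).symm))⟩⟩
  · obtain ⟨g⟩ := nonempty_quadAlg_one K
    have h1 : IsMultiquad K (∀ j, QuadAlg K (b j)) :=
      ⟨ι, inferInstance, 0, b, zero_le_one, ⟨AlgEquiv.prodUnique.symm⟩⟩
    refine (h1.quad_prod 1).congr ?_
    refine (AlgEquiv.prodCongr g AlgEquiv.refl).trans ((prodAssocAlgEquiv K _ _ _).trans
      (AlgEquiv.prodCongr AlgEquiv.refl ?_))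
    exact (prodCommAlgEquiv K _ _).trans ((AlgEquiv.prodCongr AlgEquiv.refl
      (AlgEquiv.funUnique K (Fin 1) K).symm).trans f.symm)

theorem IsMultiquad.of_pi (I : Type u) [Finite I] : ∀ (A : I → Type u) [∀ i, Field (A i)]
    [∀ i, Algebra K (A i)] [∀ i, FiniteDimensional K (A i)] (_ : ∀ i, finrank K (A i) ≤ 2),
    IsMultiquad K (∀ i, A i) := by
  induction I using Finite.induction_empty_option with
  | of_equiv e h =>
    intro A _ _ _ hA
    exact (h (fun i => A (e i)) fun i => hA _).congr (AlgEquiv.piCongrLeft K A e)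
  | h_empty =>
    intro A _ _ _ hA
    refine ⟨PEmpty, inferInstance, 0, PEmpty.elim, zero_le_one, ⟨?_⟩⟩
    exact
      { toFun := fun _ => (fun j => j.elim, Fin.elim0)
        invFun := fun _ i => i.elim
        left_inv := fun _ => Subsingleton.elim _ _
        right_inv := fun _ => Subsingleton.elim _ _
        map_mul' := fun _ _ => Subsingleton.elim _ _
        map_add' := fun _ _ => Subsingleton.elim _ _
        commutes' := fun _ => Subsingleton.elim _ _ }
  | h_option h =>
    intro A _ _ _ hA
    have h1 := h (fun i => A (some i)) fun i => hA _
    have h2 : 0 < finrank K (A none) := finrank_pos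
    rcases (by have := hA none; omega : finrank K (A none) = 1 ∨ finrank K (A none) = 2) with h3 | h3
    · have e : (A none) ≃ₐ[K] K := (AlgEquiv.ofBijective (Algebra.ofId K (A none)) (by
        rw [← Subalgebra.bot_eq_top_iff_finrank_eq_one] at h3
        exact Algebra.bijective_algebraMap_iff.2 h3.symm)).symm
      exact h1.self_prod.congr ((AlgEquiv.prodCongr e.symm AlgEquiv.refl).trans
        (piOptionAlgEquiv K A).symm)
    · obtain ⟨y, b, hy, hy'⟩ := exists_sq_of_finrank_eq_two K.two_ne_zero h3
      obtain ⟨f, hf⟩ := bijective_lift_quadExt h3 hy hy'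
      have hb0 : b ≠ 0 := by
        rintro rfl
        rw [map_zero, sq_eq_zero_iff] at hy
        exact hy' ⟨0, by rw [map_zero, hy]⟩
      exact (h1.quad_prod (Units.mk0 b hb0)).congr ((AlgEquiv.prodCongr
        (AlgEquiv.ofBijective f hf) AlgEquiv.refl).trans (piOptionAlgEquiv K A).symm)

theorem IsMultiquad.exists_mk_eq {n : ℕ} {E : EtAlg n K} (h : IsMultiquad K E) :
    ∃ a, Et.mk E = Et.mk (multiquad K n a) := by
  obtain ⟨ι, _, r, a, hr, ⟨f⟩⟩ := h
  have h1 := f.toLinearEquiv.finrank_eq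
  rw [E.finrank_eq, finrank_prod, finrank_pi_fintype] at h1
  simp only [finrank_quadAlg, Finset.sum_const, Finset.card_univ, finrank_fin_fun, smul_eq_mul]
    at h1
  -- With r at most 1, the parity of the rank determines r.
  obtain rfl : r = n - 2 * (n / 2) := by omega
  let e : ι ≃ Fin (n / 2) := Fintype.equivFinOfCardEq (by omega)
  exact ⟨fun j => a (e.symm j), Quotient.sound ⟨f.trans (AlgEquiv.prodCongr
    (AlgEquiv.piCongrLeft' K (fun j => QuadAlg K (a j)) e) AlgEquiv.refl)⟩⟩

/-- The splitting principle: an invariant is determined by its values on multiquadratic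
algebras. -/
theorem eq_zero_of_multiquad {n : ℕ} (α : Inv.{u} n)
    (h : ∀ (K : Fld.{u}) (a : Fin (n / 2) → Kˣ), α.1 K (Et.mk (multiquad K n a)) = 0) :
    α = 0 := by
  -- The induction runs over all fields at once, because enlarging the base field is what creates
  -- idempotents.
  have main : ∀ (N : ℕ) (K : Fld.{u}) (E : EtAlg n K), 2 ^ n - numIdem E = N →
      α.1 K (Et.mk E) = 0 := by
    intro N
    induction N using Nat.strong_induction_on with
    | _ N ih => ?_
    intro K E hN
    have ih' : ∀ (L : Fld.{u}) (E' : EtAlg n L), numIdem E < numIdem E' →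
        α.1 L (Et.mk E') = 0 := fun L E' hlt => by
      have := E'.finite_idem_and_le.2
      exact ih _ (by omega) L E' rfl
    obtain ⟨I, _, A, _, _, e, hA⟩ := (Algebra.Etale.iff_exists_algEquiv_prod (K := K) (A := E)).1
      inferInstance
    have := fun i => (hA i).1
    have := fun i => (hA i).2
    by_cases h2 : ∀ i, finrank K (A i) ≤ 2
    · obtain ⟨a, ha⟩ := ((IsMultiquad.of_pi I A h2).congr e.symm).exists_mk_eq
      rw [ha, h]
    · push Not at h2
      obtain ⟨i, hi⟩ := h2
      classical
      let σ : Option {j // j ≠ i} ≃ I := Equiv.optionSubtypeNe i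
      let g : E ≃ₐ[K] A i × ∀ j : {j // j ≠ i}, A j := (e.trans
        (AlgEquiv.piCongrLeft K A σ).symm).trans (piOptionAlgEquiv K fun o => A (σ o))
      have he : ∀ i, Algebra.Etale K (A i) := fun i => etale_of_isSeparable (A i)
      let E1 : EtAlg (finrank K (A i)) K := { carrier := A i, finrank_eq := rfl }
      let S : EtAlg (finrank K (∀ j : {j // j ≠ i}, A j)) K :=
        { carrier := ∀ j : {j // j ≠ i}, A j, finrank_eq := rfl }
      have hn : finrank K (A i) + finrank K (∀ j : {j // j ≠ i}, A j) = n := by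
        rw [← finrank_prod, ← g.toLinearEquiv.finrank_eq, E.finrank_eq]
      have h3 : numIdem E = numIdem (A i) * numIdem S :=
        (numIdem_congr g.toRingEquiv).trans numIdem_prod
      have h4 : numIdem (A i) ≤ 2 := numIdem_le_two
      -- E has at most twice as many idempotents as S, so `ih'` applies to every algebra with more
      -- than that.
      have h5 := eq_zero_of_prod α K hn E1 S (Field.toIsField (A i)) hi fun L E' hlt =>
        ih' L E' (by nlinarith)
      rw [← h5]
      exact congrArg _ (Quotient.sound ⟨g⟩)
  refine Subtype.ext (funext fun K => funext fun x => ?_)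
  induction x using Quotient.ind with
  | _ E => exact main _ K E rfl

end Splitting

/-! ### Exterior powers of diagonal trace forms -/

section ExteriorDiagonal

open Module Polynomial

theorem coeff_prod_one_add {R ι : Type*} [CommRing R] [Fintype ι] (x : ι → R) (i : ℕ) :
    (∏ j, (1 + C (x j) * X)).coeff i = ∑ J ∈ Finset.powersetCard i Finset.univ, ∏ j ∈ J, x j := by
  classical
  rw [Finset.prod_one_add, finsetSum_coeff, Finset.powersetCard_eq_filter, Finset.sum_filter]
  refine Finset.sum_congr rfl fun J _ => ?_
  rw [Finset.prod_mul_distrib, Finset.prod_const, ← map_prod, coeff_C_mul, coeff_X_pow, mul_ite,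
    mul_one, mul_zero]
  simp only [eq_comm]

theorem elemSymm_eq_coeff {R : Type*} [CommRing R] {m : ℕ} (i : ℕ) (x : Fin m → R) :
    elemSymm i x = (∏ j, (1 + C (x j) * X)).coeff i := (coeff_prod_one_add x i).symm

variable {n : ℕ} {K : Type u} [Field K]

/-- The elements of the basis are orthogonal for the trace form, with squares of trace `d i`. -/
def IsTraceDiag {A : Type*} [CommRing A] [Algebra K A] {ι : Type*} [DecidableEq ι]
    (v : Basis ι K A) (d : ι → Kˣ) : Prop :=
  ∀ i j, Algebra.trace K A (v i * v j) = if i = j then (d i : K) else 0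

theorem IsTraceDiag.reindex {A : Type*} [CommRing A] [Algebra K A] {ι κ : Type*} [DecidableEq ι]
    [DecidableEq κ] {v : Basis ι K A} {d : ι → Kˣ} (h : IsTraceDiag v d) (e : ι ≃ κ) :
    IsTraceDiag (v.reindex e) (d ∘ e.symm) := fun i j => by
  simp [h _ _]

theorem IsTraceDiag.toMatrix {A : Type*} [CommRing A] [Algebra K A] {ι : Type*} [Fintype ι]
    [DecidableEq ι] {v : Basis ι K A} {d : ι → Kˣ} (h : IsTraceDiag v d) :
    LinearMap.BilinForm.toMatrix v (Algebra.traceForm K A) =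
      Matrix.diagonal fun i => (d i : K) := by
  ext i j
  rw [LinearMap.BilinForm.toMatrix_apply, Algebra.traceForm_apply, h, Matrix.diagonal_apply]

theorem IsTraceDiag.mk_trace {E : EtAlg n K} {ι : Type*} [Fintype ι] [DecidableEq ι]
    {v : Basis ι K E} {d : ι → Kˣ} (h : IsTraceDiag v d) :
    W.mk E.trace = ∑ i, W.diag (d i) := by
  rw [EtAlg.trace, bilinClass_eq_cls v]
  simp only [h.toMatrix]
  rw [cls_diagonal, map_sum]
  rfl

/-- The entries are minors of a diagonal matrix. For s ≠ t an element of s outside t gives a zero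
column; for s = t the minor is itself diagonal. -/
theorem IsTraceDiag.toMatrix_extForm {E : EtAlg n K} {m : ℕ} {v : Basis (Fin m) K E}
    {d : Fin m → Kˣ} (h : IsTraceDiag v d) (i : ℕ) :
    LinearMap.BilinForm.toMatrix (v.exteriorPower i) (extForm i (Algebra.traceForm K E)) =
      Matrix.diagonal fun s : Set.powersetCard (Fin m) i => ((∏ j ∈ s.1, d j : Kˣ) : K) := by
  ext s t
  rw [WittInv.toMatrix_extForm, h.toMatrix, Matrix.diagonal_apply]
  split_ifs with hst
  · subst hst
    have : (Matrix.of fun r r' : Fin i => Matrix.diagonal (fun i => (d i : K))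
        (Set.powersetCard.ofFinEmbEquiv.symm s r') (Set.powersetCard.ofFinEmbEquiv.symm s r)) =
        Matrix.diagonal fun r => (d (Set.powersetCard.ofFinEmbEquiv.symm s r) : K) := by
      ext r r'
      rw [Matrix.of_apply, Matrix.diagonal_apply, Matrix.diagonal_apply]
      rcases eq_or_ne r r' with rfl | hr
      · simp
      · rw [if_neg hr, if_neg]
        exact fun heq => hr ((Set.powersetCard.ofFinEmbEquiv.symm s).injective heq).symm
    rw [this, Matrix.det_diagonal, Units.coe_prod]
    conv_rhs => rw [← Finset.map_orderEmbOfFin_univ s.1 s.2, Finset.prod_map]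
    rfl
  · obtain ⟨a, ha, hat⟩ := (Set.powersetCard.exists_mem_notMem_iff_ne s t).1 hst
    obtain ⟨k, rfl⟩ := (Set.powersetCard.mem_range_ofFinEmbEquiv_symm_iff_mem s a).2 ha
    refine Matrix.det_eq_zero_of_column_eq_zero k fun r => ?_
    rw [Matrix.of_apply, Matrix.diagonal_apply_ne]
    intro heq
    exact hat ((Set.powersetCard.mem_range_ofFinEmbEquiv_symm_iff_mem t _).1 ⟨r, heq.symm⟩)

theorem W.diag_prod {ι : Type*} (s : Finset ι) (d : ι → Kˣ) :
    W.diag (∏ j ∈ s, d j) = ∏ j ∈ s, W.diag (d j) :=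
  map_prod ({ toFun := W.diag, map_one' := W.diag_one, map_mul' := W.diag_mul } : Kˣ →* W K) d s

/-- The exterior powers of a diagonal form are the elementary symmetric polynomials in its entries.
Their generating polynomial turns orthogonal sums into products. -/
theorem IsTraceDiag.mk_extTrace {E : EtAlg n K} {ι : Type*} [Fintype ι] [DecidableEq ι]
    {v : Basis ι K E} {d : ι → Kˣ} (h : IsTraceDiag v d) (i : ℕ) :
    W.mk (E.extTrace i) = (∏ j, (1 + C (W.diag (d j)) * X)).coeff i := by
  have hfin : ∀ {m : ℕ} {v : Basis (Fin m) K E} {d : Fin m → Kˣ}, IsTraceDiag v d →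
      W.mk (E.extTrace i) = (∏ j, (1 + C (W.diag (d j)) * X)).coeff i := by
    intro m v d h
    rw [EtAlg.extTrace, bilinClass_eq_cls (v.exteriorPower i)]
    simp only [h.toMatrix_extForm]
    rw [cls_diagonal, map_sum, coeff_prod_one_add, Finset.sum_subtype (p := fun J => J ∈ Set.powersetCard (Fin m) i)
      _ (fun J => by rw [Finset.mem_powersetCard_univ, Set.powersetCard.mem_iff])]
    exact Finset.sum_congr rfl fun J _ => W.diag_prod J.1 d
  rw [hfin (h.reindex (Fintype.equivFin ι))]
  congr 1
  exact (Fintype.equivFin ι).symm.prod_comp fun j => 1 + C (W.diag (d j)) * X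

/-! ### Trace forms of products -/

theorem trace_eq_sum_repr {A : Type*} [CommRing A] [Algebra K A] {ι : Type*} [Fintype ι]
    (v : Basis ι K A) (x : A) : Algebra.trace K A x = ∑ i, v.repr (x * v i) i := by
  classical
  rw [Algebra.trace_eq_matrix_trace v, Matrix.trace]
  exact Finset.sum_congr rfl fun i _ => Algebra.leftMulMatrix_eq_repr_mul v x i i

theorem IsTraceDiag.prod {A B : Type*} [CommRing A] [Algebra K A] [CommRing B] [Algebra K B]
    {ι κ : Type*} [Fintype ι] [Fintype κ] [DecidableEq ι] [DecidableEq κ] {v : Basis ι K A}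
    {w : Basis κ K B} {d : ι → Kˣ} {d' : κ → Kˣ} (h : IsTraceDiag v d) (h' : IsTraceDiag w d') :
    IsTraceDiag (v.prod w) (Sum.elim d d') := by
  have ht : ∀ x : A × B, Algebra.trace K (A × B) x =
      Algebra.trace K A x.1 + Algebra.trace K B x.2 := fun x => by
    rw [trace_eq_sum_repr (v.prod w), trace_eq_sum_repr v, trace_eq_sum_repr w, Fintype.sum_sum_type]
    simp
  rintro (i | i) (j | j) <;> rw [ht] <;> simp [h _ _, h' _ _]

theorem IsTraceDiag.pi {J : Type*} [Fintype J] [DecidableEq J] {A : J → Type*}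
    [∀ j, CommRing (A j)] [∀ j, Algebra K (A j)] {ι : J → Type*} [∀ j, Fintype (ι j)]
    [∀ j, DecidableEq (ι j)] {v : ∀ j, Basis (ι j) K (A j)} {d : ∀ j, ι j → Kˣ}
    (h : ∀ j, IsTraceDiag (v j) (d j)) :
    IsTraceDiag (Pi.basis v) fun s => d s.1 s.2 := by
  have ht : ∀ x : ∀ j, A j, Algebra.trace K (∀ j, A j) x = ∑ j, Algebra.trace K (A j) (x j) :=
    fun x => by
    rw [trace_eq_sum_repr (Pi.basis v), Fintype.sum_sigma]
    refine Finset.sum_congr rfl fun j _ => ?_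
    rw [trace_eq_sum_repr (v j)]
    simp
  rintro ⟨i, r⟩ ⟨j, s⟩
  rw [ht, Pi.basis_apply, Pi.basis_apply, Finset.sum_eq_single i]
  · rw [Pi.mul_apply, Pi.single_eq_same]
    rcases eq_or_ne i j with rfl | hij
    · rw [Pi.single_eq_same, h]
      simp
    · rw [Pi.single_eq_of_ne hij, mul_zero, map_zero, if_neg fun heq => hij (congrArg Sigma.fst heq)]
  · intro k _ hk
    rw [Pi.mul_apply, Pi.single_eq_of_ne hk, zero_mul, map_zero]
  · simp

/-! ### Multiquadratic algebras -/

/-- The basis is 1, √a, where 1 has trace 2, √a has trace 0 and its square has trace 2a. -/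
theorem exists_isTraceDiag_quad (K : Fld.{u}) (a : Kˣ) :
    ∃ v : Basis (Fin 2) K (QuadAlg K a),
      IsTraceDiag v ![Units.mk0 2 K.two_ne_zero, Units.mk0 2 K.two_ne_zero * a] := by
  let pb := AdjoinRoot.powerBasis' (monic_X_pow_sub_C (a : K) two_ne_zero)
  have hdim : pb.dim = 2 := by simp [pb]
  let v := pb.basis.reindex (finCongr hdim)
  have hv0 : v 0 = 1 := by simp [v]
  have hv1 : v 1 = AdjoinRoot.root _ := by simp [v, pb]
  have hr : (v 1) ^ 2 = algebraMap K _ (a : K) := by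
    rw [hv1]
    exact QuadExt.root_sq (a : K)
  have ht1 : Algebra.trace K (QuadAlg K a) 1 = 2 := by
    rw [← map_one (algebraMap K (QuadAlg K a)), Algebra.trace_algebraMap, finrank_quadAlg]
    norm_num
  have hta : Algebra.trace K (QuadAlg K a) ((v 1) ^ 2) = 2 * a := by
    rw [hr, Algebra.algebraMap_eq_smul_one, map_smul, ht1, smul_eq_mul, mul_comm]
  have htr : Algebra.trace K (QuadAlg K a) (v 1) = 0 := by
    rw [trace_eq_sum_repr v, Fin.sum_univ_two, ← sq, hr, hv0, mul_one, v.repr_self,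
      Algebra.algebraMap_eq_smul_one, ← hv0, map_smul, v.repr_self]
    simp
  refine ⟨v, fun i j => ?_⟩
  fin_cases i <;> fin_cases j <;> simp [hv0, ht1, htr, ← sq, hta]

theorem mk_trace_quad (K : Fld.{u}) (a : Kˣ) : W.mk (quad K a).trace =
    W.diag (Units.mk0 2 K.two_ne_zero) + W.diag (Units.mk0 2 K.two_ne_zero * a) := by
  obtain ⟨v, hv⟩ := exists_isTraceDiag_quad K a
  rw [IsTraceDiag.mk_trace (E := quad K a) (v := v) hv, Fin.sum_univ_two]
  rfl

theorem isTraceDiag_self (K : Type u) [Field K] (r : ℕ) :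
    IsTraceDiag (Pi.basis fun _ : Fin r => Basis.singleton Unit K) fun _ => (1 : Kˣ) :=
  IsTraceDiag.pi (d := fun _ _ => 1) fun j i i' => by simp

theorem mk_extTrace_multiquad (K : Fld.{u}) (n : ℕ) (a : Fin (n / 2) → Kˣ) (i : ℕ) :
    W.mk ((multiquad K n a).extTrace i) =
      ((∏ j, ((1 + C (W.diag (Units.mk0 2 K.two_ne_zero)) * X) *
        (1 + C (W.diag (Units.mk0 2 K.two_ne_zero * a j)) * X))) *
          (1 + X : (W K)[X]) ^ (n - 2 * (n / 2))).coeff i := by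
  choose v hv using fun j => exists_isTraceDiag_quad K (a j)
  have h := (IsTraceDiag.pi hv).prod (isTraceDiag_self K (n - 2 * (n / 2)))
  rw [IsTraceDiag.mk_extTrace (E := multiquad K n a) h, Fintype.prod_sum_type, Fintype.prod_sigma]
  simp [W.diag_one]

end ExteriorDiagonal

/-! ### Identities between elementary symmetric polynomials -/

section Identities

open Polynomial

variable {R : Type*} [CommRing R] {m : ℕ}

theorem coeff_one_add_C_mul_X_pow (a : R) (N i : ℕ) :
    ((1 + C a * X) ^ N : R[X]).coeff i = a ^ i * (N.choose i : R) := by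
  have h : ((1 + C a * X) ^ N : R[X]) = ((1 + X) ^ N).comp (C a * X) := by simp
  rw [h, comp_C_mul_X_coeff, coeff_one_add_X_pow, mul_comm]

theorem prod_add_C_mul_X (A : R[X]) (z : Fin m → R) :
    ∏ j, (A + C (z j) * X) = ∑ k ∈ Finset.range (m + 1), C (elemSymm k z) * X ^ k * A ^ (m - k) := by
  have h : ∏ j, (A + C (z j) * X) = ∏ j, (C (z j) * X + A) :=
    Finset.prod_congr rfl fun j _ => add_comm _ _
  rw [h, Finset.prod_add, Finset.sum_powerset, Finset.card_univ, Fintype.card_fin]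
  refine Finset.sum_congr rfl fun k _ => ?_
  rw [elemSymm, map_sum, Finset.sum_mul, Finset.sum_mul]
  refine Finset.sum_congr rfl fun J hJ => ?_
  rw [Finset.mem_powersetCard_univ] at hJ
  rw [Finset.prod_mul_distrib, Finset.prod_const, Finset.prod_const, map_prod, hJ,
    Finset.card_sdiff_of_subset (Finset.subset_univ _), Finset.card_univ, Fintype.card_fin, hJ]

theorem coeff_sum_mul_X_pow (f : ℕ → R) (B : ℕ → R[X]) {i : ℕ} (hi : i ≤ m) :
    (∑ k ∈ Finset.range (m + 1), C (f k) * X ^ k * B k).coeff i =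
      ∑ k ∈ Finset.range (i + 1), f k * (B k).coeff (i - k) := by
  rw [finsetSum_coeff]
  symm
  refine Finset.sum_subset_zero_on_sdiff (Finset.range_mono (by omega)) ?_ ?_
  · intro k hk
    rw [Finset.mem_sdiff, Finset.mem_range, Finset.mem_range] at hk
    rw [mul_assoc, coeff_C_mul, coeff_X_pow_mul', if_neg (by omega), mul_zero]
  · intro k hk
    rw [Finset.mem_range] at hk
    rw [mul_assoc, coeff_C_mul, coeff_X_pow_mul', if_pos (by omega)]

/-- Expand the product of the factors (1 + cX) + y_j X by the number of terms y_j X chosen. -/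
theorem elemSymm_add (c : R) (y : Fin m → R) {i : ℕ} (hi : i ≤ m) :
    elemSymm i (fun j => c + y j) = ∑ j ∈ Finset.range (i + 1),
      elemSymm j y * (c ^ (i - j) * ((m - j).choose (i - j) : R)) := by
  have h : ∏ j, (1 + C (c + y j) * X) = ∏ j, ((1 + C c * X) + C (y j) * X) :=
    Finset.prod_congr rfl fun j _ => by rw [map_add]; ring
  rw [elemSymm_eq_coeff, h, prod_add_C_mul_X, coeff_sum_mul_X_pow _ _ hi]
  simp only [coeff_one_add_C_mul_X_pow]

/-- The series of (1 + aX)^(-m); the induction on m is Pascal's rule for multisets. -/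
theorem multichoose_series (a : R) (m : ℕ) :
    (PowerSeries.mk fun i => (-a) ^ i * (m.multichoose i : R)) *
      (1 + PowerSeries.C a * PowerSeries.X) ^ m = 1 := by
  induction m with
  | zero =>
    ext i
    rcases i with _ | i
    · simp
    · simp [PowerSeries.coeff_one]
  | succ m ih =>
    rw [pow_succ', ← mul_assoc]
    refine Eq.trans ?_ ih
    congr 1
    ext i
    rw [mul_add, mul_one, map_add, mul_comm (PowerSeries.C a), ← mul_assoc]
    rcases i with _ | i
    · simp
    · rw [PowerSeries.coeff_mul_C, PowerSeries.coeff_succ_mul_X, PowerSeries.coeff_mk,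
        PowerSeries.coeff_mk, PowerSeries.coeff_mk, Nat.multichoose_succ_succ]
      push_cast
      ring

/-- The product whose coefficients are the elementary symmetric polynomials of `m` times `c` and of
`y`. -/
noncomputable def quadPoly (c : R) (y : Fin m → R) : R[X] :=
  ∏ j, ((1 + C c * X) * (1 + C (y j) * X))

theorem elemSymm_eq_sum_coeff_quadPoly (c : R) (y : Fin m → R) (i : ℕ) :
    elemSymm i y = ∑ k ∈ Finset.range (i + 1),
      (quadPoly c y).coeff k * ((-c) ^ (i - k) * (m.multichoose (i - k) : R)) := by
  have h1 : quadPoly c y = (1 + C c * X) ^ m * ∏ j, (1 + C (y j) * X) := by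
    rw [quadPoly, Finset.prod_mul_distrib, Finset.prod_const, Finset.card_univ, Fintype.card_fin]
  have h2 : ((∏ j, (1 + C (y j) * X) : R[X]) : PowerSeries R) = (quadPoly c y : R[X]) *
      PowerSeries.mk fun i => (-c) ^ i * (m.multichoose i : R) := by
    rw [h1, coe_mul, coe_pow, coe_add, coe_one, coe_mul, coe_C, coe_X, mul_comm, ← mul_assoc,
      multichoose_series, one_mul]
  rw [elemSymm_eq_coeff, ← coeff_coe, h2, PowerSeries.coeff_mul,
    Finset.Nat.sum_antidiagonal_eq_sum_range_succ_mk]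
  exact Finset.sum_congr rfl fun k _ => by rw [PowerSeries.coeff_mk, coeff_coe]

/-- The expansion of the e_j(y) in the coefficients of `quadPoly` is inserted in `elemSymm_add`.
Exchanging the sums collects γ, and the powers of c combine to c^(i - k). -/
theorem elemSymm_eq_sum_gam (c : R) (y : Fin m → R) {i : ℕ} (hi : i ≤ m) :
    elemSymm i (fun j => c + y j) = ∑ k ∈ Finset.range (i + 1),
      c ^ (i - k) * (gam m i k : R) * (quadPoly c y).coeff k := by
  rw [elemSymm_add c y hi]
  simp only [elemSymm_eq_sum_coeff_quadPoly c y, Finset.sum_mul]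
  rw [Finset.sum_sigma', Finset.sum_congr (g := fun k => ∑ j ∈ Finset.Icc k i,
    (quadPoly c y).coeff k * ((-c) ^ (j - k) * (m.multichoose (j - k) : R)) *
      (c ^ (i - j) * ((m - j).choose (i - j) : R))) rfl, Finset.sum_sigma']
  · refine Finset.sum_bij' (fun p _ => ⟨p.2, p.1⟩) (fun p _ => ⟨p.2, p.1⟩) ?_ ?_ ?_ ?_ ?_ <;>
      simp <;> omega
  · intro k _
    rw [gam, Int.cast_sum, Finset.mul_sum, Finset.sum_mul]
    refine Finset.sum_congr rfl fun j hj => ?_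
    rw [Finset.mem_Icc] at hj
    rw [show i - k = (j - k) + (i - j) by omega, pow_add, neg_pow]
    push_cast
    ring

theorem del_natCast (m i k : ℕ) : del m i k = ∑ j ∈ Finset.Icc k i,
    (-1) ^ (j - k) * ((m - k).choose (j - k) : ℤ) * (m.choose (i - j) : ℤ) := by
  rw [del]
  refine Finset.sum_bij' (fun j _ => j.toNat) (fun j _ => (j : ℤ)) ?_ ?_ ?_ ?_ ?_
  any_goals simp only [Finset.mem_Icc]; omega
  intro j hj
  rw [Finset.mem_Icc] at hj
  rw [show (j - (k : ℤ)).toNat = j.toNat - k by omega,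
    show ((i : ℤ) - j).toNat = i - j.toNat by omega]

theorem del_eq_zero {m k : ℕ} {i : ℤ} (h : i < k) : del m i k = 0 := by
  rw [del, Finset.Icc_eq_empty (by omega), Finset.sum_empty]

/-- From 1 + y_j X = (1 - cX) + (c + y_j)X, choosing the second term k times leaves (1 + cX)^m (1 -
cX)^(m - k). Its coefficient of X^(i - k) is c^(i - k) δ. -/
theorem coeff_quadPoly (c : R) (y : Fin m → R) {i : ℕ} (hi : i ≤ m) :
    (quadPoly c y).coeff i = ∑ k ∈ Finset.range (i + 1),
      c ^ (i - k) * (del m i k : R) * elemSymm k (fun j => c + y j) := by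
  have h : quadPoly c y = (1 + C c * X) ^ m * ∏ j, ((1 + C (-c) * X) + C (c + y j) * X) := by
    have hm : (1 + C c * X : R[X]) ^ m = ∏ _j : Fin m, (1 + C c * X) := by simp
    rw [hm, ← Finset.prod_mul_distrib, quadPoly]
    refine Finset.prod_congr rfl fun j _ => ?_
    rw [map_add, map_neg]
    ring
  rw [h, prod_add_C_mul_X, Finset.mul_sum, Finset.sum_congr rfl fun k _ => mul_left_comm _ _ _,
    coeff_sum_mul_X_pow _ _ hi]
  refine Finset.sum_congr rfl fun k hk => ?_
  rw [Finset.mem_range] at hk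
  rw [mul_comm ((1 + C c * X) ^ m), coeff_mul, Finset.Nat.sum_antidiagonal_eq_sum_range_succ_mk,
    del_natCast, ← Finset.Ico_add_one_right_eq_Icc, Finset.sum_Ico_eq_sum_range, mul_comm,
    show i + 1 - k = (i - k).succ by omega, Int.cast_sum, Finset.mul_sum]
  congr 1
  refine Finset.sum_congr rfl fun l hl => ?_
  rw [Finset.mem_range] at hl
  rw [coeff_one_add_C_mul_X_pow, coeff_one_add_C_mul_X_pow, show k + l - k = l by omega,
    show i - (k + l) = i - k - l by omega, neg_pow]
  have hpow : c ^ (i - k) = c ^ l * c ^ (i - k - l) := by rw [← pow_add]; congr 1; omega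
  rw [hpow]
  push_cast
  ring

end Identities

/-! ### The invariants on multiquadratic algebras -/

section Restriction

variable {n : ℕ}

/-- Evaluation of invariants. -/
noncomputable def Inv.eval (K : Fld.{u}) (x : Et n K) : Inv.{u} n →+* W K :=
  ((Pi.evalRingHom (fun _ : Et n K => W K) x).comp
    (Pi.evalRingHom (fun K : Fld.{u} => Et n K → W K) K)).comp (Inv.{u} n).subtype

theorem Inv.eq_of_eval {α β : Inv.{u} n} (h : ∀ (K : Fld.{u}) (a : Fin (n / 2) → Kˣ),
    Inv.eval K (Et.mk (multiquad K n a)) α = Inv.eval K (Et.mk (multiquad K n a)) β) : α = β :=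
  sub_eq_zero.1 (eq_zero_of_multiquad (α - β) fun K a => sub_eq_zero.2 (h K a))

/-- The class `⟨2⟩`. -/
noncomputable def twoClass (K : Fld.{u}) : W K := W.diag (Units.mk0 2 K.two_ne_zero)

theorem twoClass_sq (K : Fld.{u}) : twoClass K ^ 2 = 1 := by
  have h := FormClass.diag_mul_sq 1 (Units.mk0 (2 : K) K.two_ne_zero)
  rw [sq, twoClass, ← W.diag_mul, ← sq, ← one_mul (_ ^ 2), ← W.diag_one]
  exact congrArg W.mk h

variable (K : Fld.{u}) (a : Fin (n / 2) → Kˣ)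

/-- The classes `⟨2 a_j⟩`. -/
noncomputable def twoMulClass : Fin (n / 2) → W K :=
  fun j => W.diag (Units.mk0 2 K.two_ne_zero * a j)

theorem eval_two (x : Et n K) (e : ℕ) : Inv.eval K x (two n e) = twoClass K ^ e :=
  map_pow ({ toFun := W.diag, map_one' := W.diag_one, map_mul' := W.diag_mul } : Kˣ →* W K) _ e

theorem isBeta_iff (i : ℕ) (b : Inv.{u} n) : IsBeta n i b ↔
    ∀ (K : Fld.{u}) (a : Fin (n / 2) → Kˣ), Inv.eval K (Et.mk (multiquad K n a)) b =
      elemSymm i fun j => twoClass K + twoMulClass K a j := by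
  simp only [IsBeta, mk_trace_quad]
  rfl

theorem eval_lam (i : ℕ) : Inv.eval K (Et.mk (multiquad K n a)) (lam n i) =
    (quadPoly (twoClass K) (twoMulClass K a) * (1 + Polynomial.X) ^ (n - 2 * (n / 2))).coeff i :=
  mk_extTrace_multiquad K n a i

theorem eval_lam_of_even (h : n = 2 * (n / 2)) (i : ℕ) :
    Inv.eval K (Et.mk (multiquad K n a)) (lam n i) =
      (quadPoly (twoClass K) (twoMulClass K a)).coeff i := by
  rw [eval_lam, show n - 2 * (n / 2) = 0 by omega, pow_zero, mul_one]

theorem eval_lam_zero_of_odd (h : n = 2 * (n / 2) + 1) :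
    Inv.eval K (Et.mk (multiquad K n a)) (lam n 0) =
      (quadPoly (twoClass K) (twoMulClass K a)).coeff 0 := by
  rw [eval_lam, show n - 2 * (n / 2) = 1 by omega, pow_one]
  simp

theorem eval_lam_succ_of_odd (h : n = 2 * (n / 2) + 1) (i : ℕ) :
    Inv.eval K (Et.mk (multiquad K n a)) (lam n (i + 1)) =
      (quadPoly (twoClass K) (twoMulClass K a)).coeff (i + 1) +
        (quadPoly (twoClass K) (twoMulClass K a)).coeff i := by
  rw [eval_lam, show n - 2 * (n / 2) = 1 by omega, pow_one, mul_add, mul_one, Polynomial.coeff_add,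
    Polynomial.coeff_mul_X]

/-- This is division by 1 + X: for odd rank each λ is a sum of two consecutive coefficients, which
alternating sums undo. -/
theorem sum_eval_lam_of_odd (h : n = 2 * (n / 2) + 1) (i : ℕ) :
    ∑ k ∈ Finset.range (i + 1), (-1) ^ (i - k) * Inv.eval K (Et.mk (multiquad K n a)) (lam n k) =
      (quadPoly (twoClass K) (twoMulClass K a)).coeff i := by
  induction i with
  | zero => simp [eval_lam_zero_of_odd K a h]
  | succ i ih =>
    have h1 : ∑ k ∈ Finset.range (i + 1),
        (-1) ^ (i + 1 - k) * Inv.eval K (Et.mk (multiquad K n a)) (lam n k) =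
        -(quadPoly (twoClass K) (twoMulClass K a)).coeff i := by
      rw [← ih, ← Finset.sum_neg_distrib]
      refine Finset.sum_congr rfl fun k hk => ?_
      rw [Finset.mem_range] at hk
      rw [show i + 1 - k = (i - k) + 1 by omega, pow_succ]
      ring
    rw [Finset.sum_range_succ, h1, eval_lam_succ_of_odd K a h, Nat.sub_self, pow_zero]
    ring

/-- There is an invariant that restricts to the coefficients of `quadPoly`. -/
theorem exists_eval_eq_coeff (n i : ℕ) : ∃ b : Inv.{u} n, ∀ (K : Fld.{u}) (a : Fin (n / 2) → Kˣ),
    Inv.eval K (Et.mk (multiquad K n a)) b =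
      (quadPoly (twoClass K) (twoMulClass K a)).coeff i := by
  rcases Nat.even_or_odd' n with ⟨m, h | h⟩
  · exact ⟨lam n i, fun K a => eval_lam_of_even K a (by omega) i⟩
  · refine ⟨∑ k ∈ Finset.range (i + 1), (-1) ^ (i - k) * lam n k, fun K a => ?_⟩
    rw [← sum_eval_lam_of_odd K a (by omega) i, map_sum]
    simp only [map_mul, map_pow, map_neg, map_one]

/-- The γ-formula defines the invariant, from invariants that restrict to the coefficients of
`quadPoly`. Uniqueness is the splitting principle. -/
theorem existsUnique_isBeta {i : ℕ} (hi : i ≤ n / 2) : ∃! b : Inv.{u} n, IsBeta n i b := by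
  choose l hl using exists_eval_eq_coeff.{u} n
  refine existsUnique_of_exists_of_unique
    ⟨∑ k ∈ Finset.range (i + 1), two n (i - k) * (gam (n / 2) i k : Inv.{u} n) * l k, ?_⟩ ?_
  · refine (isBeta_iff i _).2 fun K a => ?_
    rw [map_sum, elemSymm_eq_sum_gam _ _ hi]
    simp only [map_mul, map_intCast, eval_two, hl]
  · intro b b' hb hb'
    exact Inv.eq_of_eval fun K a =>
      ((isBeta_iff i b).1 hb K a).trans ((isBeta_iff i b').1 hb' K a).symm

/-! ### The change of basis -/

variable {β : ℕ → Inv.{u} n} {i : ℕ}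

theorem beta_eq_of_even (h : n = 2 * (n / 2)) (hi : i ≤ n / 2) (hβ : IsBeta n i (β i)) :
    β i = ∑ k ∈ Finset.range (i + 1),
      two n (i - k) * (gam (n / 2) i k : Inv.{u} n) * lam n k := by
  refine Inv.eq_of_eval fun K a => ?_
  rw [(isBeta_iff i _).1 hβ, map_sum, elemSymm_eq_sum_gam _ _ hi]
  simp only [map_mul, map_intCast, eval_two, eval_lam_of_even K a h]

theorem lam_eq_of_even (h : n = 2 * (n / 2)) (hi : i ≤ n / 2)
    (hβ : ∀ i ≤ n / 2, IsBeta n i (β i)) :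
    lam n i = ∑ k ∈ Finset.range (i + 1),
      two n (i - k) * (del (n / 2) i k : Inv.{u} n) * β k := by
  refine Inv.eq_of_eval fun K a => ?_
  rw [map_sum, eval_lam_of_even K a h, coeff_quadPoly _ _ hi]
  refine Finset.sum_congr rfl fun k hk => ?_
  rw [Finset.mem_range] at hk
  rw [map_mul, map_mul, map_intCast, eval_two, (isBeta_iff k _).1 (hβ k (by omega))]

theorem beta_eq_of_odd (h : n = 2 * (n / 2) + 1) (hi : i ≤ n / 2) (hβ : IsBeta n i (β i)) :
    β i = ∑ k ∈ Finset.range (i + 1), (∑ u ∈ Finset.Icc k i, (-1) ^ (u - k) * two n (i - u) *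
      (gam (n / 2) i u : Inv.{u} n)) * lam n k := by
  refine Inv.eq_of_eval fun K a => ?_
  rw [(isBeta_iff i _).1 hβ, map_sum, elemSymm_eq_sum_gam _ _ hi]
  simp only [map_mul, map_sum, map_pow, map_neg, map_one, map_intCast, eval_two,
    ← sum_eval_lam_of_odd K a h, Finset.mul_sum, Finset.sum_mul]
  rw [Finset.sum_sigma', Finset.sum_sigma']
  refine Finset.sum_bij' (fun p _ => ⟨p.2, p.1⟩) (fun p _ => ⟨p.2, p.1⟩) ?_ ?_ ?_ ?_ ?_
  any_goals simp; done
  any_goals simp; omega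
  rintro ⟨k, l⟩ -
  ring

theorem lam_eq_of_odd (h : n = 2 * (n / 2) + 1) (hi : i ≤ n / 2)
    (hβ : ∀ i ≤ n / 2, IsBeta n i (β i)) :
    lam n i = ∑ k ∈ Finset.range (i + 1), two n (i - k) * ((del (n / 2) i k : Inv.{u} n) +
      two n 1 * (del (n / 2) ((i : ℤ) - 1) k : Inv.{u} n)) * β k := by
  refine Inv.eq_of_eval fun K a => ?_
  rw [map_sum]
  have h1 : ∀ k ∈ Finset.range (i + 1), Inv.eval K (Et.mk (multiquad K n a))
      (two n (i - k) * ((del (n / 2) i k : Inv.{u} n) +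
        two n 1 * (del (n / 2) ((i : ℤ) - 1) k : Inv.{u} n)) * β k) =
      twoClass K ^ (i - k) * (del (n / 2) i k : W K) *
        elemSymm k (fun j => twoClass K + twoMulClass K a j) +
      twoClass K ^ (i - k) * twoClass K * (del (n / 2) ((i : ℤ) - 1) k : W K) *
        elemSymm k (fun j => twoClass K + twoMulClass K a j) := fun k hk => by
    rw [Finset.mem_range] at hk
    simp only [map_mul, map_add, map_intCast, eval_two, (isBeta_iff k _).1 (hβ k (by omega))]
    ring
  rw [Finset.sum_congr rfl h1, Finset.sum_add_distrib, ← coeff_quadPoly _ _ hi]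
  rcases i with _ | i
  -- For i = 0 the second δ has index -1 and vanishes.
  · rw [eval_lam_zero_of_odd K a h]
    simp [del_eq_zero]
  · rw [eval_lam_succ_of_odd K a h, Finset.sum_range_succ, del_eq_zero (i := ((i + 1 : ℕ) : ℤ) - 1)
      (by omega), Int.cast_zero, mul_zero, zero_mul, add_zero, coeff_quadPoly _ _ (i := i) (by omega)]
    congr 1
    refine Finset.sum_congr rfl fun k hk => ?_
    rw [Finset.mem_range] at hk
    -- The relation ⟨2⟩² = 1 turns the factor ⟨2⟩ of the statement into a lowering of the exponent.
    have h3 : twoClass K ^ (i + 1 - k) * twoClass K = twoClass K ^ (i - k) := by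
      rw [show i + 1 - k = (i - k) + 1 by omega, pow_succ, mul_assoc, ← sq, twoClass_sq, mul_one]
    rw [h3, show ((i + 1 : ℕ) : ℤ) - 1 = (i : ℕ) by omega]

end Restriction

end WittInv

theorem mainTheorem12 (n : ℕ) (hn : 1 ≤ n) :
    (∀ i ≤ n / 2, ∃! b : WittInv.Inv.{u} n, WittInv.IsBeta n i b) ∧
    ∀ β : ℕ → WittInv.Inv.{u} n, (∀ i ≤ n / 2, WittInv.IsBeta n i (β i)) →
      (∀ m : ℕ, n = 2 * m → ∀ i ≤ m,
        β i = ∑ k ∈ Finset.range (i + 1),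
          WittInv.two n (i - k) * (WittInv.gam m i k : WittInv.Inv.{u} n) * WittInv.lam n k ∧
        WittInv.lam n i = ∑ k ∈ Finset.range (i + 1),
          WittInv.two n (i - k) * (WittInv.del m i k : WittInv.Inv.{u} n) * β k) ∧
      (∀ m : ℕ, n = 2 * m + 1 → ∀ i ≤ m,
        β i = ∑ k ∈ Finset.range (i + 1),
          (∑ u ∈ Finset.Icc k i, (-1) ^ (u - k) * WittInv.two n (i - u) *
            (WittInv.gam m i u : WittInv.Inv.{u} n)) * WittInv.lam n k ∧
        WittInv.lam n i = ∑ k ∈ Finset.range (i + 1),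
          WittInv.two n (i - k) * ((WittInv.del m i k : WittInv.Inv.{u} n) +
            WittInv.two n 1 * (WittInv.del m ((i : ℤ) - 1) k : WittInv.Inv.{u} n)) * β k) := by
  refine ⟨fun i hi => WittInv.existsUnique_isBeta hi, fun β hβ => ⟨fun m hm i hi => ?_,
    fun m hm i hi => ?_⟩⟩
  · obtain rfl : m = n / 2 := by omega
    exact ⟨WittInv.beta_eq_of_even hm hi (hβ i hi), WittInv.lam_eq_of_even hm hi hβ⟩
  · obtain rfl : m = n / 2 := by omega
    exact ⟨WittInv.beta_eq_of_odd hm hi (hβ i hi), WittInv.lam_eq_of_odd hm hi hβ⟩
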